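/- Let $X$ be the total space of $\mathcal O(-1)\oplus\mathcal O(-1)$ over $\mathbb P^1$, i.e. the set of triples $(\ell,v_1,v_2)$ with $\ell\subset\mathbb C^2$ a line and $v_1=(\xi_1,\eta_1),\ v_2=(\xi_2,\eta_2)\in\ell$, with its complex structure given by the charts $(z,\xi_1,\xi_2)$ over $\{z\neq\infty\}$ and $(1/z,\eta_1,\eta_2)$ over $\{z\ne 0\}$, where $\ell=[z_1:z_2]$, $z=z_2/z_1$ and $\eta_j=z\xi_j$. Let $E=\{v_1=v_2=0\}\cong\mathbb P^1$ be the zero section, $\Sigma_1=\{v_1=0\}$ (the hypersurface $\{\xi_1=0\}$ of the first chart, $\{\eta_1=0\}$ of the second), $D=X\setminus\Sigma_1$, and $f=e^{\xi_2/\xi_1}=e^{\eta_2/\eta_1}$ on $D$. For $t\in[0,1]$ let $$C_t=\{|\xi_1|<1,\ \eta_1=t,\ \xi_2=\eta_2=0\},$$ and let $\phi_t:\mathbb C\to X$ send $\zeta$ to the point with $v_1=(\zeta,t)$, $v_2=0$ over $[\zeta:t]$ if $t>0$, and over $[1:0]$ if $t=0$. Let $\Delta$ be the open unit disc. Then: 1.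 $X$ is a connected (Hausdorff, second countable) complex threefold that is not Stein; $D$ is a domain in $X$, $f$ is holomorphic on $D$, $E\subset\Sigma_1$, and $f$ does not extend, even meromorphically, to a neighbourhood of any point of $\Sigma_1$; in particular it has an essential singularity along $E$. 2. All $\phi_t$ are holomorphic embeddings. For $t\in(0,1]$, $C_t=\phi_t(\Delta)$ and $\phi_t(\overline\Delta)\subset D$; for $t=0$, $C_0=\phi_0(\Delta)\cup E$, and $\phi_0(\overline\Delta)\cap E=\{\phi_0(0)\}$. The union over $t\in[0,1]$ of the boundaries $\partial C_t=\phi_t(\partial\Delta)$ is contained in a compact subset of $D$. 3. The closed curves $\overline C_t$ with their inclusions in $X$ form a family $\{(C_t,u_t)\}_{t\in[0,1]}$ of compact nodal complex curves with boundary over $X$ which is continuous in the Gromov topology: $C_t$ is a disc without nodes for $t>0$, and $C_0$ is the disc $\phi_0(\overline\Delta)$ with the rational bubble $E$ attached at one node, $\phi_0(0)$. In particular $C_{1/k}\to C_0$ in the Gromov topology as $k\to\infty$. 4. The continuity principles for domains in Stein manifolds fail in $X$: (a) *(Discrete version.)* $C_{1/k}$ and $C_0$ are pure one-dimensional compact analytic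 sets with boundary, the $C_{1/k}$ in $D$ and $C_0$ in $X$, $(C_{1/k},\partial C_{1/k})\to(C_0,\partial C_0)$ in the Hausdorff topology and $\partial C_0\Subset D$; but $C_0$ cannot be lifted to the envelope of holomorphy $(\widehat D,\pi)$ of $D$ over $X$: with $i:D\to\widehat D$ the canonical inclusion, there is no compact analytic set with boundary $(\widehat C_0,\partial\widehat C_0)$ in $\widehat D$ such that $\pi|_{\widehat C_0}:\widehat C_0\to C_0$ is proper, surjective and one-to-one near the boundaries and $(i(C_{1/k}),i(\partial C_{1/k}))\to(\widehat C_0,\partial\widehat C_0)$ in the Hausdorff topology. (b) *(Continuous version.)* The reversed family $(C_{1-t},u_{1-t})_{t\in[0,1]}$ is Gromov continuous, its initial curve lies in $D$ and all its boundaries lie in $D$; but there are no holomorphic $\widehat u_t:C_{1-t}\to\widehat D$ with $\pi\circ\widehat u_t=u_{1-t}$ for all $t\in[0,1]$ such that $(C_{1-t},\widehat u_t)$ is Gromov continuous. The envelope of holomorphy $\widehat D$ of $D$ over $X$ exists. Hence both continuity principles are false when the hypothesis that the ambient manifold is Stein is dropped. -/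

import Mathlib

open Set Filter Topology
open scoped Manifold ContDiff LinearAlgebra.Projectivization

noncomputable section

/-! ### Riemann surfaces with boundary

They are modelled on the closed upper half-plane.  The same half-plane carries a complex model
(transition maps holomorphic, up to the boundary) and a real one (the underlying real surface). -/

/-- The closed upper half-plane. -/
abbrev ClosedHalfPlane : Type := {z : ℂ // 0 ≤ z.im}

/-- The inclusion of the closed half-plane in `ℂ`, with the inverse extended to `ℂ` by projection. -/
def halfPlaneEquiv : PartialEquiv ClosedHalfPlane ℂ where
  toFun z := z.1
  invFun z := ⟨⟨z.re, max z.im 0⟩, le_max_right _ _⟩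
  source := univ
  target := {z | 0 ≤ z.im}
  map_source' z _ := z.2
  map_target' _ _ := mem_univ _
  left_inv' z _ := Subtype.ext (Complex.ext rfl (max_eq_left z.2))
  right_inv' _ hz := Complex.ext rfl (max_eq_left hz)

theorem range_halfPlaneEquiv : range halfPlaneEquiv = {z : ℂ | 0 ≤ z.im} :=
  Subtype.range_coe

theorem continuous_halfPlaneEquiv_symm : Continuous halfPlaneEquiv.invFun := by
  refine Continuous.subtype_mk ?_ _
  have h : (fun z : ℂ => (⟨z.re, max z.im 0⟩ : ℂ)) =
      fun z : ℂ => (z.re : ℂ) + ((max z.im 0 : ℝ) : ℂ) * Complex.I := by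
    funext z
    apply Complex.ext <;> simp
  rw [h]
  fun_prop

theorem convex_range_halfPlaneEquiv : Convex ℝ (range halfPlaneEquiv) := by
  rw [range_halfPlaneEquiv]
  exact convex_halfSpace_im_ge 0

theorem nonempty_interior_range_halfPlaneEquiv : (interior (range halfPlaneEquiv)).Nonempty := by
  rw [range_halfPlaneEquiv]
  refine ⟨Complex.I, ?_⟩
  have ho : IsOpen {z : ℂ | 0 < z.im} := isOpen_lt continuous_const Complex.continuous_im
  have hs : {z : ℂ | 0 < z.im} ⊆ {z : ℂ | 0 ≤ z.im} := by
    intro z hz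
    have h0 : 0 < z.im := hz
    exact h0.le
  refine interior_maximal hs ho ?_
  change (0 : ℝ) < Complex.I.im
  simp

/-- The complex half-plane model: manifolds over it are Riemann surfaces with boundary. -/
def complexModel : ModelWithCorners ℂ ℂ ClosedHalfPlane where
  toPartialEquiv := halfPlaneEquiv
  source_eq := rfl
  convex_range' := by
    rw [dif_pos (inferInstance : IsRCLikeNormedField ℂ)]
    exact (convex_range_halfPlaneEquiv).convex_isRCLikeNormedField
  nonempty_interior' := nonempty_interior_range_halfPlaneEquiv
  continuous_toFun := continuous_subtype_val
  continuous_invFun := continuous_halfPlaneEquiv_symm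

/-- The real half-plane model: manifolds over it are real surfaces with boundary. -/
def realModel : ModelWithCorners ℝ ℂ ClosedHalfPlane where
  toPartialEquiv := halfPlaneEquiv
  source_eq := rfl
  convex_range' := by
    rw [dif_pos (inferInstance : IsRCLikeNormedField ℝ)]
    exact (convex_range_halfPlaneEquiv).convex_isRCLikeNormedField
  nonempty_interior' := nonempty_interior_range_halfPlaneEquiv
  continuous_toFun := continuous_subtype_val
  continuous_invFun := continuous_halfPlaneEquiv_symm

/-- A compact connected Riemann surface with boundary (the boundary is contained in it). -/
structure BorderedSurface where
  carrier : Type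
  [top : TopologicalSpace carrier]
  [t2 : T2Space carrier]
  [compact : CompactSpace carrier]
  [connected : ConnectedSpace carrier]
  [charted : ChartedSpace ClosedHalfPlane carrier]
  [manifold : IsManifold complexModel ω carrier]

attribute [instance] BorderedSurface.top BorderedSurface.t2 BorderedSurface.compact
  BorderedSurface.connected BorderedSurface.charted BorderedSurface.manifold

/-! ### Nodal curves with boundary -/

/-- The standard node `{z₁ z₂ = 0}` in the unit bidisc. -/
abbrev StandardNode : Type := {z : ℂ × ℂ // ‖z.1‖ < 1 ∧ ‖z.2‖ < 1 ∧ z.1 * z.2 = 0}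

/-- The point `(z, 0)` of the standard node. -/
def StandardNode.left (z : ℂ) (hz : ‖z‖ < 1) : StandardNode := ⟨(z, 0), by simp [hz]⟩

/-- The point `(0, z)` of the standard node. -/
def StandardNode.right (z : ℂ) (hz : ‖z‖ < 1) : StandardNode := ⟨(0, z), by simp [hz]⟩

/-- A compact nodal curve with boundary: a compact Hausdorff space `carrier` (the closed curve)
which, away from finitely many points, is a Riemann surface with boundary `reg`, and which at each
of the remaining points (the nodes) is a copy of the standard node, the two branches of which are
holomorphic away from the node. -/
structure NodalCurve where
  carrier : Type
  [top : TopologicalSpace carrier]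
  [t2 : T2Space carrier]
  [compact : CompactSpace carrier]
  reg : Type
  [regTop : TopologicalSpace reg]
  [regCharted : ChartedSpace ClosedHalfPlane reg]
  [regManifold : IsManifold complexModel ω reg]
  incl : reg → carrier
  isOpenEmbedding_incl : IsOpenEmbedding incl
  finite_nodes : ((range incl)ᶜ).Finite
  exists_node : ∀ a ∈ (range incl)ᶜ, ∃ ν : StandardNode → carrier,
    IsOpenEmbedding ν ∧ ν (StandardNode.left 0 (by simp)) = a ∧
    (∃ α : ℂ → reg, ContMDiffOn 𝓘(ℂ) complexModel ω α {z | z ≠ 0 ∧ ‖z‖ < 1} ∧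
      ∀ z (hz : ‖z‖ < 1), z ≠ 0 → incl (α z) = ν (StandardNode.left z hz)) ∧
    (∃ β : ℂ → reg, ContMDiffOn 𝓘(ℂ) complexModel ω β {z | z ≠ 0 ∧ ‖z‖ < 1} ∧
      ∀ z (hz : ‖z‖ < 1), z ≠ 0 → incl (β z) = ν (StandardNode.right z hz))

attribute [instance] NodalCurve.top NodalCurve.t2 NodalCurve.compact NodalCurve.regTop
  NodalCurve.regCharted NodalCurve.regManifold

namespace NodalCurve

/-- The nodes of the curve. -/
def nodes (C : NodalCurve) : Set C.carrier := (range C.incl)ᶜ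

/-- The boundary of the curve. -/
def boundary (C : NodalCurve) : Set C.carrier := C.incl '' complexModel.boundary C.reg

/-- A continuous map from a closed nodal curve to a complex manifold is holomorphic if it is so at
the smooth interior points (at a node: continuous and holomorphic on both branches). -/
def IsHolomorphic (E : Type*) [NormedAddCommGroup E] [NormedSpace ℂ E] {M : Type*}
    [TopologicalSpace M] [ChartedSpace E M] (C : NodalCurve) (u : C(C.carrier, M)) : Prop :=
  ∀ r : C.reg, complexModel.IsInteriorPoint r →
    ContMDiffAt complexModel 𝓘(ℂ, E) ω (fun r' => u (C.incl r')) r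

end NodalCurve

/-- A smooth embedded circle in the interior of a surface, given as the range of a regular closed
curve of period `1` without further coincidences. -/
def IsSmoothCircle (S : BorderedSurface) (A : Set S.carrier) : Prop :=
  A ⊆ realModel.interior S.carrier ∧
  ∃ c : ℝ → S.carrier, ContMDiff 𝓘(ℝ) realModel ∞ c ∧
    (∀ s, mfderiv 𝓘(ℝ) realModel c s ≠ 0) ∧
    (∀ s s', c s = c s' ↔ ∃ n : ℤ, s' = s + n) ∧ range c = A

/-- A parametrization `σ` of a nodal curve by a surface: a continuous map `toMap` such that the
preimages of the nodes are smooth embedded circles and which is elsewhere a diffeomorphism (called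
`regular`) onto the smooth part of the curve. -/
structure Parametrization (S : BorderedSurface) (C : NodalCurve) where
  toMap : C(S.carrier, C.carrier)
  regular : PartialDiffeomorph realModel realModel S.carrier C.reg ∞
  source_regular : regular.source = toMap ⁻¹' range C.incl
  target_regular : regular.target = univ
  incl_regular : ∀ x ∈ regular.source, C.incl (regular x) = toMap x
  circle : ∀ a ∈ C.nodes, IsSmoothCircle S (toMap ⁻¹' {a})

/-- The pulled back complex structure `σ^* j` on the surface, written in the chart at `s`: at a
point `y` of the chart it is `A⁻¹ ∘ i ∘ A`, `A` being the differential of the parametrization.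
Meaningful at points `y` that correspond to points of `P.regular.source`. -/
def Parametrization.complexStructure {S : BorderedSurface} {C : NodalCurve}
    (P : Parametrization S C) (s : S.carrier) (y : ℂ) : ℂ →L[ℝ] ℂ :=
  let A : ℂ →L[ℝ] ℂ := mfderivWithin 𝓘(ℝ, ℂ) realModel
    (fun y' => P.regular ((extChartAt realModel s).symm y')) (range realModel) y
  A.inverse.comp ((Complex.I • ContinuousLinearMap.id ℝ ℂ).comp A)

/-! ### Gromov convergence -/

/-- Smooth convergence on a subset `L` of the closed half-plane: the functions are smooth (up to
the boundary of the half-plane) at the points of `L`, and all derivatives converge uniformly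
on `L`. -/
def SmoothTendstoOn {ι V : Type*} [NormedAddCommGroup V] [NormedSpace ℝ V] (l : Filter ι)
    (F : ι → ℂ → V) (F₀ : ℂ → V) (L : Set ℂ) : Prop :=
  (∀ᶠ i in l, ∀ y ∈ L, ContDiffWithinAt ℝ ∞ (F i) (range realModel) y) ∧
  (∀ y ∈ L, ContDiffWithinAt ℝ ∞ F₀ (range realModel) y) ∧
  ∀ m : ℕ, TendstoUniformlyOn (fun i => iteratedFDerivWithin ℝ m (F i) (range realModel))
    (iteratedFDerivWithin ℝ m F₀ (range realModel)) l L

section Gromov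

variable (E : Type*) [NormedAddCommGroup E] [NormedSpace ℂ E] {M : Type*}
  [TopologicalSpace M] [ChartedSpace E M]

/-- Gromov convergence of the curves `(C i, u i)` to `(C₀, u₀)` along a filter, for given
parametrizations by one surface. -/
structure GromovTendsto {ι : Type*} (l : Filter ι) {S : BorderedSurface}
    {C : ι → NodalCurve} (u : ∀ i, C((C i).carrier, M)) (P : ∀ i, Parametrization S (C i))
    {C₀ : NodalCurve} (u₀ : C(C₀.carrier, M)) (P₀ : Parametrization S C₀) : Prop where
  /-- uniform convergence on the surface -/
  uniform : Tendsto (fun i => (u i).comp (P i).toMap) l (𝓝 (u₀.comp P₀.toMap))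
  /-- smooth convergence (in charts) on the compacts off the circles of the limit curve -/
  smooth : ∀ (s : S.carrier) (m : M) (K : Set S.carrier), IsCompact K →
    K ⊆ P₀.regular.source → K ⊆ (chartAt ClosedHalfPlane s).source →
    MapsTo (u₀.comp P₀.toMap) K (chartAt E m).source →
    SmoothTendstoOn l
      (fun i y => extChartAt 𝓘(ℝ, E) m (u i ((P i).toMap ((extChartAt realModel s).symm y))))
      (fun y => extChartAt 𝓘(ℝ, E) m (u₀ (P₀.toMap ((extChartAt realModel s).symm y))))
      (extChartAt realModel s '' K)
  /-- such compacts are eventually mapped off the nodes -/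
  avoids_nodes : ∀ K : Set S.carrier, IsCompact K → K ⊆ P₀.regular.source →
    ∀ᶠ i in l, K ⊆ (P i).regular.source
  /-- and the complex structures converge smoothly on them -/
  structures : ∀ (s : S.carrier) (K : Set S.carrier), IsCompact K →
    K ⊆ P₀.regular.source → K ⊆ (chartAt ClosedHalfPlane s).source →
    SmoothTendstoOn l (fun i => (P i).complexStructure s) (P₀.complexStructure s)
      (extChartAt realModel s '' K)
  /-- the complex structures are constant near the boundary -/
  constant_near_boundary : ∃ W : Set S.carrier, IsOpen W ∧ realModel.boundary S.carrier ⊆ W ∧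
    W ⊆ P₀.regular.source ∧ ∀ i, W ⊆ (P i).regular.source ∧
      ∀ (s : S.carrier), ∀ x ∈ W ∩ (chartAt ClosedHalfPlane s).source,
        (P i).complexStructure s (extChartAt realModel s x) =
          P₀.complexStructure s (extChartAt realModel s x)

/-- Gromov convergence of a sequence of curves over `M`. -/
def GromovConverges {C : ℕ → NodalCurve} (u : ∀ k, C((C k).carrier, M))
    {C₀ : NodalCurve} (u₀ : C(C₀.carrier, M)) : Prop :=
  ∃ (S : BorderedSurface) (P : ∀ k, Parametrization S (C k)) (P₀ : Parametrization S C₀),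
    GromovTendsto E atTop u P u₀ P₀

/-- Continuity in the Gromov topology of a family of curves over `M` indexed by `[0,1]`. -/
def GromovContinuous {C : unitInterval → NodalCurve} (u : ∀ t, C((C t).carrier, M)) : Prop :=
  ∃ (S : BorderedSurface) (P : ∀ t, Parametrization S (C t)),
    Continuous (fun x : unitInterval × S.carrier => u x.1 ((P x.1).toMap x.2)) ∧
    ∀ t₀, GromovTendsto E (𝓝 t₀) u P (u t₀) (P t₀)

end Gromov

/-! ### Stein manifolds, meromorphic extension, envelopes of holomorphy -/

section Holomorphic

variable (E : Type*) [NormedAddCommGroup E] [NormedSpace ℂ E] {M : Type*}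
  [TopologicalSpace M] [ChartedSpace E M]

/-- A (Hausdorff, second countable) complex manifold is Stein if it is holomorphically separable
and holomorphically convex. -/
def IsStein (M : Type*) [TopologicalSpace M] [ChartedSpace E M] : Prop :=
  (∀ x y : M, x ≠ y → ∃ f : M → ℂ, ContMDiff 𝓘(ℂ, E) 𝓘(ℂ) ω f ∧ f x ≠ f y) ∧
  ∀ K : Set M, IsCompact K → IsCompact
    {x : M | ∀ f : M → ℂ, ContMDiff 𝓘(ℂ, E) 𝓘(ℂ) ω f → ∃ y ∈ K, ‖f x‖ ≤ ‖f y‖}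

/-- `f`, given on `D`, extends meromorphically to a neighbourhood of `x`: it is near `x` a quotient
`g / h` of holomorphic functions, with `h` nowhere locally zero. -/
def ExtendsMeromorphicallyAt (D : Set M) (f : M → ℂ) (x : M) : Prop :=
  ∃ V : Set M, IsOpen V ∧ x ∈ V ∧ ∃ g h : M → ℂ,
    ContMDiffOn 𝓘(ℂ, E) 𝓘(ℂ) ω g V ∧ ContMDiffOn 𝓘(ℂ, E) 𝓘(ℂ) ω h V ∧
    (∀ y ∈ V, ∃ᶠ z in 𝓝 y, h z ≠ 0) ∧ ∀ y ∈ V ∩ D, h y * f y = g y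

/-- A connected Hausdorff Riemann domain over `M` that contains a copy of the domain `D` and to
which all holomorphic functions on `D` extend. -/
structure HolomorphicExtension (D : TopologicalSpace.Opens M) where
  carrier : Type
  [top : TopologicalSpace carrier]
  [charted : ChartedSpace E carrier]
  [manifold : IsManifold 𝓘(ℂ, E) ω carrier]
  [t2 : T2Space carrier]
  [connected : ConnectedSpace carrier]
  proj : carrier → M
  isLocalDiffeomorph_proj : IsLocalDiffeomorph 𝓘(ℂ, E) 𝓘(ℂ, E) ω proj
  incl : D → carrier
  contMDiff_incl : ContMDiff 𝓘(ℂ, E) 𝓘(ℂ, E) ω incl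
  proj_incl : ∀ x, proj (incl x) = x
  exists_extension : ∀ f : D → ℂ, ContMDiff 𝓘(ℂ, E) 𝓘(ℂ) ω f →
    ∃ F : carrier → ℂ, ContMDiff 𝓘(ℂ, E) 𝓘(ℂ) ω F ∧ ∀ x, F (incl x) = f x

attribute [instance] HolomorphicExtension.top HolomorphicExtension.charted
  HolomorphicExtension.manifold HolomorphicExtension.t2 HolomorphicExtension.connected

variable {E}

/-- The envelope of holomorphy of `D` (over `M`): the maximal holomorphic extension. -/
def HolomorphicExtension.IsEnvelope {D : TopologicalSpace.Opens M}
    (R : HolomorphicExtension E D) : Prop :=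
  ∀ R' : HolomorphicExtension E D, ∃ τ : R'.carrier → R.carrier,
    ContMDiff 𝓘(ℂ, E) 𝓘(ℂ, E) ω τ ∧ (∀ y, R.proj (τ y) = R'.proj y) ∧
    ∀ x, τ (R'.incl x) = R.incl x

end Holomorphic

/-! ### Analytic sets with boundary, and the discrete continuity principle -/

/-- A compact analytic set with boundary: an analytic subset `C` of a relatively compact open
set `U`. -/
structure AnalyticSetWithBoundary (E : Type*) [NormedAddCommGroup E] [NormedSpace ℂ E]
    (M : Type*) [TopologicalSpace M] [ChartedSpace E M] where
  U : Set M
  isOpen_U : IsOpen U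
  isCompact_closure_U : IsCompact (closure U)
  C : Set M
  subset_U : C ⊆ U
  analytic : ∀ x ∈ U, ∃ V ⊆ U, IsOpen V ∧ x ∈ V ∧ ∃ (n : ℕ) (g : Fin n → M → ℂ),
    (∀ i, ContMDiffOn 𝓘(ℂ, E) 𝓘(ℂ) ω (g i) V) ∧ C ∩ V = {y ∈ V | ∀ i, g i y = 0}

section Analytic

variable {E : Type*} [NormedAddCommGroup E] [NormedSpace ℂ E] {M : Type*}
  [TopologicalSpace M] [ChartedSpace E M]

/-- The boundary of an analytic set with boundary. -/
def AnalyticSetWithBoundary.boundary (A : AnalyticSetWithBoundary E M) : Set M :=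
  closure A.C ∩ frontier A.U

/-- Near `x` the set `C` is a `q`-dimensional complex submanifold: it is the zero set of a
holomorphic submersion to `ℂ^r` with `q + r` the dimension of the ambient manifold. -/
def IsRegularPointOfDim (E : Type*) [NormedAddCommGroup E] [NormedSpace ℂ E] {M : Type*}
    [TopologicalSpace M] [ChartedSpace E M] (C : Set M) (q : ℕ) (x : M) : Prop :=
  x ∈ C ∧ ∃ r : ℕ, q + r = Module.finrank ℂ E ∧ ∃ V : Set M, IsOpen V ∧ x ∈ V ∧
    ∃ g : M → (Fin r → ℂ), ContMDiffOn 𝓘(ℂ, E) 𝓘(ℂ, Fin r → ℂ) ω g V ∧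
      Function.Surjective (mfderiv 𝓘(ℂ, E) 𝓘(ℂ, Fin r → ℂ) g x) ∧
      C ∩ V = {y ∈ V | g y = 0}

/-- Pure dimension `q`: the regular points of dimension `q` are dense in the analytic set. -/
def AnalyticSetWithBoundary.IsPure (A : AnalyticSetWithBoundary E M) (q : ℕ) : Prop :=
  A.C ⊆ closure {x | IsRegularPointOfDim E A.C q x}

/-- Convergence of compact sets in the Hausdorff metric.  On the compact subsets of a metrizable
space the topology of the Hausdorff metric is the Vietoris topology. -/
def HausdorffTendsto (A : ℕ → Set M) (A₀ : Set M) : Prop :=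
  Tendsto A atTop (@nhds (Set M) (TopologicalSpace.vietoris M) A₀)

/-- The hypotheses of the discrete continuity principle, except for those on `M`. -/
structure DiscreteHypotheses (D : TopologicalSpace.Opens M) (q : ℕ)
    (A : ℕ → AnalyticSetWithBoundary E M) (A₀ : AnalyticSetWithBoundary E M) : Prop where
  isConnected : IsConnected (D : Set M)
  one_le : 1 ≤ q
  lt_dim : q < Module.finrank ℂ E
  inside : ∀ k, closure (A k).U ⊆ D
  pure : ∀ k, (A k).IsPure q
  pure_limit : A₀.IsPure q
  tendsto_closure : HausdorffTendsto (fun k => closure (A k).C) (closure A₀.C)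
  tendsto_boundary : HausdorffTendsto (fun k => (A k).boundary) A₀.boundary
  boundary_subset : A₀.boundary ⊆ D

/-- The conclusion of the discrete continuity principle: `A₀` lifts to `R`. -/
def DiscreteLift {D : TopologicalSpace.Opens M} (R : HolomorphicExtension E D)
    (A : ℕ → AnalyticSetWithBoundary E M) (A₀ : AnalyticSetWithBoundary E M) : Prop :=
  ∃ B : AnalyticSetWithBoundary E R.carrier,
    (∃ h : MapsTo R.proj B.C A₀.C, IsProperMap (h.restrict R.proj B.C A₀.C) ∧
      Function.Surjective (h.restrict R.proj B.C A₀.C)) ∧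
    (∃ (W : Set M) (W' : Set R.carrier), IsOpen W ∧ IsOpen W' ∧ A₀.boundary ⊆ W ∧
      B.boundary ⊆ W' ∧ BijOn R.proj (B.C ∩ W') (A₀.C ∩ W)) ∧
    HausdorffTendsto (fun k => closure (R.incl '' (Subtype.val ⁻¹' (A k).C))) (closure B.C) ∧
    HausdorffTendsto (fun k => R.incl '' (Subtype.val ⁻¹' (A k).boundary)) B.boundary

/-- The discrete continuity principle in the complex manifold `M`. -/
def DiscreteContinuityPrinciple (E : Type*) [NormedAddCommGroup E] [NormedSpace ℂ E] (M : Type*)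
    [TopologicalSpace M] [ChartedSpace E M] : Prop :=
  ∀ (D : TopologicalSpace.Opens M) (q : ℕ) (A : ℕ → AnalyticSetWithBoundary E M)
    (A₀ : AnalyticSetWithBoundary E M), DiscreteHypotheses D q A A₀ →
    ∀ R : HolomorphicExtension E D, R.IsEnvelope → DiscreteLift R A A₀

/-! ### The continuous continuity principle -/

/-- The hypotheses of the continuous continuity principle, except for those on `M`. -/
structure ContinuousHypotheses (D : TopologicalSpace.Opens M) {C : unitInterval → NodalCurve}
    (u : ∀ t, C((C t).carrier, M)) : Prop where
  isConnected : IsConnected (D : Set M)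
  holomorphic : ∀ t, (C t).IsHolomorphic E (u t)
  continuous : GromovContinuous E u
  initial : range (u 0) ⊆ D
  boundary : ∀ t, u t '' (C t).boundary ⊆ D

/-- The conclusion of the continuous continuity principle: the family lifts to `R`. -/
def ContinuousLift {D : TopologicalSpace.Opens M} (R : HolomorphicExtension E D)
    {C : unitInterval → NodalCurve} (u : ∀ t, C((C t).carrier, M)) : Prop :=
  ∃ v : ∀ t, C((C t).carrier, R.carrier), (∀ t, (C t).IsHolomorphic E (v t)) ∧
    GromovContinuous E v ∧ ∀ t x, R.proj (v t x) = u t x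

/-- The continuous continuity principle in the complex manifold `M`. -/
def ContinuousContinuityPrinciple (E : Type*) [NormedAddCommGroup E] [NormedSpace ℂ E] (M : Type*)
    [TopologicalSpace M] [ChartedSpace E M] : Prop :=
  ∀ (D : TopologicalSpace.Opens M) (C : unitInterval → NodalCurve)
    (u : ∀ t, C((C t).carrier, M)), ContinuousHypotheses (E := E) D u →
    ∀ R : HolomorphicExtension E D, R.IsEnvelope → ContinuousLift R u

end Analytic

/-! ### The total space of `O(-1) ⊕ O(-1)` over the projective line -/

/-- The model space of complex threefolds. -/
abbrev C3 : Type := ℂ × ℂ × ℂ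

/-- The total space of `O(-1) ⊕ O(-1)`: a line in `ℂ²` with two vectors on it.  In the notation
with fibre coordinates, `fst = (ξ₁, η₁)` and `snd = (ξ₂, η₂)`. -/
@[ext] structure TotalSpaceX : Type where
  line : ℙ ℂ (Fin 2 → ℂ)
  fst : Fin 2 → ℂ
  snd : Fin 2 → ℂ
  fst_mem : fst ∈ line.submodule
  snd_mem : snd ∈ line.submodule

namespace TotalSpaceX

/-- The vector with entry `1` at `j` and `z` at the other place. -/
def vec (j : Fin 2) (z : ℂ) : Fin 2 → ℂ := fun i => if i = j then 1 else z

theorem vec_ne_zero (j : Fin 2) (z : ℂ) : vec j z ≠ 0 := fun h => by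
  have := congrFun h j
  simp [vec] at this

theorem mk_eq_iff_rep (l : ℙ ℂ (Fin 2 → ℂ)) (v : Fin 2 → ℂ) (hv : v ≠ 0)
    (c : ℂ) (h : l.rep = c • v) : Projectivization.mk ℂ v hv = l := by
  conv_rhs => rw [← l.mk_rep]
  rw [Projectivization.mk_eq_mk_iff']
  have hc : c ≠ 0 := by
    rintro rfl
    exact l.rep_nonzero (by simpa using h)
  exact ⟨c⁻¹, by rw [h, smul_smul, inv_mul_cancel₀ hc, one_smul]⟩

theorem rep_eq_smul_vec (l : ℙ ℂ (Fin 2 → ℂ)) (j : Fin 2) (h : l.rep j ≠ 0) :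
    l.rep = l.rep j • vec j (l.rep (1 - j) / l.rep j) := by
  funext i
  fin_cases j <;> fin_cases i <;> simp [vec] at h ⊢ <;> field_simp

theorem eq_smul_vec (l : ℙ ℂ (Fin 2 → ℂ)) (j : Fin 2) (h : l.rep j ≠ 0) (v : Fin 2 → ℂ)
    (hv : v ∈ l.submodule) : v = v j • vec j (l.rep (1 - j) / l.rep j) := by
  rw [Projectivization.submodule_eq, Submodule.mem_span_singleton] at hv
  obtain ⟨a, rfl⟩ := hv
  have := rep_eq_smul_vec l j h
  conv_lhs => rw [this]
  simp [smul_smul]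

theorem rep_mk_vec (j : Fin 2) (z : ℂ) : ∃ c : ℂ, c ≠ 0 ∧
    (Projectivization.mk ℂ (vec j z) (vec_ne_zero j z)).rep = c • vec j z := by
  obtain ⟨a, ha⟩ := Projectivization.exists_smul_eq_mk_rep ℂ (vec j z) (vec_ne_zero j z)
  exact ⟨a, a.ne_zero, ha.symm⟩

/-- The two standard trivialisations: for `j = 0` it is the chart `(z, ξ₁, ξ₂)` over `{z ≠ ∞}`, for
`j = 1` the chart `(1 / z, η₁, η₂)` over `{z ≠ 0}`, where `z = z₂ / z₁` on the line `[z₁ : z₂]`. -/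
def coord (j : Fin 2) : PartialEquiv TotalSpaceX C3 where
  toFun x := (x.line.rep (1 - j) / x.line.rep j, x.fst j, x.snd j)
  invFun y :=
    { line := Projectivization.mk ℂ (vec j y.1) (vec_ne_zero j y.1)
      fst := y.2.1 • vec j y.1
      snd := y.2.2 • vec j y.1
      fst_mem := Submodule.smul_mem _ _ (Submodule.mem_span_singleton_self _)
      snd_mem := Submodule.smul_mem _ _ (Submodule.mem_span_singleton_self _) }
  source := {x | x.line.rep j ≠ 0}
  target := univ
  map_source' _ _ := mem_univ _
  map_target' y _ := by
    obtain ⟨c, hc, h⟩ := rep_mk_vec j y.1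
    simp [h, vec, hc]
  left_inv' x hx := by
    ext1
    · exact mk_eq_iff_rep _ _ _ _ (rep_eq_smul_vec x.line j hx)
    · exact (eq_smul_vec x.line j hx x.fst x.fst_mem).symm
    · exact (eq_smul_vec x.line j hx x.snd x.snd_mem).symm
  right_inv' y _ := by
    obtain ⟨c, hc, h⟩ := rep_mk_vec j y.1
    have h1 : (1 - j : Fin 2) ≠ j := by fin_cases j <;> decide
    simp [h, vec, hc, h1]

theorem coord_symm_trans_source (i j : Fin 2) (hij : i ≠ j) :
    ((coord i).symm.trans (coord j)).source = {y : C3 | y.1 ≠ 0} := by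
  ext y
  obtain ⟨c, hc, h⟩ := rep_mk_vec i y.1
  simp [PartialEquiv.trans_source, coord, h, vec, hc, hij.symm]

theorem coord_symm_trans_apply (i j : Fin 2) (hij : i ≠ j) (y : C3) (hy : y.1 ≠ 0) :
    (coord i).symm.trans (coord j) y = (y.1⁻¹, y.2.1 * y.1, y.2.2 * y.1) := by
  obtain ⟨c, hc, h⟩ := rep_mk_vec i y.1
  have h1 : (1 - j : Fin 2) = i := by
    have hd : ∀ i j : Fin 2, i ≠ j → 1 - j = i := by decide
    exact hd i j hij
  simp [coord, h, h1, vec, hij.symm]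
  field_simp

theorem coord_symm_trans_self (i : Fin 2) :
    ((coord i).symm.trans (coord i)).source = univ ∧
      ∀ y, (coord i).symm.trans (coord i) y = y := by
  constructor
  · ext y
    simp only [PartialEquiv.trans_source, PartialEquiv.symm_source, mem_inter_iff, mem_preimage,
      mem_univ, iff_true]
    exact ⟨mem_univ _, (coord i).map_target (mem_univ y)⟩
  · intro y
    exact (coord i).right_inv (mem_univ y)

theorem contDiffOn_coord (i j : Fin 2) :
    ContDiffOn ℂ ω ((coord i).symm.trans (coord j)) ((coord i).symm.trans (coord j)).source := by
  by_cases hij : i = j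
  · subst hij
    exact contDiffOn_id.congr fun y _ => (coord_symm_trans_self i).2 y
  · rw [coord_symm_trans_source i j hij]
    have h : ContDiffOn ℂ ω (fun y : C3 => (y.1⁻¹, y.2.1 * y.1, y.2.2 * y.1)) {y : C3 | y.1 ≠ 0} := by
      refine ContDiffOn.prodMk ?_ (ContDiffOn.prodMk ?_ ?_)
      · exact contDiff_fst.contDiffOn.inv fun y hy => hy
      · exact ((contDiff_fst.comp contDiff_snd).mul contDiff_fst).contDiffOn
      · exact ((contDiff_snd.comp contDiff_snd).mul contDiff_fst).contDiffOn
    exact h.congr fun y hy => coord_symm_trans_apply i j hij y hy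

theorem exists_rep_ne_zero (l : ℙ ℂ (Fin 2 → ℂ)) : l.rep 0 ≠ 0 ∨ l.rep 1 ≠ 0 := by
  by_contra! h
  exact l.rep_nonzero (by funext i; fin_cases i <;> simp [h.1, h.2])

open Classical in
/-- The complex manifold structure of the total space, given by the two trivialisations. -/
def core : ChartedSpaceCore C3 TotalSpaceX where
  atlas := range coord
  chartAt x := if x.line.rep 0 ≠ 0 then coord 0 else coord 1
  mem_chart_source x := by
    by_cases h : x.line.rep 0 ≠ 0
    · rw [if_pos h]
      exact h
    · rw [if_neg h]
      exact (exists_rep_ne_zero x.line).resolve_left h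
  chart_mem_atlas x := by
    split_ifs <;> exact mem_range_self _
  open_source := by
    rintro _ _ ⟨i, rfl⟩ ⟨j, rfl⟩
    by_cases hij : i = j
    · subst hij
      rw [(coord_symm_trans_self i).1]
      exact isOpen_univ
    · rw [coord_symm_trans_source i j hij]
      exact isOpen_ne_fun continuous_fst continuous_const
  continuousOn_toFun := by
    rintro _ _ ⟨i, rfl⟩ ⟨j, rfl⟩
    exact (contDiffOn_coord i j).continuousOn

instance : TopologicalSpace TotalSpaceX := core.toTopologicalSpace

instance : ChartedSpace C3 TotalSpaceX := core.toChartedSpace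

theorem exists_coord_of_mem_atlas (e : OpenPartialHomeomorph TotalSpaceX C3)
    (he : e ∈ atlas C3 TotalSpaceX) : ∃ j, e.toPartialEquiv = coord j := by
  obtain ⟨e', he'⟩ := mem_iUnion.1 he
  obtain ⟨⟨j, hj⟩, h⟩ := mem_iUnion.1 he'
  rw [mem_singleton_iff.1 h]
  exact ⟨j, hj.symm⟩

instance : IsManifold 𝓘(ℂ, C3) ω TotalSpaceX := by
  apply isManifold_of_contDiffOn
  intro e e' he he'
  obtain ⟨i, hi⟩ := exists_coord_of_mem_atlas e he
  obtain ⟨j, hj⟩ := exists_coord_of_mem_atlas e' he'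
  have h := contDiffOn_coord i j
  rw [← hi, ← hj] at h
  simpa using h

theorem fst_eq_zero_iff (x : TotalSpaceX) (j : Fin 2) (h : x ∈ (coord j).source) :
    x.fst = 0 ↔ x.fst j = 0 := by
  refine ⟨fun h0 => by rw [h0]; rfl, fun h0 => ?_⟩
  rw [eq_smul_vec x.line j h x.fst x.fst_mem, h0, zero_smul]

/-- The zero section of the bundle. -/
def zeroSection (l : ℙ ℂ (Fin 2 → ℂ)) : TotalSpaceX := ⟨l, 0, 0, zero_mem _, zero_mem _⟩

/-- The rational curve `E`. -/
def bubbleE : Set TotalSpaceX := range zeroSection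

/-- The hypersurface where the first component of the bundle vanishes: it is `{ξ₁ = 0}` in the
chart `(z, ξ₁, ξ₂)` and `{η₁ = 0}` in the chart `(1 / z, η₁, η₂)`. -/
def hypersurface : Set TotalSpaceX := {x | x.fst = 0}

theorem isOpen_compl_hypersurface : IsOpen hypersurfaceᶜ := by
  rw [isOpen_iff_mem_nhds]
  intro x hx
  obtain ⟨j, hj⟩ := exists_coord_of_mem_atlas (chartAt C3 x) (chart_mem_atlas C3 x)
  have ho := (chartAt C3 x).isOpen_inter_preimage
    (isOpen_ne_fun (continuous_fst.comp continuous_snd) continuous_const :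
      IsOpen {y : C3 | y.2.1 ≠ 0})
  have hs : ∀ y, y ∈ (chartAt C3 x).source → y ∈ (coord j).source := by
    intro y hy
    rw [← hj]
    exact hy
  have hv : ∀ y, chartAt C3 x y = coord j y := by
    intro y
    rw [← hj]
    rfl
  refine mem_of_superset (ho.mem_nhds ⟨mem_chart_source C3 x, ?_⟩) ?_
  · change (chartAt C3 x x).2.1 ≠ 0
    rw [hv]
    exact fun h => hx ((fst_eq_zero_iff x j (hs x (mem_chart_source C3 x))).2 h)
  · rintro y ⟨hy, hy'⟩ h0
    change (chartAt C3 x y).2.1 ≠ 0 at hy'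
    rw [hv] at hy'
    exact hy' ((fst_eq_zero_iff y j (hs y hy)).1 h0)

/-- The domain `D`. -/
def domainD : TopologicalSpace.Opens TotalSpaceX := ⟨hypersurfaceᶜ, isOpen_compl_hypersurface⟩

open Classical in
/-- The function `exp (ξ₂ / ξ₁)`, which is `exp (η₂ / η₁)` where `ξ₁ = 0`, `η₁ ≠ 0`. -/
def expRatio (x : TotalSpaceX) : ℂ :=
  if x.fst 0 ≠ 0 then Complex.exp (x.snd 0 / x.fst 0) else Complex.exp (x.snd 1 / x.fst 1)

open Classical in
/-- A vector that spans the line over which the point `disc t ζ` lies. -/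
def discVec (t : ℝ) (ζ : ℂ) : Fin 2 → ℂ := if t = 0 then ![1, 0] else ![ζ, (t : ℂ)]

theorem discVec_ne_zero (t : ℝ) (ζ : ℂ) : discVec t ζ ≠ 0 := by
  unfold discVec
  split_ifs with h
  · exact fun h0 => by simpa using congrFun h0 0
  · exact fun h0 => h (by simpa using congrFun h0 1)

/-- The map `ζ ↦ (ξ₁, η₁, ξ₂, η₂) = (ζ, t, 0, 0)`; for `t ≠ 0` this point lies over `[ζ : t]`, for
`t = 0` over `[1 : 0]`. -/
def disc (t : ℝ) (ζ : ℂ) : TotalSpaceX where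
  line := Projectivization.mk ℂ (discVec t ζ) (discVec_ne_zero t ζ)
  fst := ![ζ, (t : ℂ)]
  snd := 0
  fst_mem := by
    rw [Projectivization.submodule_mk, Submodule.mem_span_singleton]
    unfold discVec
    split_ifs with h
    · exact ⟨ζ, by ext i; fin_cases i <;> simp [h]⟩
    · exact ⟨1, one_smul _ _⟩
  snd_mem := zero_mem _

/-- The curve `C_t = {|ξ₁| < 1, η₁ = t, ξ₂ = η₂ = 0}`. -/
def curve (t : ℝ) : Set TotalSpaceX := {x | ‖x.fst 0‖ < 1 ∧ x.fst 1 = t ∧ x.snd = 0}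

end TotalSpaceX

end

noncomputable section

namespace TotalSpaceX

/-! ### The charts of the total space -/

/-! Write v₁ = (ξ₁, η₁) and v₂ = (ξ₂, η₂). The envelope of holomorphy is controlled by the function
λ = ξ₂/ξ₁ = η₂/η₁ on D, for which v₂ = λ v₁. Let R be a connected domain over X to which all
holomorphic functions on D extend, and let Λ extend λ. By analytic continuation v₂ = Λ v₁ on R. If a
point of R lay over Σ₁, then, the projection being open, R would have a point over some place with
v₁ = 0 and v₂ ≠ 0, which is absurd. So R lies over D (`proj_mem_domainD`), and D is its own envelope
(`isEnvelope_trivialExtension`). Since C₀ contains points of E, which are not in D, nothing in the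
envelope can project onto it: both lifts fail already at the node (`not_discreteLift`,
`not_continuousLift`).

X is not Stein because holomorphic functions do not separate the points of the compact curve E
(Liouville). The function f = exp λ has no meromorphic extension because on the lines where z and ξ₂
= b ≠ 0 are fixed it is exp(b/ξ₁), which is not a quotient of holomorphic functions at 0
(`eventually_eq_zero_of_mul_exp_eq`).

The work lies in the hypotheses, above all in Gromov continuity. All curves are parametrized by the
closed unit disc. With τ = √t and x = |s|² there are non-negative factors `scale` and `coscale` with
product τ² = t, and s is sent to the point over the line [s : coscale] with v₁ = scale · (s,
coscale) = (scale · s, t) and v₂ = 0. For t > 0 this is φ_t after the radial diffeomorphism s ↦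
scale · s. As τ → 0, `coscale` tends to 0 for |s| > 1/2, and the outer annulus covers the punctured
disc φ₀; for |s| < 1/2 `scale` tends to 0 while `coscale` tends to a cutoff, and the inner disc
covers the affine part of E; the circle |s| = 1/2 collapses to the node.

The vector (s, coscale) never vanishes, so the family is jointly continuous (`continuous_point`);
this gives uniform and, with `tendsto_range_vietoris`, Hausdorff convergence. The two factors are
smooth in (τ, x) off (0, 1/4), which gives convergence of all derivatives off the circle
(`smoothTendstoOn_of_locally_contDiffOn`). In the inner disc the radial map itself degenerates, but
it is τ² times a map that depends smoothly on τ down to τ = 0, and a constant factor does not affect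
the pulled back complex structure (`pullbackStructure_mulEquiv_comp`). Near the boundary the radial
map is the identity. -/

/-- The trivialisation `coord j` as an open partial homeomorphism. -/
def chart (j : Fin 2) : OpenPartialHomeomorph TotalSpaceX C3 :=
  core.openPartialHomeomorph (coord j) (mem_range_self j)

theorem chart_mem_atlas' (j : Fin 2) : chart j ∈ atlas C3 TotalSpaceX :=
  mem_iUnion₂.2 ⟨coord j, mem_range_self j, rfl⟩

theorem exists_chartAt_eq (x : TotalSpaceX) : ∃ j, chartAt C3 x = chart j := by
  obtain ⟨e', he'⟩ := mem_iUnion.1 (chart_mem_atlas C3 x)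
  obtain ⟨⟨j, hj⟩, h⟩ := mem_iUnion.1 he'
  subst hj
  exact ⟨j, mem_singleton_iff.1 h⟩

theorem chart_apply (j : Fin 2) (x : TotalSpaceX) :
    chart j x = (x.line.rep (1 - j) / x.line.rep j, x.fst j, x.snd j) := rfl

theorem mem_chart_source_iff (j : Fin 2) (x : TotalSpaceX) :
    x ∈ (chart j).source ↔ x.line.rep j ≠ 0 := Iff.rfl

theorem chart_target (j : Fin 2) : (chart j).target = univ := rfl

theorem chart_symm_fst (j : Fin 2) (y : C3) : ((chart j).symm y).fst = y.2.1 • vec j y.1 := rfl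

theorem chart_symm_snd (j : Fin 2) (y : C3) : ((chart j).symm y).snd = y.2.2 • vec j y.1 := rfl

theorem chart_chart_symm (j : Fin 2) (y : C3) : chart j ((chart j).symm y) = y :=
  (chart j).right_inv (mem_univ y)

theorem chart_symm_mem (j : Fin 2) (y : C3) : (chart j).symm y ∈ (chart j).source :=
  (chart j).map_target (mem_univ y)

theorem exists_mem_chart_source (x : TotalSpaceX) : ∃ j, x ∈ (chart j).source :=
  (exists_rep_ne_zero x.line).elim (fun h => ⟨0, h⟩) fun h => ⟨1, h⟩

theorem contMDiffOn_chart (j : Fin 2) :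
    ContMDiffOn 𝓘(ℂ, C3) 𝓘(ℂ, C3) ω (chart j) (chart j).source :=
  contMDiffOn_of_mem_maximalAtlas (IsManifold.subset_maximalAtlas (chart_mem_atlas' j))

theorem contMDiff_chart_symm (j : Fin 2) :
    ContMDiff 𝓘(ℂ, C3) 𝓘(ℂ, C3) ω (chart j).symm :=
  contMDiffOn_univ.1 (contMDiffOn_symm_of_mem_maximalAtlas
    (IsManifold.subset_maximalAtlas (chart_mem_atlas' j)))

theorem continuous_chart_symm (j : Fin 2) : Continuous (chart j).symm :=
  (contMDiff_chart_symm j).continuous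

theorem chart_symm_left_inv {j : Fin 2} {x : TotalSpaceX} (h : x ∈ (chart j).source) :
    (chart j).symm (chart j x) = x := (chart j).left_inv h

/-- A function on the total space is smooth at `x` if it is so in a chart around `x`. -/
theorem contMDiffAt_of_comp_chart_symm {F : Type*} [NormedAddCommGroup F] [NormedSpace ℂ F]
    {f : TotalSpaceX → F} {j : Fin 2} {x : TotalSpaceX} (hx : x ∈ (chart j).source)
    (h : ContDiffAt ℂ ω (f ∘ (chart j).symm) (chart j x)) :
    ContMDiffAt 𝓘(ℂ, C3) 𝓘(ℂ, F) ω f x := by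
  have h1 : ContMDiffAt 𝓘(ℂ, C3) 𝓘(ℂ, F) ω ((f ∘ (chart j).symm) ∘ chart j) x :=
    h.contMDiffAt.comp x ((contMDiffOn_chart j).contMDiffAt ((chart j).open_source.mem_nhds hx))
  refine h1.congr_of_eventuallyEq ?_
  filter_upwards [(chart j).open_source.mem_nhds hx] with y hy
  simp [chart_symm_left_inv hy]

theorem contDiff_vec (j : Fin 2) : ContDiff ℂ ω (vec j) := by
  refine contDiff_pi.2 fun i => ?_
  by_cases h : i = j
  · simpa [vec, h] using contDiff_const
  · simp only [vec, h, if_false]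
    exact contDiff_id

/-- In a chart the map is a multiple of `vec j z` by a fibre coordinate, hence polynomial. Together
with the next lemma this provides the global holomorphic functions ξ₁, η₁, ξ₂, η₂. -/
theorem contMDiff_fst_vec : ContMDiff 𝓘(ℂ, C3) 𝓘(ℂ, Fin 2 → ℂ) ω TotalSpaceX.fst := fun x => by
  obtain ⟨j, hj⟩ := exists_mem_chart_source x
  refine contMDiffAt_of_comp_chart_symm hj (ContDiff.contDiffAt ?_)
  exact (contDiff_fst.comp contDiff_snd).smul ((contDiff_vec j).comp contDiff_fst)

theorem contMDiff_snd_vec : ContMDiff 𝓘(ℂ, C3) 𝓘(ℂ, Fin 2 → ℂ) ω TotalSpaceX.snd := fun x => by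
  obtain ⟨j, hj⟩ := exists_mem_chart_source x
  refine contMDiffAt_of_comp_chart_symm hj (ContDiff.contDiffAt ?_)
  exact (contDiff_snd.comp contDiff_snd).smul ((contDiff_vec j).comp contDiff_fst)

theorem contMDiff_fst (i : Fin 2) : ContMDiff 𝓘(ℂ, C3) 𝓘(ℂ) ω fun x : TotalSpaceX => x.fst i :=
  (((contDiff_apply ℂ ℂ i)).contMDiff).comp contMDiff_fst_vec

theorem contMDiff_snd (i : Fin 2) : ContMDiff 𝓘(ℂ, C3) 𝓘(ℂ) ω fun x : TotalSpaceX => x.snd i :=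
  (((contDiff_apply ℂ ℂ i)).contMDiff).comp contMDiff_snd_vec

theorem continuous_fst_vec : Continuous TotalSpaceX.fst := contMDiff_fst_vec.continuous

theorem continuous_snd_vec : Continuous TotalSpaceX.snd := contMDiff_snd_vec.continuous

/-! ### Points given by a vector on the line -/

open Classical in
/-- The point `([v], a v, b v)`, for a non-zero vector `v`. -/
def ofVec (v : Fin 2 → ℂ) (a b : ℂ) : TotalSpaceX :=
  if h : v ≠ 0 then
    { line := Projectivization.mk ℂ v h
      fst := a • v
      snd := b • v
      fst_mem := Submodule.smul_mem _ _ (Submodule.mem_span_singleton_self _)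
      snd_mem := Submodule.smul_mem _ _ (Submodule.mem_span_singleton_self _) }
  else (chart 0).symm 0

theorem ofVec_fst {v : Fin 2 → ℂ} (hv : v ≠ 0) (a b : ℂ) : (ofVec v a b).fst = a • v := by
  simp [ofVec, hv]

theorem ofVec_snd {v : Fin 2 → ℂ} (hv : v ≠ 0) (a b : ℂ) : (ofVec v a b).snd = b • v := by
  simp [ofVec, hv]

theorem smul_vec_div {v : Fin 2 → ℂ} {j : Fin 2} (h : v j ≠ 0) :
    v j • vec j (v (1 - j) / v j) = v := by
  funext i
  fin_cases j <;> fin_cases i <;> simp [vec] at h ⊢ <;> field_simp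

/-- Normalizing the j-th entry of v to 1 multiplies the fibre coordinates by `v j`. Smoothness and
continuity of maps into the total space given by a spanning vector are reduced to this formula. -/
theorem ofVec_eq_chart_symm {v : Fin 2 → ℂ} {j : Fin 2} (h : v j ≠ 0) (a b : ℂ) :
    ofVec v a b = (chart j).symm (v (1 - j) / v j, a * v j, b * v j) := by
  have hv : v ≠ 0 := fun h0 => h (by simp [h0])
  have key := smul_vec_div h
  have hl : Projectivization.mk ℂ v hv = Projectivization.mk ℂ (vec j (v (1 - j) / v j))
      (vec_ne_zero _ _) := by
    rw [Projectivization.mk_eq_mk_iff']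
    exact ⟨v j, key⟩
  ext1
  · simp only [ofVec, dif_pos hv]
    exact hl
  · rw [ofVec_fst hv, chart_symm_fst, mul_smul, key]
  · rw [ofVec_snd hv, chart_symm_snd, mul_smul, key]

theorem chart_ofVec {v : Fin 2 → ℂ} {j : Fin 2} (h : v j ≠ 0) (a b : ℂ) :
    chart j (ofVec v a b) = (v (1 - j) / v j, a * v j, b * v j) := by
  rw [ofVec_eq_chart_symm h, chart_chart_symm]

theorem ofVec_mem_chart_source {v : Fin 2 → ℂ} {j : Fin 2} (h : v j ≠ 0) (a b : ℂ) :
    ofVec v a b ∈ (chart j).source := by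
  rw [ofVec_eq_chart_symm h]
  exact chart_symm_mem _ _

theorem ne_zero_of_ofVec_mem_chart_source {v : Fin 2 → ℂ} (hv : v ≠ 0) {j : Fin 2} {a b : ℂ}
    (h : ofVec v a b ∈ (chart j).source) : v j ≠ 0 := by
  rw [mem_chart_source_iff] at h
  simp only [ofVec, dif_pos hv] at h
  obtain ⟨c, hc⟩ := Projectivization.exists_smul_eq_mk_rep ℂ v hv
  rw [← hc] at h
  exact fun h0 => h (by simp [Pi.smul_apply, h0])

theorem exists_apply_ne_zero {v : Fin 2 → ℂ} (hv : v ≠ 0) : ∃ j, v j ≠ 0 :=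
  Function.ne_iff.1 hv

theorem contMDiffAt_ofVec {F : Type*} [NormedAddCommGroup F] [NormedSpace ℂ F]
    {v : F → Fin 2 → ℂ} {a b : F → ℂ} {z : F} (hv : ContDiffAt ℂ ω v z) (ha : ContDiffAt ℂ ω a z)
    (hb : ContDiffAt ℂ ω b z) (h : v z ≠ 0) :
    ContMDiffAt 𝓘(ℂ, F) 𝓘(ℂ, C3) ω (fun y => ofVec (v y) (a y) (b y)) z := by
  obtain ⟨j, hj⟩ := exists_apply_ne_zero h
  have hv' := contDiffAt_pi.1 hv
  have h1 : ContDiffAt ℂ ω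
      (fun y => ((v y (1 - j) / v y j, a y * v y j, b y * v y j) : C3)) z :=
    ((hv' (1 - j)).div (hv' j) hj).prodMk ((ha.mul (hv' j)).prodMk (hb.mul (hv' j)))
  refine (((contMDiff_chart_symm j) _).comp z h1.contMDiffAt).congr_of_eventuallyEq ?_
  filter_upwards [(hv' j).continuousAt.eventually_ne hj] with y hy
  exact ofVec_eq_chart_symm hy _ _

theorem continuousAt_ofVec {T : Type*} [TopologicalSpace T]
    {v : T → Fin 2 → ℂ} {a b : T → ℂ} {z : T} (hv : ContinuousAt v z) (ha : ContinuousAt a z)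
    (hb : ContinuousAt b z) (h : v z ≠ 0) :
    ContinuousAt (fun y => ofVec (v y) (a y) (b y)) z := by
  obtain ⟨j, hj⟩ := exists_apply_ne_zero h
  have hv' := fun i => (continuous_apply i).continuousAt.comp hv
  have h1 : ContinuousAt
      (fun y => ((v y (1 - j) / v y j, a y * v y j, b y * v y j) : C3)) z :=
    ((hv' (1 - j)).div (hv' j) hj).prodMk ((ha.mul (hv' j)).prodMk (hb.mul (hv' j)))
  refine ((continuous_chart_symm j).continuousAt.comp h1).congr ?_
  filter_upwards [(hv' j).eventually_ne hj] with y hy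
  exact (ofVec_eq_chart_symm hy _ _).symm

theorem ofVec_ext {v w : Fin 2 → ℂ} (c : ℂ) (hv : v ≠ 0) (hvw : v = c • w) {a b a' b' : ℂ}
    (ha : a' = a * c) (hb : b' = b * c) : ofVec v a b = ofVec w a' b' := by
  have hw : w ≠ 0 := by
    rintro rfl
    simp [hvw] at hv
  ext1
  · simp only [ofVec, dif_pos hv, dif_pos hw]
    rw [Projectivization.mk_eq_mk_iff']
    exact ⟨c, hvw.symm⟩
  · rw [ofVec_fst hv, ofVec_fst hw, hvw, smul_smul, ha]
  · rw [ofVec_snd hv, ofVec_snd hw, hvw, smul_smul, hb]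

/-! ### The topology of the total space -/

instance : T2Space TotalSpaceX := by
  refine ⟨fun x y hxy => ?_⟩
  -- The two vectors are continuous functions of the point, so only points with equal vectors
  -- require the charts.
  by_cases hf : x.fst = y.fst ∧ x.snd = y.snd
  · by_cases h : ∃ j, x ∈ (chart j).source ∧ y ∈ (chart j).source
    · obtain ⟨j, hx, hy⟩ := h
      obtain ⟨U, V, hU, hV, hxU, hyV, hUV⟩ := t2_separation ((chart j).injOn.ne hx hy hxy)
      refine ⟨_, _, (chart j).isOpen_inter_preimage hU, (chart j).isOpen_inter_preimage hV,
        ⟨hx, hxU⟩, ⟨hy, hyV⟩, ?_⟩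
      exact (hUV.preimage (chart j)).mono inter_subset_right inter_subset_right
    -- Without a common chart the two lines are [1 : 0] and [0 : 1]; they are separated by |z| < 1
    -- and |1/z| < 1.
    · have key : ∀ j : Fin 2, ∀ x y : TotalSpaceX, x ∈ (chart j).source →
          x ∉ (chart (1 - j)).source → y ∉ (chart j).source → y ∈ (chart (1 - j)).source →
          SeparatedNhds {x} {y} := by
        intro j x y hx hx' hy hy'
        have hd : 1 - (1 - j) = j := by fin_cases j <;> rfl
        have ho : ∀ i, IsOpen ((chart i).source ∩ chart i ⁻¹' {c : C3 | ‖c.1‖ < 1}) := fun i =>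
          (chart i).isOpen_inter_preimage (isOpen_lt continuous_fst.norm continuous_const)
        refine ⟨_, _, ho j, ho (1 - j), ?_, ?_, ?_⟩
        · rw [singleton_subset_iff]
          refine ⟨hx, ?_⟩
          have h0 : x.line.rep (1 - j) = 0 := by simpa [mem_chart_source_iff] using hx'
          simp [chart_apply, h0]
        · rw [singleton_subset_iff]
          refine ⟨hy', ?_⟩
          have h0 : y.line.rep j = 0 := by simpa [mem_chart_source_iff] using hy
          simp [chart_apply, h0, hd]
        · rw [Set.disjoint_left]
          rintro z ⟨hz, hz1⟩ ⟨hz', hz1'⟩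
          simp only [chart_apply, mem_preimage, mem_ofPred_eq, hd, norm_div] at hz1 hz1'
          rw [div_lt_one (norm_pos_iff.2 hz)] at hz1
          rw [div_lt_one (norm_pos_iff.2 hz')] at hz1'
          exact lt_asymm hz1 hz1'
      push Not at h
      obtain ⟨j, hj⟩ := exists_mem_chart_source x
      obtain ⟨i, hi⟩ := exists_mem_chart_source y
      have hij : i = 1 - j := by
        have h1 : i ≠ j := fun h' => h j hj (h' ▸ hi)
        revert h1
        fin_cases i <;> fin_cases j <;> simp
      subst hij
      obtain ⟨U, V, hU, hV, h1, h2, h3⟩ := key j x y hj (fun h' => h _ h' hi) (h j hj) hi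
      exact ⟨U, V, hU, hV, h1 rfl, h2 rfl, h3⟩
  · have hne : ((x.fst, x.snd) : (Fin 2 → ℂ) × (Fin 2 → ℂ)) ≠ (y.fst, y.snd) := by
      rwa [Ne, Prod.ext_iff]
    exact separated_by_continuous (continuous_fst_vec.prodMk continuous_snd_vec) hne

instance : SecondCountableTopology TotalSpaceX := by
  have : ∀ j, SecondCountableTopology (chart j).source :=
    fun j => (chart j).secondCountableTopology_source
  exact TopologicalSpace.secondCountableTopology_of_countable_cover
    (fun j => (chart j).open_source)
    (eq_univ_of_forall fun x => mem_iUnion.2 (exists_mem_chart_source x))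

theorem chart_source_eq_range (j : Fin 2) : (chart j).source = range (chart j).symm := by
  rw [← image_univ, ← chart_target j, (chart j).symm_image_target_eq_source]

instance : ConnectedSpace TotalSpaceX := by
  have h : ∀ j, IsConnected (chart j).source := fun j => by
    rw [chart_source_eq_range]
    exact isConnected_range (continuous_chart_symm j)
  have h1 : (chart 0).source ∪ (chart 1).source = univ := by
    refine eq_univ_of_forall fun x => ?_
    exact exists_rep_ne_zero x.line
  rw [connectedSpace_iff_univ, ← h1]
  -- A point over the line [1 : 1] lies in both charts.
  refine (h 0).union ⟨ofVec (fun _ => 1) 0 0, ?_, ?_⟩ (h 1) <;>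
    exact ofVec_mem_chart_source (by simp) _ _

/-- Sets on which both vectors are bounded are relatively compact. -/
theorem isCompact_of_norm_le {K : Set TotalSpaceX} (hK : IsClosed K) (r : ℝ)
    (h1 : ∀ x ∈ K, ‖x.fst‖ ≤ r) (h2 : ∀ x ∈ K, ‖x.snd‖ ≤ r) : IsCompact K := by
  have hc : IsCompact (Metric.closedBall (0 : ℂ) 1 ×ˢ
      (Metric.closedBall (0 : ℂ) r ×ˢ Metric.closedBall (0 : ℂ) r)) :=
    (isCompact_closedBall _ _).prod ((isCompact_closedBall _ _).prod (isCompact_closedBall _ _))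
  refine ((hc.image (continuous_chart_symm 0)).union
    (hc.image (continuous_chart_symm 1))).of_isClosed_subset hK fun x hx => ?_
  -- The chart is taken at the larger entry of the representative, so that the base coordinate lies
  -- in the closed unit disc.
  have key : ∀ j : Fin 2, x ∈ (chart j).source → ‖x.line.rep (1 - j)‖ ≤ ‖x.line.rep j‖ →
      x ∈ (chart j).symm '' (Metric.closedBall (0 : ℂ) 1 ×ˢ
        (Metric.closedBall (0 : ℂ) r ×ˢ Metric.closedBall (0 : ℂ) r)) := by
    intro j hj hle
    refine ⟨chart j x, ⟨?_, ?_, ?_⟩, chart_symm_left_inv hj⟩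
    · rw [chart_apply, mem_closedBall_zero_iff, norm_div]
      exact div_le_one_of_le₀ hle (norm_nonneg _)
    · rw [mem_closedBall_zero_iff]
      exact (norm_le_pi_norm x.fst j).trans (h1 x hx)
    · rw [mem_closedBall_zero_iff]
      exact (norm_le_pi_norm x.snd j).trans (h2 x hx)
  have hne : ∀ j : Fin 2, ‖x.line.rep (1 - j)‖ ≤ ‖x.line.rep j‖ → x ∈ (chart j).source := by
    intro j hj h0
    refine x.line.rep_nonzero (funext fun i => ?_)
    rw [h0, norm_zero] at hj
    have h1 := norm_le_zero_iff.1 hj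
    have : i = j ∨ i = 1 - j := by fin_cases i <;> fin_cases j <;> simp
    rcases this with rfl | rfl
    exacts [h0, h1]
  rcases le_total ‖x.line.rep 1‖ ‖x.line.rep 0‖ with h | h
  · exact Or.inl (key 0 (hne 0 h) h)
  · exact Or.inr (key 1 (hne 1 h) h)

theorem fst_apply_eq (x : TotalSpaceX) {j : Fin 2} (h : x ∈ (chart j).source) :
    x.fst = x.fst j • vec j (chart j x).1 := eq_smul_vec x.line j h x.fst x.fst_mem

theorem snd_apply_eq (x : TotalSpaceX) {j : Fin 2} (h : x ∈ (chart j).source) :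
    x.snd = x.snd j • vec j (chart j x).1 := eq_smul_vec x.line j h x.snd x.snd_mem

end TotalSpaceX

namespace TotalSpaceX

/-! ### The total space is not Stein -/

theorem isClosed_setOf_fst_snd_eq_zero : IsClosed {x : TotalSpaceX | x.fst = 0 ∧ x.snd = 0} :=
  (isClosed_singleton.preimage continuous_fst_vec).inter
    (isClosed_singleton.preimage continuous_snd_vec)

theorem bubbleE_eq : bubbleE = {x | x.fst = 0 ∧ x.snd = 0} := by
  ext x
  constructor
  · rintro ⟨l, rfl⟩
    exact ⟨rfl, rfl⟩
  · rintro ⟨h1, h2⟩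
    exact ⟨x.line, TotalSpaceX.ext rfl h1.symm h2.symm⟩

theorem isCompact_bubbleE : IsCompact bubbleE := by
  rw [bubbleE_eq]
  refine isCompact_of_norm_le isClosed_setOf_fst_snd_eq_zero 0 ?_ ?_
  · rintro x ⟨h, -⟩
    simp [h]
  · rintro x ⟨-, h⟩
    simp [h]

theorem chart_symm_mem_bubbleE (j : Fin 2) (z : ℂ) : (chart j).symm (z, 0, 0) ∈ bubbleE := by
  rw [bubbleE_eq]
  exact ⟨by simp [chart_symm_fst], by simp [chart_symm_snd]⟩

/-- Holomorphic functions are constant on the affine part of the zero section. -/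
theorem apply_chart_symm_eq {f : TotalSpaceX → ℂ} (hf : ContMDiff 𝓘(ℂ, C3) 𝓘(ℂ) ω f) (z w : ℂ) :
    f ((chart 0).symm (z, 0, 0)) = f ((chart 0).symm (w, 0, 0)) := by
  have hs : ContDiff ℂ ω fun z : ℂ => ((z, 0, 0) : C3) := contDiff_id.prodMk contDiff_const
  have hd : ContDiff ℂ ω fun z : ℂ => f ((chart 0).symm (z, 0, 0)) :=
    (hf.comp ((contMDiff_chart_symm 0).comp hs.contMDiff)).contDiff
  -- Liouville's theorem: f is bounded on the compact curve E.
  refine (hd.differentiable (by simp)).apply_eq_apply_of_bounded ?_ z w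
  refine (isCompact_bubbleE.image hf.continuous).isBounded.subset ?_
  rintro _ ⟨z, rfl⟩
  exact mem_image_of_mem f (chart_symm_mem_bubbleE 0 z)

theorem not_isStein : ¬ IsStein C3 TotalSpaceX := by
  rintro ⟨h, -⟩
  have hne : (chart 0).symm (0, 0, 0) ≠ (chart 0).symm (1, 0, 0) := fun h0 => by
    have := congrArg (chart 0) h0
    rw [chart_chart_symm, chart_chart_symm] at this
    simp at this
  obtain ⟨f, hf, hfne⟩ := h _ _ hne
  exact hfne (apply_chart_symm_eq hf 0 1)

/-! ### The domain and the function on it -/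

theorem mem_domainD {x : TotalSpaceX} : x ∈ domainD ↔ x.fst ≠ 0 := Iff.rfl

theorem isConnected_domainD : IsConnected (domainD : Set TotalSpaceX) := by
  have hc : IsConnected {y : C3 | y.2.1 ≠ 0} := by
    have h0 : IsConnected ({0}ᶜ : Set ℂ) :=
      isConnected_compl_singleton_of_one_lt_rank (by simp) 0
    have := (isConnected_univ (α := ℂ)).prod (h0.prod (isConnected_univ (α := ℂ)))
    convert this using 1
    ext y
    simp
  have h (j : Fin 2) : IsConnected ((chart j).symm '' {y : C3 | y.2.1 ≠ 0}) :=
    hc.image _ (continuous_chart_symm j).continuousOn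
  have hD : (domainD : Set TotalSpaceX) =
      (chart 0).symm '' {y : C3 | y.2.1 ≠ 0} ∪ (chart 1).symm '' {y : C3 | y.2.1 ≠ 0} := by
    have key (j : Fin 2) (x : TotalSpaceX) (hj : x ∈ (chart j).source) (hx : x.fst ≠ 0) :
        x ∈ (chart j).symm '' {y : C3 | y.2.1 ≠ 0} :=
      ⟨chart j x, fun h0 => hx ((fst_eq_zero_iff x j hj).2 h0), chart_symm_left_inv hj⟩
    ext x
    constructor
    · intro hx
      exact (exists_rep_ne_zero x.line).imp (fun h => key 0 x h hx) fun h => key 1 x h hx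
    · rintro (⟨y, hy, rfl⟩ | ⟨y, hy, rfl⟩) <;>
        exact smul_ne_zero hy (vec_ne_zero _ _)
  rw [hD]
  have hp (j : Fin 2) : ofVec (fun _ => 1) 1 0 ∈ (chart j).symm '' {y : C3 | y.2.1 ≠ 0} :=
    ⟨(1, 1, 0), by simp, by rw [ofVec_eq_chart_symm (j := j) (by simp)]; simp⟩
  exact (h 0).union ⟨_, hp 0, hp 1⟩ (h 1)

open Classical in
/-- The ratio of the second to the first vector. -/
def ratio (x : TotalSpaceX) : ℂ :=
  if x.fst 0 ≠ 0 then x.snd 0 / x.fst 0 else x.snd 1 / x.fst 1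

theorem expRatio_eq (x : TotalSpaceX) : expRatio x = Complex.exp (ratio x) := by
  unfold expRatio ratio
  split_ifs <;> rfl

/-- Both vectors lie on one line, so the 2 × 2 minors vanish. Hence ξ₂/ξ₁ and η₂/η₁ agree where both
make sense. -/
theorem fst_mul_snd (x : TotalSpaceX) (i j : Fin 2) :
    x.fst i * x.snd j = x.fst j * x.snd i := by
  obtain ⟨k, hk⟩ := exists_mem_chart_source x
  rw [fst_apply_eq x hk, snd_apply_eq x hk]
  simp only [Pi.smul_apply, smul_eq_mul]
  ring

theorem ratio_eq {x : TotalSpaceX} {i : Fin 2} (h : x.fst i ≠ 0) :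
    ratio x = x.snd i / x.fst i := by
  unfold ratio
  split_ifs with h0
  · rw [div_eq_div_iff h0 h, mul_comm, fst_mul_snd, mul_comm]
  · fin_cases i
    · exact absurd h (by simpa using h0)
    · rfl

/-- This relation is what survives analytic continuation: unlike λ, the two vectors are defined on
Σ₁ as well. -/
theorem snd_eq_ratio_smul {x : TotalSpaceX} (h : x ∈ domainD) : x.snd = ratio x • x.fst := by
  obtain ⟨i, hi⟩ := exists_apply_ne_zero (mem_domainD.1 h)
  funext j
  rw [ratio_eq hi, Pi.smul_apply, smul_eq_mul]
  field_simp
  rw [mul_comm, fst_mul_snd, mul_comm]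

theorem contMDiffOn_ratio : ContMDiffOn 𝓘(ℂ, C3) 𝓘(ℂ) ω ratio domainD := by
  intro x hx
  obtain ⟨i, hi⟩ := exists_apply_ne_zero (mem_domainD.1 hx)
  refine ContMDiffAt.contMDiffWithinAt ?_
  refine (((contMDiff_snd i) x).div₀ ((contMDiff_fst i) x) hi).congr_of_eventuallyEq ?_
  filter_upwards [(contMDiff_fst i).continuous.continuousAt.eventually_ne hi] with y hy
  exact ratio_eq hy

theorem contMDiffOn_expRatio : ContMDiffOn 𝓘(ℂ, C3) 𝓘(ℂ) ω expRatio domainD := by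
  have h : ContMDiffOn 𝓘(ℂ, C3) 𝓘(ℂ) ω (Complex.exp ∘ ratio) domainD :=
    Complex.contDiff_exp.contMDiff.comp_contMDiffOn contMDiffOn_ratio
  exact h.congr fun x _ => expRatio_eq x

theorem bubbleE_subset_hypersurface : bubbleE ⊆ hypersurface := by
  rintro _ ⟨l, rfl⟩
  rfl

/-! ### The function does not extend meromorphically -/

/-- Under s ↦ 1/s this is the growth of exp against powers. -/
theorem tendsto_pow_mul_exp_inv (n : ℕ) :
    Tendsto (fun s : ℝ => s ^ n * Real.exp s⁻¹) (𝓝[>] 0) atTop := by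
  have h := (Real.tendsto_exp_div_pow_atTop n).comp tendsto_inv_nhdsGT_zero
  refine h.congr fun s => ?_
  simp [div_eq_mul_inv, mul_comm]

/-- A function of one variable with an essential singularity of exponential type is not a quotient
of holomorphic functions. -/
theorem eventually_eq_zero_of_mul_exp_eq {h g : ℂ → ℂ} {b : ℂ} (hb : b ≠ 0)
    (hh : AnalyticAt ℂ h 0) (hg : ContinuousAt g 0)
    (heq : ∀ᶠ w in 𝓝[≠] 0, h w * Complex.exp (b / w) = g w) : ∀ᶠ w in 𝓝 0, h w = 0 := by
  by_contra hne
  obtain ⟨n, φ, hφ, hφ0, hφe⟩ := hh.exists_eventuallyEq_pow_smul_nonzero_iff.2 hne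
  -- On the ray w = s b with s > 0 the exponent b/w is 1/s. There |h(w) exp(b/w)| = sⁿ exp(1/s) |b|ⁿ
  -- |φ(w)| with φ(0) ≠ 0 is unbounded, whereas g has a limit.
  have hs : Tendsto (fun s : ℝ => (s : ℂ) * b) (𝓝[>] 0) (𝓝[≠] 0) := by
    refine tendsto_nhdsWithin_iff.2 ⟨?_, ?_⟩
    · have : ContinuousAt (fun s : ℝ => (s : ℂ) * b) 0 := by fun_prop
      have h0 := this.tendsto
      simp only [Complex.ofReal_zero, zero_mul] at h0
      exact h0.mono_left nhdsWithin_le_nhds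
    · filter_upwards [self_mem_nhdsWithin] with s hs
      exact mul_ne_zero (by exact_mod_cast (ne_of_gt hs)) hb
  have hs0 := hs.mono_right nhdsWithin_le_nhds
  have hlim : Tendsto (fun s : ℝ => ‖g (s * b)‖) (𝓝[>] 0) (𝓝 ‖g 0‖) :=
    (hg.tendsto.comp hs0).norm
  have hinf : Tendsto (fun s : ℝ => (s ^ n * Real.exp s⁻¹) * (‖b‖ ^ n * ‖φ (s * b)‖))
      (𝓝[>] 0) atTop := by
    refine (tendsto_pow_mul_exp_inv n).atTop_mul_pos (C := ‖b‖ ^ n * ‖φ 0‖) (by positivity) ?_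
    exact ((hφ.continuousAt.tendsto.comp hs0).norm).const_mul _
  refine not_tendsto_nhds_of_tendsto_atTop hinf _ (hlim.congr' ?_)
  filter_upwards [hs.eventually heq, hs0.eventually hφe, self_mem_nhdsWithin] with s h1 h2 hpos
  have hs0 : (0 : ℝ) < s := hpos
  have hsc : (s : ℂ) ≠ 0 := by exact_mod_cast hs0.ne'
  have h3 : b / ((s : ℂ) * b) = ((s⁻¹ : ℝ) : ℂ) := by
    push_cast
    field_simp
  rw [← h1, h2, h3, sub_zero, norm_mul, norm_smul, norm_pow, norm_mul, Complex.norm_real,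
    Complex.norm_exp, Complex.ofReal_re, Real.norm_of_nonneg hs0.le]
  ring

theorem not_extendsMeromorphicallyAt {x : TotalSpaceX} (hx : x ∈ hypersurface) :
    ¬ ExtendsMeromorphicallyAt C3 domainD expRatio x := by
  rintro ⟨V, hV, hxV, g, h, hg, hh, hne, heq⟩
  obtain ⟨j, hj⟩ := exists_mem_chart_source x
  set p₀ : C3 := chart j x with hp₀
  have hp₀x : (chart j).symm p₀ = x := chart_symm_left_inv hj
  have hW : IsOpen ((chart j).symm ⁻¹' V) := hV.preimage (continuous_chart_symm j)
  have hp₀W : p₀ ∈ (chart j).symm ⁻¹' V := by rwa [mem_preimage, hp₀x]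
  have hcd : ∀ f : TotalSpaceX → ℂ, ContMDiffOn 𝓘(ℂ, C3) 𝓘(ℂ) ω f V →
      ContDiffOn ℂ ω (f ∘ (chart j).symm) ((chart j).symm ⁻¹' V) := fun f hf =>
    (hf.comp (contMDiff_chart_symm j).contMDiffOn Subset.rfl).contDiffOn
  obtain ⟨ε, hε, hball⟩ := Metric.isOpen_iff.1 hW p₀ hp₀W
  have hp₀0 : p₀.2.1 = 0 := by
    have : x.fst = 0 := hx
    simp [hp₀, chart_apply, this]
  -- a point near `p₀` where `h` does not vanish, with nonzero last coordinate
  obtain ⟨p₁, hp₁b, hp₁h⟩ : ∃ p ∈ Metric.ball p₀ ε, h ((chart j).symm p) ≠ 0 := by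
    have h1 : ∃ᶠ z in 𝓝 x, h z ≠ 0 := hne x hxV
    have h2 : ∀ᶠ z in 𝓝 x, z ∈ (chart j).source ∧ chart j z ∈ Metric.ball p₀ ε :=
      ((chart j).open_source.eventually_mem hj).and
        (((chart j).continuousAt hj).eventually (Metric.ball_mem_nhds _ hε))
    obtain ⟨z, hz, hzs, hzb⟩ := (h1.and_eventually h2).exists
    exact ⟨chart j z, hzb, by rwa [chart_symm_left_inv hzs]⟩
  obtain ⟨b, hb0, hbb, hbh⟩ : ∃ b : ℂ, b ≠ 0 ∧ (p₁.1, p₁.2.1, b) ∈ Metric.ball p₀ ε ∧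
      h ((chart j).symm (p₁.1, p₁.2.1, b)) ≠ 0 := by
    have hc : Continuous fun b : ℂ => ((p₁.1, p₁.2.1, b) : C3) := by fun_prop
    have h1 : ∀ᶠ b in 𝓝 p₁.2.2, (p₁.1, p₁.2.1, b) ∈ Metric.ball p₀ ε :=
      hc.continuousAt.eventually (Metric.isOpen_ball.mem_nhds hp₁b)
    have h2 : ∀ᶠ b in 𝓝 p₁.2.2, h ((chart j).symm (p₁.1, p₁.2.1, b)) ≠ 0 := by
      have h3 : ContinuousAt (h ∘ (chart j).symm) p₁ :=
        (hcd h hh).continuousOn.continuousAt (hW.mem_nhds (hball hp₁b))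
      exact (ContinuousAt.comp (x := p₁.2.2) (g := h ∘ (chart j).symm) h3
        hc.continuousAt).eventually_ne hp₁h
    have h3 : ∃ᶠ b in 𝓝 p₁.2.2, b ≠ 0 :=
      mem_closure_iff_frequently.1 (dense_compl_singleton (0 : ℂ) p₁.2.2)
    obtain ⟨b, hb, hb1, hb2⟩ := (h3.and_eventually (h1.and h2)).exists
    exact ⟨b, hb, hb1, hb2⟩
  -- the slice
  let ι : ℂ → C3 := fun w => (p₁.1, w, b)
  have hι : ContDiff ℂ ω ι := contDiff_const.prodMk (contDiff_id.prodMk contDiff_const)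
  -- The distance on `C3` is a maximum, so the ball is a product of discs and the middle coordinate
  -- may move freely in its disc.
  rw [Metric.mem_ball, Prod.dist_eq, max_lt_iff, Prod.dist_eq, max_lt_iff] at hbb
  have hmaps : ∀ w ∈ Metric.ball (0 : ℂ) ε, ι w ∈ (chart j).symm ⁻¹' V := fun w hw => by
    refine hball ?_
    rw [Metric.mem_ball, Prod.dist_eq, max_lt_iff, Prod.dist_eq, max_lt_iff]
    refine ⟨hbb.1, ?_, hbb.2.2⟩
    rw [hp₀0]
    exact hw
  have han : AnalyticOnNhd ℂ (h ∘ (chart j).symm ∘ ι) (Metric.ball 0 ε) := fun w hw => by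
    have h1 : ContDiffAt ℂ ω (h ∘ (chart j).symm) (ι w) :=
      (hcd h hh).contDiffAt (hW.mem_nhds (hmaps w hw))
    exact (h1.comp w hι.contDiffAt).analyticAt
  have h0 : (0 : ℂ) ∈ Metric.ball (0 : ℂ) ε := Metric.mem_ball_self hε
  have hgc : ContinuousAt (g ∘ (chart j).symm ∘ ι) 0 := by
    have h1 : ContinuousAt (g ∘ (chart j).symm) (ι 0) :=
      (hcd g hg).continuousOn.continuousAt (hW.mem_nhds (hmaps 0 h0))
    exact ContinuousAt.comp (x := (0 : ℂ)) (g := g ∘ (chart j).symm) h1 hι.continuous.continuousAt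
  have hzero : ∀ᶠ w in 𝓝 0, (h ∘ (chart j).symm ∘ ι) w = 0 := by
    refine eventually_eq_zero_of_mul_exp_eq hb0 (han 0 h0) hgc ?_
    filter_upwards [self_mem_nhdsWithin, nhdsWithin_le_nhds (Metric.ball_mem_nhds 0 hε)] with w hw
      hwb
    have hf : ((chart j).symm (ι w)).fst j = w := by simp [chart_symm_fst, ι, vec]
    have hs : ((chart j).symm (ι w)).snd j = b := by simp [chart_symm_snd, ι, vec]
    have hfne : ((chart j).symm (ι w)).fst j ≠ 0 := by rwa [hf]
    have hD : (chart j).symm (ι w) ∈ domainD := mem_domainD.2 fun h0 => hfne (by simp [h0])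
    have := heq _ ⟨hmaps w hwb, hD⟩
    rwa [expRatio_eq, ratio_eq hfne, hf, hs] at this
  -- The identity theorem carries the vanishing from ξ₁ = 0 along the slice to `p₁.2.1`, where h was
  -- chosen non-zero.
  have := han.eqOn_zero_of_preconnected_of_eventuallyEq_zero
    (convex_ball _ _).isPreconnected h0 hzero (x := p₁.2.1) (by rw [← hp₀0]; exact hbb.2.1)
  exact hbh this

end TotalSpaceX

/-! ### Domains of the total space over themselves -/

section OpensVal

variable {E : Type*} [NormedAddCommGroup E] [NormedSpace ℂ E] {M : Type*}
  [TopologicalSpace M] [ChartedSpace E M]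

theorem isLocalDiffeomorph_opens_val (U : TopologicalSpace.Opens M) :
    IsLocalDiffeomorph 𝓘(ℂ, E) 𝓘(ℂ, E) ω (Subtype.val : U → M) := by
  intro x
  let e := U.openPartialHomeomorphSubtypeCoe ⟨x⟩
  have htgt : e.target = U := U.openPartialHomeomorphSubtypeCoe_target ⟨x⟩
  have hval : ∀ y ∈ (U : Set M), (e.symm y : M) = y := fun y hy => e.right_inv (htgt ▸ hy)
  refine ⟨{ toPartialEquiv := e.toPartialEquiv
            open_source := e.open_source
            open_target := e.open_target
            contMDiffOn_toFun := contMDiff_subtype_val.contMDiffOn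
            contMDiffOn_invFun := ?_ }, mem_univ x, fun _ _ => rfl⟩
  intro y hy
  refine (ChartedSpace.liftPropWithinAt_subtypeVal_comp_iff _ _ _).1 ?_
  refine (contMDiffWithinAt_id (x := y)).congr (fun z hz => hval z (htgt ▸ hz)) (hval y (htgt ▸ hy))

end OpensVal

namespace TotalSpaceX

/-! ### The envelope of holomorphy of the domain -/

/-- Two holomorphic functions on a connected manifold which agree near a point are equal. -/
theorem _root_.ContMDiff.eq_of_eventuallyEq_nhds {E : Type*} [NormedAddCommGroup E]
    [NormedSpace ℂ E] {M : Type*} [TopologicalSpace M] [ChartedSpace E M]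
    [IsManifold 𝓘(ℂ, E) ω M] [PreconnectedSpace M] {f g : M → ℂ}
    (hf : ContMDiff 𝓘(ℂ, E) 𝓘(ℂ) ω f) (hg : ContMDiff 𝓘(ℂ, E) 𝓘(ℂ) ω g) {x : M}
    (h : f =ᶠ[𝓝 x] g) : f = g := by
  -- The set where the germs agree is open by its definition; at a limit point the identity theorem
  -- on a ball of a chart shows that it is closed.
  have key : ∀ y : M, y ∈ closure {z | f =ᶠ[𝓝 z] g} → f =ᶠ[𝓝 y] g := by
    intro y hy
    let e := chartAt E y
    have hes : y ∈ e.source := mem_chart_source E y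
    obtain ⟨ε, hε, hb⟩ := Metric.isOpen_iff.1 e.open_target (e y) (e.map_source hes)
    have han : ∀ k : M → ℂ, ContMDiff 𝓘(ℂ, E) 𝓘(ℂ) ω k →
        AnalyticOnNhd ℂ (k ∘ e.symm) (Metric.ball (e y) ε) := fun k hk z hz => by
      have h1 : ContMDiffOn 𝓘(ℂ, E) 𝓘(ℂ) ω (k ∘ e.symm) e.target :=
        hk.comp_contMDiffOn (contMDiffOn_chart_symm (x := y))
      exact (h1.contDiffOn.contDiffAt (e.open_target.mem_nhds (hb hz))).analyticAt
    have hU : IsOpen (e.source ∩ e ⁻¹' Metric.ball (e y) ε) :=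
      e.isOpen_inter_preimage Metric.isOpen_ball
    have hyU : y ∈ e.source ∩ e ⁻¹' Metric.ball (e y) ε := ⟨hes, Metric.mem_ball_self hε⟩
    obtain ⟨z, ⟨hzs, hzb⟩, hz⟩ := mem_closure_iff.1 hy _ hU hyU
    have hz' : f ∘ e.symm =ᶠ[𝓝 (e z)] g ∘ e.symm := by
      have := (e.continuousAt_symm (e.map_source hzs)).tendsto
      rw [e.left_inv hzs] at this
      exact this.eventually hz
    have heq := (han f hf).eqOn_of_preconnected_of_eventuallyEq (han g hg)
      (convex_ball _ _).isPreconnected hzb hz'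
    filter_upwards [hU.mem_nhds hyU] with w hw
    have := heq hw.2
    simpa [e.left_inv hw.1] using this
  have hopen : IsOpen {z | f =ᶠ[𝓝 z] g} := isOpen_setOfPred_eventually_nhds
  have hclopen : IsClopen {z | f =ᶠ[𝓝 z] g} :=
    ⟨isClosed_of_closure_subset fun y hy => key y hy, hopen⟩
  have huniv := hclopen.eq_univ ⟨x, h⟩
  funext y
  have : y ∈ {z | f =ᶠ[𝓝 z] g} := huniv ▸ mem_univ y
  exact this.eq_of_nhds

variable (R : HolomorphicExtension C3 domainD)

/-- Near `R.incl x` a point and the copy in R of its projection lie in one set on which `proj` is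
injective, hence coincide. So identities on D hold on an open subset of R. -/
theorem eventually_incl_proj (x : domainD) : ∀ᶠ y in 𝓝 (R.incl x),
    ∃ z : domainD, R.proj y = z ∧ y = R.incl z := by
  obtain ⟨Φ, hx, heq⟩ := R.isLocalDiffeomorph_proj (R.incl x)
  have hc : Continuous R.incl := R.contMDiff_incl.continuous
  have hp : Continuous R.proj := R.isLocalDiffeomorph_proj.contMDiff.continuous
  have ho : IsOpen (Subtype.val '' (R.incl ⁻¹' Φ.source)) :=
    domainD.2.isOpenMap_subtype_val _ (Φ.open_source.preimage hc)
  have h1 : ∀ᶠ y in 𝓝 (R.incl x), R.proj y ∈ Subtype.val '' (R.incl ⁻¹' Φ.source) := by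
    refine hp.continuousAt.eventually (ho.mem_nhds ?_)
    rw [R.proj_incl]
    exact ⟨x, hx, rfl⟩
  filter_upwards [h1, Φ.open_source.mem_nhds hx] with y hy hyΦ
  obtain ⟨z, hz, hzy⟩ := hy
  refine ⟨z, hzy.symm, Φ.toPartialEquiv.injOn hyΦ hz ?_⟩
  have h2 : R.proj y = R.proj (R.incl z) := by rw [R.proj_incl, hzy]
  rwa [heq hyΦ, heq hz] at h2

/-- Every holomorphic extension of the domain lies over the domain itself. -/
theorem proj_mem_domainD (y : R.carrier) : R.proj y ∈ domainD := by
  by_contra hy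
  have hratio : ContMDiff 𝓘(ℂ, C3) 𝓘(ℂ) ω fun x : domainD => ratio x := fun x =>
    contMDiffAt_subtype_iff.2 (contMDiffOn_ratio.contMDiffAt (domainD.2.mem_nhds x.2))
  obtain ⟨Λ, hΛ, hΛe⟩ := R.exists_extension _ hratio
  have hp : ContMDiff 𝓘(ℂ, C3) 𝓘(ℂ, C3) ω R.proj := R.isLocalDiffeomorph_proj.contMDiff
  have hD := isConnected_domainD.nonempty
  -- Analytic continuation of v₂ = λ v₁ from the copy of D to all of R.
  have heq : ∀ i, (fun y => (R.proj y).snd i) = fun y => Λ y * (R.proj y).fst i := fun i => by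
    refine ContMDiff.eq_of_eventuallyEq_nhds (x := R.incl ⟨hD.some, hD.some_mem⟩)
      ((contMDiff_snd i).comp hp) (hΛ.mul ((contMDiff_fst i).comp hp)) ?_
    filter_upwards [eventually_incl_proj R ⟨hD.some, hD.some_mem⟩] with y hy
    obtain ⟨z, hz, rfl⟩ := hy
    simp only [hz, hΛe]
    exact congrFun (snd_eq_ratio_smul z.2) i
  have hfst : (R.proj y).fst = 0 := not_not.1 hy
  -- With a point of Σ₁ the open range contains nearby points with the same base coordinate, v₁ = 0
  -- and v₂ ≠ 0. They contradict v₂ = Λ v₁.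
  have hopen : IsOpen (range R.proj) := R.isLocalDiffeomorph_proj.isOpen_range
  obtain ⟨j, hj⟩ := exists_mem_chart_source (R.proj y)
  set p := chart j (R.proj y)
  let ι : ℂ → TotalSpaceX := fun b => (chart j).symm (p.1, 0, b)
  have hι : Continuous ι := (continuous_chart_symm j).comp (by fun_prop)
  have hp2 : p.2.1 = 0 := by
    change (R.proj y).fst j = 0
    simp [hfst]
  have hιp : ι p.2.2 = R.proj y := by
    change (chart j).symm (p.1, 0, p.2.2) = _
    rw [← hp2]
    exact chart_symm_left_inv hj
  have h1 : ∀ᶠ b in 𝓝 p.2.2, ι b ∈ range R.proj :=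
    hι.continuousAt.eventually (hopen.mem_nhds (by rw [hιp]; exact mem_range_self y))
  have h2 : ∃ᶠ b in 𝓝 p.2.2, b ≠ 0 :=
    mem_closure_iff_frequently.1 (dense_compl_singleton (0 : ℂ) p.2.2)
  obtain ⟨b, hb, y', hy'⟩ := (h2.and_eventually h1).exists
  have := congrFun (heq j) y'
  simp only [hy'] at this
  have hb0 : b = 0 := by simpa [ι, chart_symm_fst, chart_symm_snd, vec] using this
  exact hb hb0

instance : ConnectedSpace domainD := isConnected_iff_connectedSpace.1 isConnected_domainD

/-- The domain, as a domain over the total space. -/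
def trivialExtension : HolomorphicExtension C3 domainD where
  carrier := domainD
  proj := Subtype.val
  isLocalDiffeomorph_proj := isLocalDiffeomorph_opens_val _
  incl := id
  contMDiff_incl := contMDiff_id
  proj_incl _ := rfl
  exists_extension f hf := ⟨f, hf, fun _ => rfl⟩

/-- As every extension lies over D, its projection is the required map into D. -/
theorem isEnvelope_trivialExtension : trivialExtension.IsEnvelope := by
  intro R
  refine ⟨fun y => (⟨R.proj y, proj_mem_domainD R y⟩ : domainD), ?_, fun y => rfl,
    fun x => Subtype.ext (R.proj_incl x)⟩
  exact fun y => (ChartedSpace.liftPropWithinAt_subtypeVal_comp_iff _ _ _).1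
    (R.isLocalDiffeomorph_proj.contMDiff y)

/-! ### The discs -/

theorem disc_fst (t : ℝ) (ζ : ℂ) : (disc t ζ).fst = ![ζ, (t : ℂ)] := rfl

theorem disc_snd (t : ℝ) (ζ : ℂ) : (disc t ζ).snd = 0 := rfl

theorem disc_eq_ofVec {t : ℝ} (ht : t ≠ 0) (ζ : ℂ) : disc t ζ = ofVec ![ζ, (t : ℂ)] 1 0 := by
  have hv : (![ζ, (t : ℂ)] : Fin 2 → ℂ) ≠ 0 := fun h0 => ht (by simpa using congrFun h0 1)
  ext1
  · simp only [disc, discVec, if_neg ht, ofVec, dif_pos hv]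
  · simp [disc_fst, ofVec_fst hv]
  · simp [disc_snd, ofVec_snd hv]

theorem disc_zero_eq_ofVec (ζ : ℂ) : disc 0 ζ = ofVec ![1, 0] ζ 0 := by
  have hv : (![1, 0] : Fin 2 → ℂ) ≠ 0 := fun h0 => by simpa using congrFun h0 0
  ext1
  · simp only [disc, discVec, if_true, ofVec, dif_pos hv]
  · simp [disc_fst, ofVec_fst hv]
  · simp [disc_snd, ofVec_snd hv]

/-- Covers both clauses in the definition of `disc`. For t = 0 the line must be [1 : 0]; this has to
be assumed, since it cannot be read off from a v when a = 0. -/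
theorem ofVec_eq_disc {v : Fin 2 → ℂ} {a : ℂ} {t : ℝ} {ζ : ℂ} (hv : v ≠ 0)
    (h0 : a * v 0 = ζ) (h1 : a * v 1 = t) (h : t = 0 → v 1 = 0) :
    ofVec v a 0 = disc t ζ := by
  by_cases ht : t = 0
  · subst ht
    have hv1 := h rfl
    rw [disc_zero_eq_ofVec]
    refine ofVec_ext (v 0) hv ?_ h0.symm (by simp)
    ext i
    fin_cases i <;> simp [hv1]
  · rw [disc_eq_ofVec ht]
    have ha : a ≠ 0 := by
      rintro rfl
      exact ht (by simpa using h1.symm)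
    refine ofVec_ext a⁻¹ hv ?_ (by simp [ha]) (by simp)
    rw [← h0, ← h1]
    ext i
    fin_cases i <;> simp [ha]

theorem contMDiff_disc (t : ℝ) : ContMDiff 𝓘(ℂ) 𝓘(ℂ, C3) ω (disc t) := by
  by_cases ht : t = 0
  · subst ht
    rw [funext disc_zero_eq_ofVec]
    exact fun z => contMDiffAt_ofVec contDiffAt_const contDiffAt_id contDiffAt_const
      fun h0 => by simpa using congrFun h0 0
  · rw [funext (disc_eq_ofVec ht)]
    refine fun z => contMDiffAt_ofVec (contDiffAt_pi.2 fun i => ?_) contDiffAt_const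
      contDiffAt_const fun h0 => ht (by simpa using congrFun h0 1)
    fin_cases i
    · exact contDiffAt_id
    · exact contDiffAt_const

/-- The global function ξ₁ is a left inverse of `disc t`. It gives the embedding here and, by the
chain rule, the injectivity of the differential in the next lemma. -/
theorem isEmbedding_disc (t : ℝ) : IsEmbedding (disc t) :=
  (show Function.LeftInverse (fun x : TotalSpaceX => x.fst 0) (disc t) from fun _ => rfl).isEmbedding
    (contMDiff_fst 0).continuous (contMDiff_disc t).continuous

theorem injective_mfderiv_disc (t : ℝ) (ζ : ℂ) :
    Function.Injective (mfderiv 𝓘(ℂ) 𝓘(ℂ, C3) (disc t) ζ) := by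
  have h1 := ((contMDiff_fst 0) (disc t ζ)).mdifferentiableAt (by simp)
  have h2 := ((contMDiff_disc t) ζ).mdifferentiableAt (by simp)
  have h3 := mfderiv_comp ζ h1 h2
  have h4 : (fun x : TotalSpaceX => x.fst 0) ∘ disc t = id := rfl
  rw [h4, mfderiv_id] at h3
  refine Function.LeftInverse.injective
    (g := mfderiv 𝓘(ℂ, C3) 𝓘(ℂ) (fun x : TotalSpaceX => x.fst 0) (disc t ζ)) fun v => ?_
  exact (congrArg (fun L => L v) h3).symm

/-- Off Σ₁ the line is spanned by v₁. -/
theorem line_eq_of_fst_ne_zero {x y : TotalSpaceX} (h : x.fst = y.fst) (h0 : x.fst ≠ 0) :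
    x.line = y.line := by
  have key : ∀ z : TotalSpaceX, ∀ hz : z.fst ≠ 0, z.line = Projectivization.mk ℂ z.fst hz := by
    intro z hz
    have hm := z.fst_mem
    rw [Projectivization.submodule_eq, Submodule.mem_span_singleton] at hm
    obtain ⟨a, ha⟩ := hm
    conv_lhs => rw [← z.line.mk_rep]
    symm
    rw [Projectivization.mk_eq_mk_iff']
    exact ⟨a, ha⟩
  rw [key x h0, key y (h ▸ h0)]
  simp only [h]

theorem curve_eq_image_disc {t : ℝ} (ht : t ≠ 0) : curve t = disc t '' Metric.ball 0 1 := by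
  ext x
  constructor
  · rintro ⟨h1, h2, h3⟩
    have hf : (disc t (x.fst 0)).fst = x.fst := by
      ext i
      fin_cases i
      · rfl
      · exact h2.symm
    refine ⟨x.fst 0, by simpa using h1, TotalSpaceX.ext (line_eq_of_fst_ne_zero hf ?_) hf h3.symm⟩
    exact fun h0 => ht (by simpa [disc_fst] using congrFun h0 1)
  · rintro ⟨ζ, hζ, rfl⟩
    exact ⟨by simpa [disc_fst] using hζ, by simp [disc_fst], rfl⟩

end TotalSpaceX

/-! ### Complex and real smoothness over the half-plane -/

section RestrictScalars

variable {N N' : Type*} [TopologicalSpace N] [ChartedSpace ClosedHalfPlane N]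
  [TopologicalSpace N'] [ChartedSpace ClosedHalfPlane N']

theorem range_realModel : range realModel = {z : ℂ | 0 ≤ z.im} := range_halfPlaneEquiv

theorem range_complexModel : range complexModel = {z : ℂ | 0 ≤ z.im} := range_halfPlaneEquiv

theorem ContMDiffWithinAt.restrictScalars_realModel {n : ℕ∞ω} {f : N → ℂ} {s : Set N} {x : N}
    (h : ContMDiffWithinAt complexModel 𝓘(ℂ) n f s x) :
    ContMDiffWithinAt realModel 𝓘(ℝ, ℂ) n f s x :=
  ⟨h.1, ContDiffWithinAt.restrict_scalars ℝ h.2⟩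

theorem ContMDiff.restrictScalars_realModel {n : ℕ∞ω} {f : N → ℂ}
    (h : ContMDiff complexModel 𝓘(ℂ) n f) : ContMDiff realModel 𝓘(ℝ, ℂ) n f :=
  fun x => ContMDiffWithinAt.restrictScalars_realModel (h x)

theorem coe_realModel_symm {y : ℂ} (hy : 0 ≤ y.im) : (realModel.symm y : ℂ) = y :=
  halfPlaneEquiv.right_inv hy

theorem coe_complexModel_symm {y : ℂ} (hy : 0 ≤ y.im) : (complexModel.symm y : ℂ) = y :=
  halfPlaneEquiv.right_inv hy

/-- An interior point is one whose chart value has positive imaginary part. -/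
theorem isInteriorPoint_complexModel_iff {x : N} :
    complexModel.IsInteriorPoint x ↔ 0 < (chartAt ClosedHalfPlane x x : ℂ).im := by
  change (chartAt ClosedHalfPlane x x : ℂ) ∈ interior (range complexModel) ↔ _
  rw [range_complexModel, Complex.interior_setOfPred_le_im]
  rfl

theorem isInteriorPoint_realModel_iff {x : N} :
    realModel.IsInteriorPoint x ↔ 0 < (chartAt ClosedHalfPlane x x : ℂ).im := by
  change (chartAt ClosedHalfPlane x x : ℂ) ∈ interior (range realModel) ↔ _
  rw [range_realModel, Complex.interior_setOfPred_le_im]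
  rfl

theorem mem_boundary_complexModel_iff {x : N} :
    x ∈ complexModel.boundary N ↔ (chartAt ClosedHalfPlane x x : ℂ).im = 0 := by
  rw [← complexModel.compl_interior, mem_compl_iff]
  change ¬ complexModel.IsInteriorPoint x ↔ _
  rw [isInteriorPoint_complexModel_iff, not_lt]
  exact ⟨fun h => le_antisymm h (chartAt ClosedHalfPlane x x).2, fun h => h.le⟩

theorem mem_boundary_realModel_iff {x : N} :
    x ∈ realModel.boundary N ↔ (chartAt ClosedHalfPlane x x : ℂ).im = 0 := by
  rw [← realModel.compl_interior, mem_compl_iff]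
  change ¬ realModel.IsInteriorPoint x ↔ _
  rw [isInteriorPoint_realModel_iff, not_lt]
  exact ⟨fun h => le_antisymm h (chartAt ClosedHalfPlane x x).2, fun h => h.le⟩

/-- `κ` is a holomorphic coordinate at `p`: the preferred chart at `p` is a biholomorphic function
of `κ`. -/
def IsCoordinateAt (κ : N → ℂ) (p : N) : Prop :=
  ∃ φ : ℂ → ℂ, ContDiffAt ℂ ω φ (κ p) ∧ deriv φ (κ p) ≠ 0 ∧
    ∀ᶠ q in 𝓝 p, (chartAt ClosedHalfPlane p q : ℂ) = φ (κ q)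

end RestrictScalars

/-! ### The closed disc -/

/-- The closed unit disc. -/
abbrev UnitDisc : Type := Metric.closedBall (0 : ℂ) 1

namespace UnitDisc

theorem norm_le (z : UnitDisc) : ‖(z : ℂ)‖ ≤ 1 := mem_closedBall_zero_iff.1 z.2

/-- The Cayley transform which sends the unit disc to the upper half-plane and `u` to infinity. -/
def cayley (u z : ℂ) : ℂ := Complex.I * (u + z) / (u - z)

/-- The inverse of the Cayley transform. -/
def cayleyInv (u w : ℂ) : ℂ := u * (w - Complex.I) / (w + Complex.I)

/-- The imaginary part has the sign of 1 - |z|², so the disc corresponds to the half-plane and the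
unit circle to its boundary. -/
theorem cayley_im {u z : ℂ} (hu : ‖u‖ = 1) :
    (cayley u z).im = (1 - ‖z‖ ^ 2) / ‖u - z‖ ^ 2 := by
  have hu2 : u.re * u.re + u.im * u.im = 1 := by
    rw [← Complex.normSq_apply, Complex.normSq_eq_norm_sq, hu, one_pow]
  rw [← Complex.normSq_eq_norm_sq, ← Complex.normSq_eq_norm_sq, cayley, Complex.div_im,
    Complex.normSq_apply z]
  simp only [Complex.mul_re, Complex.mul_im, Complex.I_re, Complex.I_im, Complex.add_re,
    Complex.add_im, Complex.sub_re, Complex.sub_im]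
  rw [← sub_div]
  congr 1
  linear_combination hu2

theorem add_I_ne_zero {w : ℂ} (hw : 0 ≤ w.im) : w + Complex.I ≠ 0 := fun h => by
  have := congrArg Complex.im h
  simp at this
  linarith

theorem cayleyInv_cayley {u z : ℂ} (hu : u ≠ 0) (h : z ≠ u) : cayleyInv u (cayley u z) = z := by
  have h1 : u - z ≠ 0 := sub_ne_zero.2 h.symm
  unfold cayleyInv cayley
  have h2 : Complex.I * (u + z) / (u - z) + Complex.I = 2 * Complex.I * u / (u - z) := by
    field_simp
    ring
  have h3 : Complex.I * (u + z) / (u - z) - Complex.I = 2 * Complex.I * z / (u - z) := by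
    field_simp
    ring
  rw [h2, h3]
  have := Complex.I_ne_zero
  field_simp

theorem cayleyInv_ne {u w : ℂ} (hu : u ≠ 0) (hw : 0 ≤ w.im) : cayleyInv u w ≠ u := fun h => by
  have h1 := add_I_ne_zero hw
  unfold cayleyInv at h
  rw [div_eq_iff h1] at h
  have h2 := mul_left_cancel₀ hu h
  have h3 := congrArg Complex.im h2
  simp at h3
  linarith

theorem cayley_cayleyInv {u w : ℂ} (hu : u ≠ 0) (hw : 0 ≤ w.im) :
    cayley u (cayleyInv u w) = w := by
  have h1 := add_I_ne_zero hw
  unfold cayleyInv cayley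
  have h2 : u + u * (w - Complex.I) / (w + Complex.I) = 2 * u * w / (w + Complex.I) := by
    field_simp
    ring
  have h3 : u - u * (w - Complex.I) / (w + Complex.I) = 2 * u * Complex.I / (w + Complex.I) := by
    field_simp
    ring
  rw [h2, h3]
  have := Complex.I_ne_zero
  field_simp

theorem norm_cayleyInv_le {u w : ℂ} (hu : ‖u‖ = 1) (hw : 0 ≤ w.im) : ‖cayleyInv u w‖ ≤ 1 := by
  have hu0 : u ≠ 0 := fun h => by simp [h] at hu
  have h := cayley_im (z := cayleyInv u w) hu
  rw [cayley_cayleyInv hu0 hw] at h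
  have h1 : 0 < ‖u - cayleyInv u w‖ := norm_pos_iff.2 (sub_ne_zero.2 (cayleyInv_ne hu0 hw).symm)
  rw [eq_div_iff (by positivity)] at h
  have h2 : 0 ≤ w.im * ‖u - cayleyInv u w‖ ^ 2 := by positivity
  have h3 : ‖cayleyInv u w‖ ^ 2 ≤ 1 := by linarith
  exact (sq_le_one_iff₀ (norm_nonneg _)).1 h3

theorem contDiffAt_cayley {u z : ℂ} (h : z ≠ u) : ContDiffAt ℂ ω (cayley u) z :=
  (contDiffAt_const.mul (contDiffAt_const.add contDiffAt_id)).div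
    (contDiffAt_const.sub contDiffAt_id) (sub_ne_zero.2 h.symm)

theorem contDiffAt_cayleyInv {u w : ℂ} (h : w + Complex.I ≠ 0) : ContDiffAt ℂ ω (cayleyInv u) w :=
  (contDiffAt_const.mul (contDiffAt_id.sub contDiffAt_const)).div
    (contDiffAt_id.add contDiffAt_const) h

theorem deriv_cayley_ne_zero {u z : ℂ} (hu : u ≠ 0) (h : z ≠ u) : deriv (cayley u) z ≠ 0 := by
  have h1 : u - z ≠ 0 := sub_ne_zero.2 h.symm
  have hd : HasDerivAt (cayley u)
      ((Complex.I * 1 * (u - z) - Complex.I * (u + z) * (-1)) / (u - z) ^ 2) z :=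
    (((hasDerivAt_id z).const_add u).const_mul Complex.I).div ((hasDerivAt_id z).const_sub u) h1
  rw [hd.deriv]
  have h2 : Complex.I * 1 * (u - z) - Complex.I * (u + z) * (-1) = 2 * Complex.I * u := by ring
  rw [h2]
  exact div_ne_zero (mul_ne_zero (mul_ne_zero two_ne_zero Complex.I_ne_zero) hu) (pow_ne_zero 2 h1)

/-- The chart of the closed disc given by the Cayley transform. -/
def cayleyChart (u : ℂ) (hu : ‖u‖ = 1) : OpenPartialHomeomorph UnitDisc ClosedHalfPlane :=
  have hu0 : u ≠ 0 := fun h => by simp [h] at hu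
  { toFun := fun z => ⟨cayley u z, by
      rw [cayley_im hu]
      have := sq_le_one_iff₀ (norm_nonneg (z : ℂ)) |>.2 z.norm_le
      exact div_nonneg (by linarith) (by positivity)⟩
    invFun := fun w => ⟨cayleyInv u w, mem_closedBall_zero_iff.2 (norm_cayleyInv_le hu w.2)⟩
    source := {z | (z : ℂ) ≠ u}
    target := univ
    map_source' := fun _ _ => mem_univ _
    map_target' := fun w _ => cayleyInv_ne hu0 w.2
    left_inv' := fun _ hz => Subtype.ext (cayleyInv_cayley hu0 hz)
    right_inv' := fun w _ => Subtype.ext (cayley_cayleyInv hu0 w.2)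
    open_source := isOpen_ne_fun continuous_subtype_val continuous_const
    open_target := isOpen_univ
    continuousOn_toFun := by
      refine IsInducing.subtypeVal.continuousOn_iff.2 fun z hz => ?_
      exact ((contDiffAt_cayley hz).continuousAt.comp
        continuous_subtype_val.continuousAt).continuousWithinAt
    continuousOn_invFun := by
      refine IsInducing.subtypeVal.continuousOn_iff.2 fun w _ => ?_
      exact ((contDiffAt_cayleyInv (add_I_ne_zero w.2)).continuousAt.comp
        continuous_subtype_val.continuousAt).continuousWithinAt }

open Classical in
/-- The point of the circle that the preferred chart at `z` sends to infinity. -/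
def pole (z : UnitDisc) : ℂ := if 0 ≤ (z : ℂ).re then -1 else 1

theorem norm_pole (z : UnitDisc) : ‖pole z‖ = 1 := by
  unfold pole
  split_ifs <;> simp

theorem pole_ne_zero (z : UnitDisc) : pole z ≠ 0 := fun h => by
  have := norm_pole z
  simp [h] at this

/-- The pole is chosen on the other side: its real part is negative if that of z is not, and
positive if that of z is negative. -/
theorem ne_pole (z : UnitDisc) : (z : ℂ) ≠ pole z := by
  unfold pole
  split_ifs with h
  · intro h0
    rw [h0] at h
    norm_num at h
  · intro h0
    rw [h0] at h
    norm_num at h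

instance : ChartedSpace ClosedHalfPlane UnitDisc where
  atlas := {e | ∃ u hu, e = cayleyChart u hu}
  chartAt z := cayleyChart (pole z) (norm_pole z)
  mem_chart_source z := ne_pole z
  chart_mem_atlas _ := ⟨_, _, rfl⟩

theorem coe_extChartAt_symm (z : UnitDisc) {y : ℂ} (hy : 0 ≤ y.im) :
    ((extChartAt realModel z).symm y : ℂ) = cayleyInv (pole z) y := by
  change cayleyInv (pole z) (realModel.symm y : ℂ) = _
  rw [coe_realModel_symm hy]

instance : IsManifold complexModel ω UnitDisc := by
  apply isManifold_of_contDiffOn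
  rintro _ _ ⟨u, hu, rfl⟩ ⟨v, hv, rfl⟩
  have key : ContDiffOn ℂ ω (cayley v ∘ cayleyInv u)
      {y : ℂ | 0 ≤ y.im ∧ cayleyInv u y ≠ v} := fun y hy =>
    ((contDiffAt_cayley hy.2).comp y
      (contDiffAt_cayleyInv (add_I_ne_zero hy.1))).contDiffWithinAt
  have hsub : complexModel.symm ⁻¹' ((cayleyChart u hu).symm.trans (cayleyChart v hv)).source ∩
      range complexModel ⊆ {y : ℂ | 0 ≤ y.im ∧ cayleyInv u y ≠ v} := by
    rintro y ⟨⟨-, hy⟩, hy'⟩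
    rw [range_complexModel] at hy'
    refine ⟨hy', ?_⟩
    have h1 : cayleyInv u (complexModel.symm y : ℂ) ≠ v := hy
    rwa [coe_complexModel_symm hy'] at h1
  refine (key.mono hsub).congr fun y hy => ?_
  have hy' := (hsub hy).1
  change cayley v (cayleyInv u (complexModel.symm y : ℂ)) = _
  rw [coe_complexModel_symm hy']
  rfl

theorem contMDiff_coe : ContMDiff complexModel 𝓘(ℂ) ω ((↑) : UnitDisc → ℂ) := by
  intro z
  refine contMDiffAt_iff.2 ⟨continuous_subtype_val.continuousAt, ?_⟩
  have hz : 0 ≤ (cayley (pole z) z).im := (chartAt ClosedHalfPlane z z).2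
  have h : ContDiffWithinAt ℂ ω (cayleyInv (pole z)) (range complexModel) (cayley (pole z) z) :=
    (contDiffAt_cayleyInv (add_I_ne_zero hz)).contDiffWithinAt
  refine h.congr_of_mem (fun y hy => ?_) (by rw [range_complexModel]; exact hz)
  rw [range_complexModel] at hy
  change cayleyInv (pole z) (complexModel.symm y : ℂ) = _
  rw [coe_complexModel_symm hy]

/-- Smooth maps to the closed disc are those which are smooth as maps to the plane. -/
theorem contMDiffWithinAt_complex {E H N : Type*} [NormedAddCommGroup E] [NormedSpace ℂ E]
    [TopologicalSpace H] {I : ModelWithCorners ℂ E H} [TopologicalSpace N] [ChartedSpace H N]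
    {n : ℕ∞ω} {g : N → UnitDisc} {s : Set N} {x : N}
    (h : ContMDiffWithinAt I 𝓘(ℂ) n (fun y => (g y : ℂ)) s x) :
    ContMDiffWithinAt I complexModel n g s x := by
  rw [contMDiffWithinAt_iff_target]
  refine ⟨IsInducing.subtypeVal.continuousWithinAt_iff.2 h.continuousWithinAt, ?_⟩
  have h1 : ContDiffAt ℂ n (cayley (pole (g x))) (g x) :=
    (contDiffAt_cayley (ne_pole (g x))).of_le le_top
  exact ContMDiffAt.comp_contMDiffWithinAt (f := fun y => (g y : ℂ)) x h1.contMDiffAt h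

theorem contMDiffWithinAt_real {E H N : Type*} [NormedAddCommGroup E] [NormedSpace ℝ E]
    [TopologicalSpace H] {I : ModelWithCorners ℝ E H} [TopologicalSpace N] [ChartedSpace H N]
    {n : ℕ∞ω} {g : N → UnitDisc} {s : Set N} {x : N}
    (h : ContMDiffWithinAt I 𝓘(ℝ, ℂ) n (fun y => (g y : ℂ)) s x) :
    ContMDiffWithinAt I realModel n g s x := by
  rw [contMDiffWithinAt_iff_target]
  refine ⟨IsInducing.subtypeVal.continuousWithinAt_iff.2 h.continuousWithinAt, ?_⟩
  have h1 : ContDiffAt ℝ n (cayley (pole (g x))) (g x) :=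
    ((contDiffAt_cayley (ne_pole (g x))).of_le le_top).restrict_scalars ℝ
  exact ContMDiffAt.comp_contMDiffWithinAt (f := fun y => (g y : ℂ)) x h1.contMDiffAt h

theorem isCoordinateAt (z : UnitDisc) : IsCoordinateAt ((↑) : UnitDisc → ℂ) z :=
  ⟨cayley (pole z), contDiffAt_cayley (ne_pole z), deriv_cayley_ne_zero (pole_ne_zero z) (ne_pole z),
    Eventually.of_forall fun _ => rfl⟩

theorem chartAt_im_eq (z : UnitDisc) : (chartAt ClosedHalfPlane z z : ℂ).im =
    (1 - ‖(z : ℂ)‖ ^ 2) / ‖pole z - z‖ ^ 2 := cayley_im (norm_pole z)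

theorem chartAt_im_eq_zero_iff (z : UnitDisc) :
    (chartAt ClosedHalfPlane z z : ℂ).im = 0 ↔ ‖(z : ℂ)‖ = 1 := by
  have h : ‖pole z - z‖ ^ 2 ≠ 0 := pow_ne_zero _ (norm_ne_zero_iff.2 (sub_ne_zero.2 (ne_pole z).symm))
  rw [chartAt_im_eq, div_eq_zero_iff, or_iff_left h, sub_eq_zero, eq_comm,
    pow_eq_one_iff_of_nonneg (norm_nonneg _) two_ne_zero]

theorem mem_boundary_complexModel {z : UnitDisc} :
    z ∈ complexModel.boundary UnitDisc ↔ ‖(z : ℂ)‖ = 1 := by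
  rw [mem_boundary_complexModel_iff, chartAt_im_eq_zero_iff]

theorem mem_boundary_realModel {z : UnitDisc} :
    z ∈ realModel.boundary UnitDisc ↔ ‖(z : ℂ)‖ = 1 := by
  rw [mem_boundary_realModel_iff, chartAt_im_eq_zero_iff]

theorem mem_interior_realModel {z : UnitDisc} (hz : ‖(z : ℂ)‖ < 1) :
    z ∈ realModel.interior UnitDisc := by
  have := (compl_compl (realModel.interior UnitDisc)).symm
  rw [this, realModel.compl_interior, mem_compl_iff, mem_boundary_realModel]
  exact hz.ne

instance : CompactSpace UnitDisc := isCompact_iff_compactSpace.1 (isCompact_closedBall _ _)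

instance : ConnectedSpace UnitDisc := isConnected_iff_connectedSpace.1
  ⟨⟨0, by simp⟩, (convex_closedBall _ _).isPreconnected⟩

/-- The closed disc as a compact bordered surface. -/
abbrev surface : BorderedSurface where
  carrier := UnitDisc

end UnitDisc

/-! ### The plane -/

/-- The complex plane as a Riemann surface over the half-plane. -/
def AffineLine : Type := ℂ

namespace AffineLine

instance : TopologicalSpace AffineLine := inferInstanceAs (TopologicalSpace ℂ)

/-- The coordinate of the affine line. -/
def coe : AffineLine → ℂ := id

/-- The point with a given coordinate. -/
def of : ℂ → AffineLine := id

theorem continuous_coe : Continuous coe := continuous_id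

theorem continuous_of : Continuous of := continuous_id

theorem coe_of (z : ℂ) : coe (of z) = z := rfl

/-- The translation to the upper half-plane of the half-plane above height `c`. -/
def shiftChart (c : ℝ) : OpenPartialHomeomorph AffineLine ClosedHalfPlane where
  -- The maximum only supplies a default value off the source, so that the value is always in the
  -- closed half-plane.
  toFun z := ⟨⟨(coe z).re, max ((coe z).im - c) 0⟩, le_max_right _ _⟩
  invFun w := of ((w : ℂ) + c * Complex.I)
  source := {z | c < (coe z).im}
  target := {w | 0 < (w : ℂ).im}
  map_source' z hz := by
    change 0 < max ((coe z).im - c) 0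
    exact lt_max_of_lt_left (sub_pos.2 hz)
  map_target' w hw := by
    change c < ((w : ℂ) + c * Complex.I).im
    simpa using hw
  left_inv' z hz := by
    have hz' : c < (coe z).im := hz
    refine Complex.ext ?_ ?_
    · simp [of, coe]
    · change max ((coe z).im - c) 0 + ((c : ℂ) * Complex.I).im = _
      rw [max_eq_left (by linarith)]
      simp [coe]
  right_inv' w hw := by
    have hw' : 0 < (w : ℂ).im := hw
    refine Subtype.ext (Complex.ext ?_ ?_)
    · change ((w : ℂ) + c * Complex.I).re = _
      simp
    · change max (((w : ℂ) + c * Complex.I).im - c) 0 = _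
      simp [hw'.le]
  open_source := isOpen_lt continuous_const (Complex.continuous_im.comp continuous_coe)
  open_target := isOpen_lt continuous_const (Complex.continuous_im.comp continuous_subtype_val)
  continuousOn_toFun := by
    refine Continuous.continuousOn (Continuous.subtype_mk ?_ _)
    refine Complex.equivRealProdCLM.symm.continuous.comp (Continuous.prodMk ?_ ?_)
    · exact Complex.continuous_re.comp continuous_coe
    · exact ((Complex.continuous_im.comp continuous_coe).sub continuous_const).max continuous_const
  continuousOn_invFun :=
    (continuous_of.comp (continuous_subtype_val.add continuous_const)).continuousOn

theorem coe_shiftChart {c : ℝ} {z : AffineLine} (hz : c < (coe z).im) :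
    (shiftChart c z : ℂ) = coe z - c * Complex.I := by
  refine Complex.ext ?_ ?_
  · simp [shiftChart]
  · change max ((coe z).im - c) 0 = _
    rw [max_eq_left (by linarith)]
    simp

theorem shiftChart_symm_apply (c : ℝ) (w : ClosedHalfPlane) :
    (shiftChart c).symm w = of ((w : ℂ) + c * Complex.I) := rfl

instance : ChartedSpace ClosedHalfPlane AffineLine where
  atlas := range shiftChart
  -- This chart puts z at height 1, so every point is an interior point.
  chartAt z := shiftChart ((coe z).im - 1)
  mem_chart_source z := sub_one_lt (coe z).im
  chart_mem_atlas _ := mem_range_self _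

instance : IsManifold complexModel ω AffineLine := by
  apply isManifold_of_contDiffOn
  rintro _ _ ⟨c, rfl⟩ ⟨d, rfl⟩
  have key : ContDiff ℂ ω fun y : ℂ => y + c * Complex.I - d * Complex.I :=
    (contDiff_id.add contDiff_const).sub contDiff_const
  refine key.contDiffOn.congr ?_
  rintro y ⟨⟨-, hy⟩, hy'⟩
  rw [range_complexModel] at hy'
  change (shiftChart d ((shiftChart c).symm (complexModel.symm y)) : ℂ) = _
  rw [coe_shiftChart (z := (shiftChart c).symm (complexModel.symm y)) hy, shiftChart_symm_apply, coe_of, coe_complexModel_symm hy']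

theorem contMDiff_coe : ContMDiff complexModel 𝓘(ℂ) ω coe := by
  intro z
  refine contMDiffAt_iff.2 ⟨continuous_coe.continuousAt, ?_⟩
  have h : ContDiff ℂ ω fun y : ℂ => y + (((coe z).im - 1 : ℝ) : ℂ) * Complex.I :=
    contDiff_id.add contDiff_const
  refine h.contDiffAt.contDiffWithinAt.congr_of_mem (fun y hy => ?_) (mem_range_self _)
  rw [range_complexModel] at hy
  change coe ((shiftChart ((coe z).im - 1)).symm (complexModel.symm y)) = _
  rw [shiftChart_symm_apply, coe_of, coe_complexModel_symm hy]

theorem chartAt_eventuallyEq (z : AffineLine) : ∀ᶠ w in 𝓝 z,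
    (chartAt ClosedHalfPlane z w : ℂ) = coe w - ((coe z).im - 1 : ℝ) * Complex.I := by
  filter_upwards [(chartAt ClosedHalfPlane z).open_source.mem_nhds (mem_chart_source _ z)] with w hw
  exact coe_shiftChart hw

theorem isCoordinateAt (z : AffineLine) : IsCoordinateAt coe z := by
  refine ⟨fun y => y - ((coe z).im - 1 : ℝ) * Complex.I, contDiffAt_id.sub contDiffAt_const, ?_,
    chartAt_eventuallyEq z⟩
  rw [((hasDerivAt_id' (coe z)).sub_const _).deriv]
  exact one_ne_zero

theorem chartAt_im_pos (z : AffineLine) : 0 < (chartAt ClosedHalfPlane z z : ℂ).im :=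
  lt_max_of_lt_left (b := (coe z).im - ((coe z).im - 1)) (by linarith)

theorem contMDiffWithinAt_complex {E H N : Type*} [NormedAddCommGroup E] [NormedSpace ℂ E]
    [TopologicalSpace H] {I : ModelWithCorners ℂ E H} [TopologicalSpace N] [ChartedSpace H N]
    {n : ℕ∞ω} {g : N → AffineLine} {s : Set N} {x : N} (hx : x ∈ s)
    (h : ContMDiffWithinAt I 𝓘(ℂ) n (fun y => coe (g y)) s x) :
    ContMDiffWithinAt I complexModel n g s x := by
  rw [contMDiffWithinAt_iff_target]
  have hc : ContinuousWithinAt g s x := h.continuousWithinAt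
  refine ⟨hc, ?_⟩
  have h1 : ContDiff ℂ n fun y => y - ((coe (g x)).im - 1 : ℝ) * Complex.I :=
    contDiff_id.sub contDiff_const
  refine (ContMDiffAt.comp_contMDiffWithinAt (f := fun y => coe (g y)) x
    h1.contDiffAt.contMDiffAt h).congr_of_eventuallyEq_of_mem
    (hc.eventually (chartAt_eventuallyEq (g x))) hx

theorem contMDiffWithinAt_real {E H N : Type*} [NormedAddCommGroup E] [NormedSpace ℝ E]
    [TopologicalSpace H] {I : ModelWithCorners ℝ E H} [TopologicalSpace N] [ChartedSpace H N]
    {n : ℕ∞ω} {g : N → AffineLine} {s : Set N} {x : N} (hx : x ∈ s)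
    (h : ContMDiffWithinAt I 𝓘(ℝ, ℂ) n (fun y => coe (g y)) s x) :
    ContMDiffWithinAt I realModel n g s x := by
  rw [contMDiffWithinAt_iff_target]
  have hc : ContinuousWithinAt g s x := h.continuousWithinAt
  refine ⟨hc, ?_⟩
  have h1 : ContDiff ℝ n fun y : ℂ => y - ((coe (g x)).im - 1 : ℝ) * Complex.I :=
    contDiff_id.sub contDiff_const
  refine (ContMDiffAt.comp_contMDiffWithinAt (f := fun y => coe (g y)) x
    h1.contDiffAt.contMDiffAt h).congr_of_eventuallyEq_of_mem
    (hc.eventually (chartAt_eventuallyEq (g x))) hx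

end AffineLine

/-! ### Radial diffeomorphisms of the plane -/

section Radial

theorem hasFDerivAt_radial {q : ℝ → ℝ} {q' : ℝ} {s : ℂ} (hq : HasDerivAt q q' (‖s‖ ^ 2)) :
    ∃ L : ℂ →L[ℝ] ℂ, HasFDerivAt (fun s : ℂ => q (‖s‖ ^ 2) • s) L s ∧
      ∀ v, L v = q (‖s‖ ^ 2) • v + (q' * (2 * inner ℝ s v)) • s := by
  have h1 : HasFDerivAt (fun s : ℂ => ‖s‖ ^ 2) (2 • innerSL ℝ s) s := hasStrictFDerivAt_norm_sq s |>.hasFDerivAt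
  have h2 := hq.comp_hasFDerivAt s h1
  refine ⟨_, h2.smul (hasFDerivAt_id s), fun v => ?_⟩
  simp [mul_comm]
  left
  left
  ring

/-- Pairing the equation with v gives a |v|² + 2 b ⟨s, v⟩² = 0, a sum of two non-negative terms. -/
theorem injective_radial_fderiv {a b : ℝ} (ha : 0 < a) (hb : 0 ≤ b) {s v : ℂ}
    (h : a • v + (b * (2 * inner ℝ s v)) • s = 0) : v = 0 := by
  have h1 : inner ℝ (a • v + (b * (2 * inner ℝ s v)) • s) v = 0 := by rw [h, inner_zero_left]
  rw [inner_add_left, real_inner_smul_left, real_inner_smul_left, real_inner_self_eq_norm_sq] at h1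
  have h2 : 0 ≤ b * (2 * inner ℝ s v) * inner ℝ s v := by
    have : b * (2 * inner ℝ s v) * inner ℝ s v = 2 * b * (inner ℝ s v) ^ 2 := by ring
    rw [this]
    positivity
  have h3 : a * ‖v‖ ^ 2 ≤ 0 := by linarith
  have h4 : ‖v‖ ^ 2 ≤ 0 := by
    by_contra! h5
    linarith [mul_pos ha h5]
  have h6 : ‖v‖ = 0 := by
    have := le_antisymm h4 (by positivity)
    exact pow_eq_zero_iff two_ne_zero |>.1 this
  exact norm_eq_zero.1 h6

/-- A positive increasing radial scaling is injective. -/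
theorem injOn_radial {q : ℝ → ℝ} {I : Set ℝ} (hpos : ∀ x ∈ I, 0 < q x) (hmono : MonotoneOn q I) :
    InjOn (fun s : ℂ => q (‖s‖ ^ 2) • s) {s | ‖s‖ ^ 2 ∈ I} := by
  -- The modulus of the image increases strictly with |s|. Equal images therefore have equal |s|,
  -- hence the same factor.
  have key : ∀ s s' : ℂ, ‖s‖ ^ 2 ∈ I → ‖s'‖ ^ 2 ∈ I → ‖s‖ < ‖s'‖ →
      q (‖s‖ ^ 2) * ‖s‖ < q (‖s'‖ ^ 2) * ‖s'‖ := fun s s' hs hs' h => by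
    have h1 : q (‖s‖ ^ 2) ≤ q (‖s'‖ ^ 2) := hmono hs hs' (by gcongr)
    calc q (‖s‖ ^ 2) * ‖s‖ ≤ q (‖s'‖ ^ 2) * ‖s‖ := by gcongr
      _ < q (‖s'‖ ^ 2) * ‖s'‖ := by
        have := hpos _ hs'
        gcongr
  intro s hs s' hs' h
  have hn : q (‖s‖ ^ 2) * ‖s‖ = q (‖s'‖ ^ 2) * ‖s'‖ := by
    have := congrArg norm h
    simpa [norm_smul, abs_of_pos (hpos _ hs), abs_of_pos (hpos _ hs')] using this
  have hr : ‖s‖ = ‖s'‖ := by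
    rcases lt_trichotomy ‖s‖ ‖s'‖ with h1 | h1 | h1
    · exact absurd hn (key s s' hs hs' h1).ne
    · exact h1
    · exact absurd hn (key s' s hs' hs h1).ne'
  simp only [hr] at h
  exact smul_right_injective ℂ (hpos _ hs').ne' h

/-- The differential of a positive increasing radial scaling is invertible. -/
theorem isInvertible_fderiv_smul_radial {q : ℝ → ℝ} {I : Set ℝ} (hI : IsOpen I)
    (hpos : ∀ x ∈ I, 0 < q x) (hmono : MonotoneOn q I) (hq : ContDiffOn ℝ ∞ q I) {s : ℂ}
    (hs : ‖s‖ ^ 2 ∈ I) :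
    (fderiv ℝ (fun s : ℂ => q (‖s‖ ^ 2) • s) s).IsInvertible := by
  have hqs : ContDiffAt ℝ ∞ q (‖s‖ ^ 2) := hq.contDiffAt (hI.mem_nhds hs)
  have hd : HasDerivAt q (deriv q (‖s‖ ^ 2)) (‖s‖ ^ 2) :=
    (hqs.differentiableAt (by simp)).hasDerivAt
  have hd0 : 0 ≤ deriv q (‖s‖ ^ 2) := by
    rw [← derivWithin_of_isOpen hI hs]
    exact hmono.derivWithin_nonneg
  obtain ⟨L, hL, hLv⟩ := hasFDerivAt_radial hd
  -- For an endomorphism of the plane injectivity suffices; it holds because q > 0 and, by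
  -- monotonicity, q' ≥ 0.
  have hinj : Function.Injective L := by
    rw [injective_iff_map_eq_zero]
    intro v hv
    rw [hLv] at hv
    exact injective_radial_fderiv (hpos _ hs) hd0 hv
  rw [hL.fderiv]
  exact ⟨(LinearEquiv.ofInjectiveEndo L.toLinearMap hinj).toContinuousLinearEquiv,
    ContinuousLinearMap.ext fun _ => rfl⟩

/-- The inverse of a positive increasing radial scaling is smooth. -/
theorem contDiffAt_invFunOn_radial {q : ℝ → ℝ} {I : Set ℝ} (hI : IsOpen I)
    (hpos : ∀ x ∈ I, 0 < q x) (hmono : MonotoneOn q I) (hq : ContDiffOn ℝ ∞ q I) {s : ℂ}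
    (hs : ‖s‖ ^ 2 ∈ I) :
    ContDiffAt ℝ ∞ (Function.invFunOn (fun s : ℂ => q (‖s‖ ^ 2) • s) {s | ‖s‖ ^ 2 ∈ I})
      (q (‖s‖ ^ 2) • s) := by
  set f : ℂ → ℂ := fun s => q (‖s‖ ^ 2) • s
  set U : Set ℂ := {s | ‖s‖ ^ 2 ∈ I}
  have hU : IsOpen U := hI.preimage (continuous_norm.pow 2)
  have hqs : ContDiffAt ℝ ∞ q (‖s‖ ^ 2) := hq.contDiffAt (hI.mem_nhds hs)
  have hf : ContDiffAt ℝ ∞ f s := by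
    have h1 : ContDiffAt ℝ ∞ (fun s : ℂ => ‖s‖ ^ 2) s := (contDiff_norm_sq ℝ).contDiffAt
    exact (hqs.comp s h1).smul contDiffAt_id
  obtain ⟨L', hL'⟩ := isInvertible_fderiv_smul_radial hI hpos hmono hq hs
  have hL' : HasFDerivAt f (L' : ℂ →L[ℝ] ℂ) s := by
    rw [hL']
    exact (hf.differentiableAt (by simp)).hasFDerivAt
  have hinv := hf.to_localInverse hL' (by simp)
  refine hinv.congr_of_eventuallyEq ?_
  have hstrict : HasStrictFDerivAt f (L' : ℂ →L[ℝ] ℂ) s := hf.hasStrictFDerivAt' hL' (by simp)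
  -- The smooth local inverse stays in U near `f s`, and f is injective on U, so it agrees there
  -- with `Function.invFunOn`.
  have h1 : ∀ᶠ y in 𝓝 (f s), f (hstrict.localInverse f L' s y) = y :=
    hstrict.eventually_right_inverse
  have h2 : ∀ᶠ y in 𝓝 (f s), hstrict.localInverse f L' s y ∈ U := by
    have := hinv.continuousAt
    refine this.eventually (hU.mem_nhds ?_)
    have h3 : hstrict.localInverse f L' s (f s) = s := hstrict.localInverse_apply_image
    change hstrict.localInverse f L' s (f s) ∈ U
    rw [h3]
    exact hs
  filter_upwards [h1, h2] with y hy hyU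
  have h4 : Function.invFunOn f U (f (hstrict.localInverse f L' s y)) =
      hstrict.localInverse f L' s y :=
    (injOn_radial hpos hmono).leftInvOn_invFunOn hyU
  rw [hy] at h4
  exact h4

end Radial

/-! ### The scaling functions -/

namespace Neck

/-- The cutoff which vanishes for `x ≤ 1 / 4` and is `1` for `3 / 8 ≤ x`. -/
def outer (x : ℝ) : ℝ := Real.smoothTransition (8 * (x - 1 / 4))

/-- The cutoff which vanishes for `1 / 4 ≤ x` and is `1` for `x ≤ 1 / 8`. -/
def inner (x : ℝ) : ℝ := Real.smoothTransition (8 * (1 / 4 - x))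

theorem outer_of_le {x : ℝ} (h : x ≤ 1 / 4) : outer x = 0 :=
  Real.smoothTransition.zero_of_nonpos (by linarith)

theorem inner_of_le {x : ℝ} (h : 1 / 4 ≤ x) : inner x = 0 :=
  Real.smoothTransition.zero_of_nonpos (by linarith)

theorem outer_eq_one {x : ℝ} (h : 3 / 8 ≤ x) : outer x = 1 :=
  Real.smoothTransition.one_of_one_le (by linarith)

theorem inner_zero : inner 0 = 1 := Real.smoothTransition.one_of_one_le (by norm_num)

theorem outer_pos {x : ℝ} (h : 1 / 4 < x) : 0 < outer x :=
  Real.smoothTransition.pos_of_pos (by linarith)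

theorem inner_pos {x : ℝ} (h : x < 1 / 4) : 0 < inner x :=
  Real.smoothTransition.pos_of_pos (by linarith)

theorem outer_nonneg (x : ℝ) : 0 ≤ outer x := Real.smoothTransition.nonneg _

theorem inner_nonneg (x : ℝ) : 0 ≤ inner x := Real.smoothTransition.nonneg _

theorem outer_le_one (x : ℝ) : outer x ≤ 1 := Real.smoothTransition.le_one _

theorem inner_le_one (x : ℝ) : inner x ≤ 1 := Real.smoothTransition.le_one _

theorem monotone_outer : Monotone outer := fun _ _ h =>
  Real.smoothTransition.monotone (by linarith)

theorem antitone_inner : Antitone inner := fun _ _ h =>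
  Real.smoothTransition.monotone (by linarith)

theorem contDiff_outer : ContDiff ℝ ∞ outer :=
  Real.smoothTransition.contDiff.comp (contDiff_const.mul (contDiff_id.sub contDiff_const))

theorem contDiff_inner : ContDiff ℝ ∞ inner :=
  Real.smoothTransition.contDiff.comp (contDiff_const.mul (contDiff_const.sub contDiff_id))

/-- The outer cutoff, raised to lie above `τ`. -/
def outerRaised (τ x : ℝ) : ℝ := outer x + τ * (1 - outer x)

/-- The inner cutoff, raised to lie above `τ`. -/
def innerRaised (τ x : ℝ) : ℝ := inner x + τ * (1 - inner x)

theorem contDiff_outerRaised : ContDiff ℝ ∞ fun p : ℝ × ℝ => outerRaised p.1 p.2 :=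
  (contDiff_outer.comp contDiff_snd).add
    (contDiff_fst.mul (contDiff_const.sub (contDiff_outer.comp contDiff_snd)))

theorem contDiff_innerRaised : ContDiff ℝ ∞ fun p : ℝ × ℝ => innerRaised p.1 p.2 :=
  (contDiff_inner.comp contDiff_snd).add
    (contDiff_fst.mul (contDiff_const.sub (contDiff_inner.comp contDiff_snd)))

theorem outerRaised_of_le {τ x : ℝ} (h : x ≤ 1 / 4) : outerRaised τ x = τ := by
  simp [outerRaised, outer_of_le h]

theorem innerRaised_of_le {τ x : ℝ} (h : 1 / 4 ≤ x) : innerRaised τ x = τ := by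
  simp [innerRaised, inner_of_le h]

theorem le_outerRaised {τ : ℝ} (hτ : τ ≤ 1) (x : ℝ) : τ ≤ outerRaised τ x := by
  have : 0 ≤ (1 - τ) * outer x := mul_nonneg (by linarith) (outer_nonneg x)
  unfold outerRaised
  linarith

theorem le_innerRaised {τ : ℝ} (hτ : τ ≤ 1) (x : ℝ) : τ ≤ innerRaised τ x := by
  have : 0 ≤ (1 - τ) * inner x := mul_nonneg (by linarith) (inner_nonneg x)
  unfold innerRaised
  linarith

theorem outerRaised_pos {τ x : ℝ} (hτ : 0 ≤ τ) (hx : 1 / 4 < x) : 0 < outerRaised τ x :=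
  add_pos_of_pos_of_nonneg (outer_pos hx) (mul_nonneg hτ (sub_nonneg.2 (outer_le_one x)))

theorem innerRaised_pos {τ x : ℝ} (hτ : 0 ≤ τ) (hx : x < 1 / 4) : 0 < innerRaised τ x :=
  add_pos_of_pos_of_nonneg (inner_pos hx) (mul_nonneg hτ (sub_nonneg.2 (inner_le_one x)))

open Classical in
/-- The scaling factor of the map of the disc to itself with parameter `τ`. -/
def scale (τ x : ℝ) : ℝ := if 1 / 4 ≤ x then outerRaised τ x else τ ^ 2 / innerRaised τ x

open Classical in
/-- The complementary factor: the product of the two factors is `τ ^ 2`. -/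
def coscale (τ x : ℝ) : ℝ := if 1 / 4 ≤ x then τ ^ 2 / outerRaised τ x else innerRaised τ x

theorem scale_outer {τ x : ℝ} (h : 1 / 4 ≤ x) : scale τ x = outerRaised τ x := if_pos h

theorem coscale_outer {τ x : ℝ} (h : 1 / 4 ≤ x) : coscale τ x = τ ^ 2 / outerRaised τ x := if_pos h

theorem scale_inner {τ x : ℝ} (h : x < 1 / 4) : scale τ x = τ ^ 2 / innerRaised τ x :=
  if_neg (not_le.2 h)

theorem coscale_inner {τ x : ℝ} (h : x < 1 / 4) : coscale τ x = innerRaised τ x :=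
  if_neg (not_le.2 h)

/-- On either side of 1/4 one of the raised cutoffs is the constant τ, which merges the two clauses
of the definition into one formula. For τ > 0 it is smooth across x = 1/4. -/
theorem scale_eq {τ x : ℝ} (hτ : 0 < τ) :
    scale τ x = τ * outerRaised τ x / innerRaised τ x := by
  rcases le_or_gt (1 / 4) x with h | h
  · rw [scale_outer h, innerRaised_of_le h]
    field_simp
  · rw [scale_inner h, outerRaised_of_le h.le, sq]

theorem coscale_eq {τ x : ℝ} (hτ : 0 < τ) :
    coscale τ x = τ * innerRaised τ x / outerRaised τ x := by
  rcases le_or_gt (1 / 4) x with h | h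
  · rw [coscale_outer h, innerRaised_of_le h, sq]
  · rw [coscale_inner h, outerRaised_of_le h.le]
    field_simp

theorem scale_of_le {τ x : ℝ} (h : 3 / 8 ≤ x) : scale τ x = 1 := by
  rw [scale_outer (by linarith), outerRaised, outer_eq_one h]
  ring

theorem scale_zero_outer {x : ℝ} (h : 1 / 4 ≤ x) : scale 0 x = outer x := by
  rw [scale_outer h, outerRaised]
  ring

theorem scale_zero_inner {x : ℝ} (h : x ≤ 1 / 4) : scale 0 x = 0 := by
  rcases h.eq_or_lt with rfl | h
  · rw [scale_zero_outer le_rfl, outer_of_le le_rfl]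
  · rw [scale_inner h]
    simp

theorem coscale_zero_outer {x : ℝ} (h : 1 / 4 ≤ x) : coscale 0 x = 0 := by
  rw [coscale_outer h]
  simp

theorem coscale_zero_inner {x : ℝ} (h : x < 1 / 4) : coscale 0 x = inner x := by
  rw [coscale_inner h, innerRaised]
  ring

/-- The product is the coordinate η₁ of the image point, which thus lies on the curve η₁ = τ². -/
theorem scale_mul_coscale {τ x : ℝ} (h0 : 0 ≤ τ) (h1 : τ ≤ 1) :
    scale τ x * coscale τ x = τ ^ 2 := by
  rcases h0.eq_or_lt with rfl | h
  · rcases le_or_gt (1 / 4) x with h | h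
    · simp [coscale_zero_outer h]
    · simp [scale_zero_inner h.le]
  · have ha := h.trans_le (le_outerRaised h1 x)
    have hb := h.trans_le (le_innerRaised h1 x)
    rw [scale_eq h, coscale_eq h]
    field_simp

theorem scale_pos {τ x : ℝ} (h : 0 < τ) (h1 : τ ≤ 1) : 0 < scale τ x := by
  have ha := h.trans_le (le_outerRaised h1 x)
  have hb := h.trans_le (le_innerRaised h1 x)
  rw [scale_eq h]
  positivity

theorem scale_nonneg {τ x : ℝ} (h : 0 ≤ τ) (h1 : τ ≤ 1) : 0 ≤ scale τ x := by
  rcases le_or_gt (1 / 4) x with hx | hx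
  · rw [scale_outer hx]
    exact h.trans (le_outerRaised h1 x)
  · rw [scale_inner hx]
    exact div_nonneg (sq_nonneg _) (innerRaised_pos h hx).le

theorem coscale_nonneg {τ x : ℝ} (h : 0 ≤ τ) (h1 : τ ≤ 1) : 0 ≤ coscale τ x := by
  rcases le_or_gt (1 / 4) x with hx | hx
  · rw [coscale_outer hx]
    exact div_nonneg (sq_nonneg _) (h.trans (le_outerRaised h1 x))
  · rw [coscale_inner hx]
    exact (innerRaised_pos h hx).le

/-- Needed for continuity at the one singular pair (0, 1/4): there `scale` is squeezed between 0 and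
a continuous function with value 0. -/
theorem scale_le {τ x : ℝ} (h : 0 ≤ τ) (h1 : τ ≤ 1) : scale τ x ≤ outerRaised τ x := by
  rcases le_or_gt (1 / 4) x with hx | hx
  · rw [scale_outer hx]
  · rw [scale_inner hx, outerRaised_of_le hx.le, div_le_iff₀ (innerRaised_pos h hx), sq]
    exact mul_le_mul_of_nonneg_left (le_innerRaised h1 x) h

theorem coscale_le {τ x : ℝ} (h : 0 ≤ τ) (h1 : τ ≤ 1) : coscale τ x ≤ innerRaised τ x := by
  rcases le_or_gt (1 / 4) x with hx | hx
  · rw [coscale_outer hx, innerRaised_of_le hx]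
    refine div_le_of_le_mul₀ (h.trans (le_outerRaised h1 x)) h ?_
    rw [sq]
    exact mul_le_mul_of_nonneg_left (le_outerRaised h1 x) h
  · rw [coscale_inner hx]

/-- In the common formula the numerator increases and the denominator decreases. Monotonicity makes
the radial maps injective with invertible differential. -/
theorem monotone_scale {τ : ℝ} (h : 0 < τ) (h1 : τ ≤ 1) : Monotone (scale τ) := fun x y hxy => by
  have hx := h.trans_le (le_innerRaised h1 x)
  have hy := h.trans_le (le_innerRaised h1 y)
  have hy' := h.trans_le (le_outerRaised h1 y)
  rw [scale_eq h, scale_eq h]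
  have ha : outerRaised τ x ≤ outerRaised τ y := by
    have : (1 - τ) * outer x ≤ (1 - τ) * outer y :=
      mul_le_mul_of_nonneg_left (monotone_outer hxy) (by linarith)
    unfold outerRaised
    linarith
  have hb : innerRaised τ y ≤ innerRaised τ x := by
    have : (1 - τ) * inner y ≤ (1 - τ) * inner x :=
      mul_le_mul_of_nonneg_left (antitone_inner hxy) (by linarith)
    unfold innerRaised
    linarith
  gcongr

/-- An open set of pairs `(τ, x)` on which the factors are smooth; of the pairs with `0 ≤ τ ≤ 1` it
misses only `(0, 1 / 4)`. -/
def smoothLocus : Set (ℝ × ℝ) := {p | (1 / 4 < p.2 ∧ 0 < outerRaised p.1 p.2) ∨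
  (p.2 < 1 / 4 ∧ 0 < innerRaised p.1 p.2) ∨
  (0 < p.1 ∧ 0 < outerRaised p.1 p.2 ∧ 0 < innerRaised p.1 p.2)}

theorem isOpen_smoothLocus : IsOpen smoothLocus := by
  have ha := contDiff_outerRaised.continuous
  have hb := contDiff_innerRaised.continuous
  refine IsOpen.union ?_ (IsOpen.union ?_ ?_)
  · exact (isOpen_lt continuous_const continuous_snd).inter (isOpen_lt continuous_const ha)
  · exact (isOpen_lt continuous_snd continuous_const).inter (isOpen_lt continuous_const hb)
  · exact (isOpen_lt continuous_const continuous_fst).inter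
      ((isOpen_lt continuous_const ha).inter (isOpen_lt continuous_const hb))

theorem mem_smoothLocus {τ x : ℝ} (h0 : 0 ≤ τ) (h1 : τ ≤ 1) (h : τ ≠ 0 ∨ x ≠ 1 / 4) :
    (τ, x) ∈ smoothLocus := by
  rcases h0.eq_or_lt with rfl | hτ
  · rcases (h.resolve_left (by simp)).lt_or_gt with hx | hx
    · exact Or.inr (Or.inl ⟨hx, innerRaised_pos h0 hx⟩)
    · exact Or.inl ⟨hx, outerRaised_pos h0 hx⟩
  · exact Or.inr (Or.inr ⟨hτ, hτ.trans_le (le_outerRaised h1 x), hτ.trans_le (le_innerRaised h1 x)⟩)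

theorem contDiffAt_scale {p : ℝ × ℝ} (hp : p ∈ smoothLocus) :
    ContDiffAt ℝ ∞ (fun p : ℝ × ℝ => scale p.1 p.2) p := by
  have ha := contDiff_outerRaised.contDiffAt (x := p)
  have hb := contDiff_innerRaised.contDiffAt (x := p)
  rcases hp with ⟨hx, -⟩ | ⟨hx, h⟩ | ⟨hτ, -, h⟩
  · refine ha.congr_of_eventuallyEq ?_
    filter_upwards [(isOpen_lt continuous_const continuous_snd).mem_nhds hx] with p' hp'
    exact scale_outer (le_of_lt hp')
  · refine ((contDiffAt_fst.pow 2).div hb h.ne').congr_of_eventuallyEq ?_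
    filter_upwards [(isOpen_lt continuous_snd continuous_const).mem_nhds hx] with p' hp'
    exact scale_inner hp'
  · refine ((contDiffAt_fst.mul ha).div hb h.ne').congr_of_eventuallyEq ?_
    filter_upwards [(isOpen_lt continuous_const continuous_fst).mem_nhds hτ] with p' hp'
    exact scale_eq hp'

theorem contDiffAt_coscale {p : ℝ × ℝ} (hp : p ∈ smoothLocus) :
    ContDiffAt ℝ ∞ (fun p : ℝ × ℝ => coscale p.1 p.2) p := by
  have ha := contDiff_outerRaised.contDiffAt (x := p)
  have hb := contDiff_innerRaised.contDiffAt (x := p)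
  rcases hp with ⟨hx, h⟩ | ⟨hx, -⟩ | ⟨hτ, h, -⟩
  · refine ((contDiffAt_fst.pow 2).div ha h.ne').congr_of_eventuallyEq ?_
    filter_upwards [(isOpen_lt continuous_const continuous_snd).mem_nhds hx] with p' hp'
    exact coscale_outer (le_of_lt hp')
  · refine hb.congr_of_eventuallyEq ?_
    filter_upwards [(isOpen_lt continuous_snd continuous_const).mem_nhds hx] with p' hp'
    exact coscale_inner hp'
  · refine ((contDiffAt_fst.mul hb).div ha h.ne').congr_of_eventuallyEq ?_
    filter_upwards [(isOpen_lt continuous_const continuous_fst).mem_nhds hτ] with p' hp'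
    exact coscale_eq hp'

theorem continuousOn_scale : ContinuousOn (fun p : ℝ × ℝ => scale p.1 p.2) (Icc 0 1 ×ˢ univ) := by
  rintro ⟨τ, x⟩ ⟨⟨h0, h1⟩, -⟩
  by_cases h : τ ≠ 0 ∨ x ≠ 1 / 4
  · exact (contDiffAt_scale (mem_smoothLocus h0 h1 h)).continuousAt.continuousWithinAt
  · push Not at h
    obtain ⟨rfl, rfl⟩ := h
    have hv : scale 0 (1 / 4) = 0 := scale_zero_inner le_rfl
    have hl := (contDiff_outerRaised.continuous.tendsto ((0 : ℝ), (1 / 4 : ℝ))).mono_left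
      (nhdsWithin_le_nhds (s := Icc (0 : ℝ) 1 ×ˢ univ))
    simp only [outerRaised_of_le le_rfl] at hl
    unfold ContinuousWithinAt
    simp only [hv]
    refine tendsto_of_tendsto_of_tendsto_of_le_of_le' tendsto_const_nhds hl ?_ ?_
    · filter_upwards [self_mem_nhdsWithin] with p hp
      exact scale_nonneg hp.1.1 hp.1.2
    · filter_upwards [self_mem_nhdsWithin] with p hp
      exact scale_le hp.1.1 hp.1.2

theorem continuousOn_coscale :
    ContinuousOn (fun p : ℝ × ℝ => coscale p.1 p.2) (Icc 0 1 ×ˢ univ) := by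
  rintro ⟨τ, x⟩ ⟨⟨h0, h1⟩, -⟩
  by_cases h : τ ≠ 0 ∨ x ≠ 1 / 4
  · exact (contDiffAt_coscale (mem_smoothLocus h0 h1 h)).continuousAt.continuousWithinAt
  · push Not at h
    obtain ⟨rfl, rfl⟩ := h
    have hv : coscale 0 (1 / 4) = 0 := coscale_zero_outer le_rfl
    have hl := (contDiff_innerRaised.continuous.tendsto ((0 : ℝ), (1 / 4 : ℝ))).mono_left
      (nhdsWithin_le_nhds (s := Icc (0 : ℝ) 1 ×ˢ univ))
    simp only [innerRaised_of_le le_rfl] at hl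
    unfold ContinuousWithinAt
    simp only [hv]
    refine tendsto_of_tendsto_of_tendsto_of_le_of_le' tendsto_const_nhds hl ?_ ?_
    · filter_upwards [self_mem_nhdsWithin] with p hp
      exact coscale_nonneg hp.1.1 hp.1.2
    · filter_upwards [self_mem_nhdsWithin] with p hp
      exact coscale_le hp.1.1 hp.1.2

/-! ### The radial maps -/

/-- For `τ > 0`, a diffeomorphism of the disc; for `τ = 0` it collapses `‖s‖ ≤ 1 / 2`. -/
def radial (τ : ℝ) (s : ℂ) : ℂ := scale τ (‖s‖ ^ 2) • s

/-- The affine coordinate on the bubble. -/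
def bubble (s : ℂ) : ℂ := (inner (‖s‖ ^ 2))⁻¹ • s

theorem radial_of_le {τ : ℝ} {s : ℂ} (h : 3 / 8 ≤ ‖s‖ ^ 2) : radial τ s = s := by
  rw [radial, scale_of_le h, one_smul]

theorem contDiff_scale {τ : ℝ} (h0 : 0 < τ) (h1 : τ ≤ 1) : ContDiff ℝ ∞ (scale τ) :=
  contDiff_iff_contDiffAt.2 fun x =>
    (contDiffAt_scale (mem_smoothLocus (x := x) h0.le h1 (Or.inl h0.ne'))).comp x
      (contDiffAt_const.prodMk contDiffAt_id)

theorem contDiff_radial {τ : ℝ} (h0 : 0 < τ) (h1 : τ ≤ 1) : ContDiff ℝ ∞ (radial τ) :=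
  ((contDiff_scale h0 h1).comp (contDiff_norm_sq ℝ)).smul contDiff_id

theorem norm_radial {τ : ℝ} (h0 : 0 ≤ τ) (h1 : τ ≤ 1) (s : ℂ) :
    ‖radial τ s‖ = scale τ (‖s‖ ^ 2) * ‖s‖ := by
  rw [radial, norm_smul, Real.norm_of_nonneg (scale_nonneg h0 h1)]

theorem scale_le_one {τ x : ℝ} (h0 : 0 ≤ τ) (h1 : τ ≤ 1) : scale τ x ≤ 1 := by
  refine (scale_le h0 h1).trans ?_
  have : 0 ≤ (1 - τ) * (1 - outer x) :=
    mul_nonneg (by linarith) (sub_nonneg.2 (outer_le_one x))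
  unfold outerRaised
  linarith

theorem norm_radial_le {τ : ℝ} (h0 : 0 ≤ τ) (h1 : τ ≤ 1) (s : ℂ) : ‖radial τ s‖ ≤ ‖s‖ := by
  rw [norm_radial h0 h1]
  exact mul_le_of_le_one_left (norm_nonneg s) (scale_le_one h0 h1)

/-! ### Surjectivity and inverses of the radial maps -/

theorem norm_smul_inv_eq {c r : ℝ} {ζ : ℂ} (hc : 0 < c) (h : c * r = ‖ζ‖) : ‖c⁻¹ • ζ‖ = r := by
  rw [norm_smul, norm_inv, Real.norm_of_nonneg hc.le, ← h]
  field_simp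

/-- By the intermediate value theorem for the modulus, which runs from 0 at r = 0 to 1 at r = 1,
where the factor is 1. -/
theorem exists_radial_eq {τ : ℝ} (h0 : 0 < τ) (h1 : τ ≤ 1) {ζ : ℂ} (hζ : ‖ζ‖ ≤ 1) :
    ∃ s, ‖s‖ ≤ 1 ∧ radial τ s = ζ := by
  have hc : ContinuousOn (fun r : ℝ => scale τ (r ^ 2) * r) (Icc 0 1) :=
    (((contDiff_scale h0 h1).continuous.comp (continuous_pow 2)).mul continuous_id).continuousOn
  have hm : ‖ζ‖ ∈ Icc (scale τ (0 ^ 2) * 0) (scale τ (1 ^ 2) * 1) := by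
    rw [scale_of_le (x := 1 ^ 2) (by norm_num)]
    simpa using hζ
  obtain ⟨r, ⟨hr0, hr1⟩, hr⟩ := intermediate_value_Icc zero_le_one hc hm
  have hp : 0 < scale τ (r ^ 2) := scale_pos h0 h1
  have hn := norm_smul_inv_eq hp hr
  refine ⟨(scale τ (r ^ 2))⁻¹ • ζ, hn.trans_le hr1, ?_⟩
  rw [radial, hn, smul_inv_smul₀ hp.ne']

theorem exists_radial_zero_eq {ζ : ℂ} (h0 : ζ ≠ 0) (hζ : ‖ζ‖ ≤ 1) :
    ∃ s, ‖s‖ ≤ 1 ∧ 1 / 4 < ‖s‖ ^ 2 ∧ radial 0 s = ζ := by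
  -- The modulus of the image runs from 0 on the circle r = 1/2 to 1 at r = 1.
  have hc : ContinuousOn (fun r : ℝ => outer (r ^ 2) * r) (Icc (1 / 2) 1) :=
    ((contDiff_outer.continuous.comp (continuous_pow 2)).mul continuous_id).continuousOn
  have hm : ‖ζ‖ ∈ Icc (outer ((1 / 2) ^ 2) * (1 / 2)) (outer (1 ^ 2) * 1) := by
    rw [outer_of_le (by norm_num), outer_eq_one (by norm_num)]
    simpa using hζ
  obtain ⟨r, ⟨hr0, hr1⟩, hr⟩ := intermediate_value_Icc (by norm_num) hc hm
  have hne : r ≠ 1 / 2 := by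
    rintro rfl
    simp only [outer_of_le (show ((1 : ℝ) / 2) ^ 2 ≤ 1 / 4 by norm_num), zero_mul] at hr
    exact h0 (norm_eq_zero.1 hr.symm)
  have hr2 : 1 / 2 < r := lt_of_le_of_ne hr0 hne.symm
  have hr4 : 1 / 4 < r ^ 2 := by nlinarith
  have hp : 0 < outer (r ^ 2) := outer_pos hr4
  have hn := norm_smul_inv_eq hp hr
  refine ⟨(outer (r ^ 2))⁻¹ • ζ, hn.trans_le hr1, by rwa [hn], ?_⟩
  rw [radial, hn, scale_zero_outer hr4.le, smul_inv_smul₀ hp.ne']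

theorem exists_bubble_eq (w : ℂ) : ∃ s, ‖s‖ ^ 2 < 1 / 4 ∧ bubble s = w := by
  -- The equation r / inner(r²) = |w| is solved in a form without division, since the cutoff
  -- vanishes at r = 1/2.
  have hc : ContinuousOn (fun r : ℝ => r - ‖w‖ * inner (r ^ 2)) (Icc 0 (1 / 2)) :=
    (continuous_id.sub (continuous_const.mul
      (contDiff_inner.continuous.comp (continuous_pow 2)))).continuousOn
  have hm : (0 : ℝ) ∈ Icc (0 - ‖w‖ * inner (0 ^ 2)) (1 / 2 - ‖w‖ * inner ((1 / 2) ^ 2)) := by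
    rw [inner_of_le (x := (1 / 2) ^ 2) (by norm_num)]
    simp [inner_zero]
  obtain ⟨r, ⟨hr0, hr1⟩, hr⟩ := intermediate_value_Icc (by norm_num) hc hm
  have hne : r ≠ 1 / 2 := by
    rintro rfl
    simp only [inner_of_le (show (1 : ℝ) / 4 ≤ (1 / 2) ^ 2 by norm_num)] at hr
    norm_num at hr
  have hr2 : r < 1 / 2 := lt_of_le_of_ne hr1 hne
  have hr4 : r ^ 2 < 1 / 4 := by nlinarith
  have hp : 0 < inner (r ^ 2) := inner_pos hr4
  have hn : ‖inner (r ^ 2) • w‖ = r := by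
    rw [norm_smul, Real.norm_of_nonneg hp.le, mul_comm]
    linarith
  refine ⟨inner (r ^ 2) • w, by rwa [hn], ?_⟩
  rw [bubble, hn, inv_smul_smul₀ hp.ne']

theorem injective_radial {τ : ℝ} (h0 : 0 < τ) (h1 : τ ≤ 1) : Function.Injective (radial τ) := by
  have := injOn_radial (q := scale τ) (I := univ) (fun _ _ => scale_pos h0 h1)
    ((monotone_scale h0 h1).monotoneOn _)
  exact fun s s' h => this (mem_univ (‖s‖ ^ 2)) (mem_univ (‖s'‖ ^ 2)) h

theorem monotoneOn_inv_inner : MonotoneOn (fun x => (inner x)⁻¹) (Iio (1 / 4)) :=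
  fun _ _ _ hy hxy => inv_anti₀ (inner_pos hy) (antitone_inner hxy)

theorem injOn_bubble : InjOn bubble {s | ‖s‖ ^ 2 ∈ Iio (1 / 4)} :=
  injOn_radial (q := fun x => (inner x)⁻¹) (fun _ hx => inv_pos.2 (inner_pos hx))
    monotoneOn_inv_inner

/-- The inverse of `radial τ`. -/
def radialInv (τ : ℝ) : ℂ → ℂ := Function.invFunOn (radial τ) {s | ‖s‖ ^ 2 ∈ univ}

/-- The inverse of `radial 0` outside the collapsed disc. -/
def radialZeroInv : ℂ → ℂ :=
  Function.invFunOn (fun s : ℂ => outer (‖s‖ ^ 2) • s) {s | ‖s‖ ^ 2 ∈ Ioi (1 / 4)}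

/-- The inverse of the affine coordinate on the bubble. -/
def bubbleInv : ℂ → ℂ := Function.invFunOn bubble {s | ‖s‖ ^ 2 ∈ Iio (1 / 4)}

theorem radialInv_radial {τ : ℝ} (h0 : 0 < τ) (h1 : τ ≤ 1) (s : ℂ) :
    radialInv τ (radial τ s) = s :=
  ((injective_radial h0 h1).injOn).leftInvOn_invFunOn (mem_univ (‖s‖ ^ 2))

theorem radialZeroInv_radial {s : ℂ} (hs : 1 / 4 < ‖s‖ ^ 2) : radialZeroInv (radial 0 s) = s := by
  have := injOn_radial (q := outer) (I := Ioi (1 / 4)) (fun _ hx => outer_pos hx)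
    (monotone_outer.monotoneOn _)
  rw [radial, scale_zero_outer hs.le]
  exact this.leftInvOn_invFunOn hs

theorem bubbleInv_bubble {s : ℂ} (hs : ‖s‖ ^ 2 < 1 / 4) : bubbleInv (bubble s) = s :=
  injOn_bubble.leftInvOn_invFunOn hs

theorem contDiffAt_radialInv {τ : ℝ} (h0 : 0 < τ) (h1 : τ ≤ 1) (s : ℂ) :
    ContDiffAt ℝ ∞ (radialInv τ) (radial τ s) :=
  contDiffAt_invFunOn_radial isOpen_univ (fun _ _ => scale_pos h0 h1)
    ((monotone_scale h0 h1).monotoneOn _) (contDiff_scale h0 h1).contDiffOn (mem_univ _)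

theorem contDiffAt_radialZeroInv {s : ℂ} (hs : 1 / 4 < ‖s‖ ^ 2) :
    ContDiffAt ℝ ∞ radialZeroInv (radial 0 s) := by
  rw [radial, scale_zero_outer hs.le]
  exact contDiffAt_invFunOn_radial isOpen_Ioi (fun _ hx => outer_pos hx)
    (monotone_outer.monotoneOn _) contDiff_outer.contDiffOn hs

theorem contDiffAt_bubbleInv {s : ℂ} (hs : ‖s‖ ^ 2 < 1 / 4) :
    ContDiffAt ℝ ∞ bubbleInv (bubble s) :=
  contDiffAt_invFunOn_radial isOpen_Iio (q := fun x => (inner x)⁻¹)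
    (fun _ hx => inv_pos.2 (inner_pos hx)) monotoneOn_inv_inner
    (contDiff_inner.contDiffOn.inv fun _ hx => (inner_pos hx).ne') hs

end Neck

/-! ### Smooth convergence of families depending smoothly on a parameter -/

section SmoothFamilies

variable {V : Type*} [NormedAddCommGroup V] [NormedSpace ℝ V]

theorem uniqueDiffOn_range_realModel : UniqueDiffOn ℝ (range realModel) := realModel.uniqueDiffOn

theorem iteratedFDeriv_slice {H : ℝ × ℂ → V} {O : Set (ℝ × ℂ)} (hO : IsOpen O)
    (hH : ContDiffOn ℝ ∞ H O) {τ : ℝ} {y : ℂ} (hy : (τ, y) ∈ O) (m : ℕ) :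
    iteratedFDeriv ℝ m (fun y => H (τ, y)) y =
      (iteratedFDeriv ℝ m H (τ, y)).compContinuousLinearMap
        fun _ => ContinuousLinearMap.inr ℝ ℝ ℂ := by
  set g : ℂ →L[ℝ] ℝ × ℂ := ContinuousLinearMap.inr ℝ ℝ ℂ
  -- Translation by (τ, 0) turns the affine inclusion of the slice into the linear map `inr`, and
  -- iterated derivatives compose well with linear maps.
  set H' : ℝ × ℂ → V := fun p => H (p + (τ, 0))
  have hs : IsOpen {p : ℝ × ℂ | p + (τ, 0) ∈ O} := hO.preimage (continuous_id.add continuous_const)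
  have hH' : ContDiffOn ℝ ∞ H' {p : ℝ × ℂ | p + (τ, 0) ∈ O} :=
    hH.comp (contDiff_id.add contDiff_const).contDiffOn fun p hp => hp
  have hy' : g y ∈ {p : ℝ × ℂ | p + (τ, 0) ∈ O} := by
    change (0, y) + (τ, (0 : ℂ)) ∈ O
    simpa using hy
  have h1 := g.iteratedFDerivWithin_comp_right hH' hs.uniqueDiffOn
    (hs.preimage g.continuous).uniqueDiffOn hy' (i := m) (by exact_mod_cast le_top)
  rw [iteratedFDerivWithin_of_isOpen m (hs.preimage g.continuous) hy',
    iteratedFDerivWithin_of_isOpen m hs hy', iteratedFDeriv_comp_add_right] at h1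
  have h2 : H' ∘ g = fun y => H (τ, y) := by
    funext z
    simp [H', g]
  have h3 : g y + (τ, 0) = (τ, y) := by simp [g]
  rw [h2, h3] at h1
  exact h1

/-- A criterion for smooth convergence: near each point of the compact set the functions are
given by one function which is smooth in the parameter and the variable. -/
theorem smoothTendstoOn_of_locally_contDiffOn {ι : Type*} {l : Filter ι} {F : ι → ℂ → V}
    {F₀ : ℂ → V} {L : Set ℂ} (hL : IsCompact L) (hLr : L ⊆ range realModel) {τ : ι → ℝ} {τ₀ : ℝ}
    (hτ : Tendsto τ l (𝓝 τ₀))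
    (h : ∀ y ∈ L, ∃ (H : ℝ × ℂ → V) (O : Set (ℝ × ℂ)), IsOpen O ∧ (τ₀, y) ∈ O ∧
      ContDiffOn ℝ ∞ H O ∧
      (∀ i, ∀ y' ∈ range realModel, (τ i, y') ∈ O → F i y' = H (τ i, y')) ∧
      ∀ y' ∈ range realModel, (τ₀, y') ∈ O → F₀ y' = H (τ₀, y')) :
    SmoothTendstoOn l F F₀ L := by
  -- On the half-plane f agrees near y with a function smooth on an open set of the plane. Its
  -- derivatives within the half-plane are therefore the joint derivatives of H restricted to the
  -- second factor.
  have slice : ∀ {H : ℝ × ℂ → V} {O : Set (ℝ × ℂ)} (_ : IsOpen O) (_ : ContDiffOn ℝ ∞ H O)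
      {f : ℂ → V} {τ' : ℝ} (_ : ∀ y' ∈ range realModel, (τ', y') ∈ O → f y' = H (τ', y')) {y : ℂ}
      (_ : y ∈ range realModel) (_ : (τ', y) ∈ O),
      ContDiffWithinAt ℝ ∞ f (range realModel) y ∧ ∀ m : ℕ,
        iteratedFDerivWithin ℝ m f (range realModel) y =
          (iteratedFDeriv ℝ m H (τ', y)).compContinuousLinearMap
            fun _ => ContinuousLinearMap.inr ℝ ℝ ℂ := by
    intro H O hO hH f τ' hf y hyr hyO
    have hc : ContDiffAt ℝ ∞ (fun y => H (τ', y)) y :=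
      (hH.contDiffAt (hO.mem_nhds hyO)).comp y (contDiffAt_const.prodMk contDiffAt_id)
    have hev : f =ᶠ[𝓝[range realModel] y] fun y => H (τ', y) := by
      have : ∀ᶠ y' in 𝓝 y, (τ', y') ∈ O :=
        (hO.preimage (continuous_const.prodMk continuous_id)).mem_nhds hyO
      filter_upwards [nhdsWithin_le_nhds this, self_mem_nhdsWithin] with y' h1 h2
      exact hf y' h2 h1
    refine ⟨hc.contDiffWithinAt.congr_of_eventuallyEq hev (hf y hyr hyO), fun m => ?_⟩
    rw [hev.iteratedFDerivWithin_eq (hf y hyr hyO),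
      iteratedFDerivWithin_eq_iteratedFDeriv uniqueDiffOn_range_realModel
        (hc.of_le (by exact_mod_cast le_top)) hyr, iteratedFDeriv_slice hO hH hyO]
  have hbox : ∀ {O : Set (ℝ × ℂ)} (_ : IsOpen O) {y : ℂ} (_ : (τ₀, y) ∈ O),
      ∃ U ∈ 𝓝 τ₀, ∃ T ∈ 𝓝 y, ∀ τ' ∈ U, ∀ y' ∈ T, (τ', y') ∈ O := by
    intro O hO y hy
    have := hO.mem_nhds hy
    rw [nhds_prod_eq, mem_prod_iff] at this
    obtain ⟨U, hU, T, hT, hUT⟩ := this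
    exact ⟨U, hU, T, hT, fun τ' h1 y' h2 => hUT ⟨h1, h2⟩⟩
  refine ⟨?_, fun y hy => ?_, fun m => ?_⟩
  · choose! H O hO hyO hH hF hF₀ using h
    have key : ∀ y ∈ L, ∃ T ∈ 𝓝 y, ∃ U ∈ 𝓝 τ₀, ∀ τ' ∈ U, ∀ y' ∈ T, (τ', y') ∈ O y := by
      intro y hy
      obtain ⟨U, hU, T, hT, hUT⟩ := hbox (hO y hy) (hyO y hy)
      exact ⟨T, hT, U, hU, hUT⟩
    choose! T hT U hU hUT using key
    obtain ⟨t, htL, htc⟩ := hL.elim_nhds_subcover T hT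
    have hev : ∀ᶠ i in l, ∀ x ∈ t, τ i ∈ U x := by
      rw [Filter.eventually_all_finset]
      exact fun x hx => hτ.eventually (hU x (htL x hx))
    filter_upwards [hev] with i hi y hy
    obtain ⟨x, hx, hyx⟩ := mem_iUnion₂.1 (htc hy)
    exact (slice (hO x (htL x hx)) (hH x (htL x hx)) (hF x (htL x hx) i) (hLr hy)
      (hUT x (htL x hx) _ (hi x hx) _ hyx)).1
  · obtain ⟨H, O, hO, hyO, hH, -, hF₀⟩ := h y hy
    exact (slice hO hH hF₀ (hLr hy) hyO).1
  -- On a compact set locally uniform convergence is enough, and near a point it is the joint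
  -- continuity in (τ, y) of the m-th derivative of H.
  · rw [← tendstoLocallyUniformlyOn_iff_tendstoUniformlyOn_of_compact hL,
      Metric.tendstoLocallyUniformlyOn_iff]
    intro ε hε y hy
    obtain ⟨H, O, hO, hyO, hH, hF, hF₀⟩ := h y hy
    set G : ℝ × ℂ → ContinuousMultilinearMap ℝ (fun _ : Fin m => ℂ) V := fun p =>
      (iteratedFDeriv ℝ m H p).compContinuousLinearMap fun _ => ContinuousLinearMap.inr ℝ ℝ ℂ
    have hG : ContinuousAt G (τ₀, y) := by
      have h1 : ContinuousAt (iteratedFDeriv ℝ m H) (τ₀, y) :=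
        (hH.contDiffAt (hO.mem_nhds hyO)).continuousAt_iteratedFDeriv (by exact_mod_cast le_top)
      exact (ContinuousMultilinearMap.compContinuousLinearMapL (F := V) fun _ : Fin m =>
        ContinuousLinearMap.inr ℝ ℝ ℂ).continuous.continuousAt.comp h1
    have hnear : ∀ᶠ p in 𝓝 (τ₀, y), p ∈ O ∧ dist (G p) (G (τ₀, y)) < ε / 2 :=
      (hO.eventually_mem hyO).and (Metric.tendsto_nhds.1 hG (ε / 2) (half_pos hε))
    rw [nhds_prod_eq] at hnear
    obtain ⟨pU, hU, pT, hT, hUT⟩ := eventually_prod_iff.1 hnear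
    refine ⟨{y' | pT y'} ∩ L, inter_mem (nhdsWithin_le_nhds hT) self_mem_nhdsWithin, ?_⟩
    filter_upwards [hτ.eventually hU] with i hi y' hy'
    have h1 := hUT hi hy'.1
    have h2 := hUT hU.self_of_nhds hy'.1
    rw [(slice hO hH (hF i) (hLr hy'.2) h1.1).2 m, (slice hO hH hF₀ (hLr hy'.2) h2.1).2 m]
    calc dist (G (τ₀, y')) (G (τ i, y'))
        ≤ dist (G (τ₀, y')) (G (τ₀, y)) + dist (G (τ i, y')) (G (τ₀, y)) :=
          dist_triangle_right _ _ _
      _ < ε / 2 + ε / 2 := add_lt_add h2.2 h1.2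
      _ = ε := add_halves ε

end SmoothFamilies

/-! ### Pulled back complex structures -/

/-- The complex structure `B⁻¹ ∘ i ∘ B`. -/
def pullbackStructure (B : ℂ →L[ℝ] ℂ) : ℂ →L[ℝ] ℂ :=
  B.inverse.comp ((Complex.I • ContinuousLinearMap.id ℝ ℂ).comp B)

/-- Multiplication by a non-zero complex number as a real linear equivalence. -/
def mulEquiv (c : ℂ) (hc : c ≠ 0) : ℂ ≃L[ℝ] ℂ :=
  (ContinuousLinearEquiv.smulLeft (R₁ := ℂ) (Units.mk0 c hc)).restrictScalars ℝ

theorem mulEquiv_apply (c : ℂ) (hc : c ≠ 0) (v : ℂ) : mulEquiv c hc v = c * v := rfl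

/-- Multiplication by c commutes with multiplication by i. Hence the pulled back structure ignores
both a holomorphic change of coordinate and a non-zero constant factor, however small. -/
theorem pullbackStructure_mulEquiv_comp (c : ℂ) (hc : c ≠ 0) (B : ℂ →L[ℝ] ℂ) :
    pullbackStructure ((mulEquiv c hc : ℂ →L[ℝ] ℂ).comp B) = pullbackStructure B := by
  unfold pullbackStructure
  rw [ContinuousLinearMap.inverse_equiv_comp]
  ext v
  simp only [ContinuousLinearMap.comp_apply, _root_.smul_apply,
    ContinuousLinearMap.id_apply, ContinuousLinearEquiv.coe_coe, mulEquiv_apply, smul_eq_mul]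
  congr 1
  rw [ContinuousLinearEquiv.symm_apply_eq, mulEquiv_apply]
  ring

theorem contDiffAt_pullbackStructure {B : ℂ →L[ℝ] ℂ} (hB : B.IsInvertible) :
    ContDiffAt ℝ ∞ pullbackStructure B :=
  hB.contDiffAt_map_inverse.clm_comp (contDiffAt_const.clm_comp contDiffAt_id)

theorem isOpen_setOf_isInvertible : IsOpen {B : ℂ →L[ℝ] ℂ | B.IsInvertible} :=
  ContinuousLinearEquiv.isOpen

instance (N : Type*) [TopologicalSpace N] [ChartedSpace ClosedHalfPlane N]
    [IsManifold complexModel ω N] : IsManifold realModel ∞ N := by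
  apply isManifold_of_contDiffOn
  intro e e' he he'
  have h := (contDiffGroupoid ω complexModel).compatible he he'
  have h1 := (contDiffGroupoid_le (I := complexModel) (m := ∞) (n := ω) le_top h).1
  exact ContDiffOn.restrict_scalars ℝ h1

/-- In a coordinate of the curve, the pulled back complex structure is that of the differential of
the coordinate expression. -/
theorem Parametrization.complexStructure_eq {S : BorderedSurface} {C : NodalCurve}
    (P : Parametrization S C) {s : S.carrier} {y : ℂ} (hy : y ∈ (extChartAt realModel s).target)
    (hsrc : (extChartAt realModel s).symm y ∈ P.regular.source) {κ : C.reg → ℂ}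
    (hκ : IsCoordinateAt κ (P.regular ((extChartAt realModel s).symm y))) {K : ℂ → ℂ}
    (hK : DifferentiableAt ℝ K y)
    (hev : ∀ᶠ y' in 𝓝[range realModel] y,
      κ (P.regular ((extChartAt realModel s).symm y')) = K y') :
    P.complexStructure s y = pullbackStructure (fderiv ℝ K y) := by
  set g : ℂ → C.reg := fun y' => P.regular ((extChartAt realModel s).symm y')
  have hyr : y ∈ range realModel := extChartAt_target_subset_range s hy
  have hg : MDifferentiableWithinAt 𝓘(ℝ, ℂ) realModel g (range realModel) y := by
    have h1 := (contMDiffWithinAt_extChartAt_symm_range (I := realModel) (n := ∞) s hy)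
    have h2 : ContMDiffAt realModel realModel ∞ P.regular ((extChartAt realModel s).symm y) :=
      P.regular.contMDiffOn_toFun.contMDiffAt (P.regular.open_source.mem_nhds hsrc)
    exact (h2.comp_contMDiffWithinAt y h1).mdifferentiableWithinAt (by simp)
  obtain ⟨φ, hφ, hφ', hφe⟩ := hκ
  have hKy : κ (g y) = K y := hev.self_of_nhdsWithin hyr
  -- The chart at the image point is φ ∘ κ with φ holomorphic, so the differential in the charts is
  -- that of K followed by multiplication by the non-zero number φ'.
  have hA : mfderivWithin 𝓘(ℝ, ℂ) realModel g (range realModel) y =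
      (mulEquiv (deriv φ (κ (g y))) hφ' : ℂ →L[ℝ] ℂ).comp (fderiv ℝ K y) := by
    have h1 : mfderivWithin 𝓘(ℝ, ℂ) realModel g (range realModel) y =
        fderivWithin ℝ (writtenInExtChartAt 𝓘(ℝ, ℂ) realModel y g) (range realModel) y := by
      refine hg.mfderivWithin.trans ?_
      simp only [mfld_simps, inter_univ]
      rfl
    have h2 : writtenInExtChartAt 𝓘(ℝ, ℂ) realModel y g =ᶠ[𝓝[range realModel] y] φ ∘ K := by
      filter_upwards [hev, hg.continuousWithinAt.eventually hφe] with y' h3 h4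
      rw [Function.comp_apply, ← h3, ← h4]
      rfl
    have hd : HasFDerivAt φ ((mulEquiv (deriv φ (κ (g y))) hφ' : ℂ →L[ℝ] ℂ)) (K y) := by
      rw [← hKy]
      have := ((hφ.differentiableAt (by simp)).hasDerivAt).hasFDerivAt.restrictScalars ℝ
      refine this.congr_fderiv (ContinuousLinearMap.ext fun v => ?_)
      simp only [mulEquiv_apply, ContinuousLinearEquiv.coe_coe, ContinuousLinearMap.coe_restrictScalars',
        ContinuousLinearMap.toSpanSingleton_apply, smul_eq_mul]
      exact mul_comm _ _
    rw [h1, h2.fderivWithin_eq_of_mem hyr]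
    exact ((hd.comp y hK.hasFDerivAt).hasFDerivWithinAt).fderivWithin
      (uniqueDiffOn_range_realModel y hyr)
  unfold Parametrization.complexStructure
  change pullbackStructure (mfderivWithin 𝓘(ℝ, ℂ) realModel g (range realModel) y) = _
  rw [hA, pullbackStructure_mulEquiv_comp]

/-! ### Maps to the closed disc and to the punctured disc -/

/-- The closed disc without its centre. -/
def puncturedOpens : TopologicalSpace.Opens UnitDisc :=
  ⟨{z | (z : ℂ) ≠ 0}, isOpen_ne_fun continuous_subtype_val continuous_const⟩

/-- The closed disc without its centre. -/
abbrev PuncturedDisc : Type := puncturedOpens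

open Classical in
/-- The point of the closed disc with a given coordinate. -/
def toDisc (z : ℂ) : UnitDisc := if h : ‖z‖ ≤ 1 then ⟨z, mem_closedBall_zero_iff.2 h⟩ else ⟨1, by simp⟩

theorem coe_toDisc {z : ℂ} (h : ‖z‖ ≤ 1) : (toDisc z : ℂ) = z := by
  rw [toDisc, dif_pos h]

theorem toDisc_coe (z : UnitDisc) : toDisc z = z := Subtype.ext (coe_toDisc z.norm_le)

/-- The default value of `toDisc` is 1 rather than 0, so that it may serve in `toPunctured`. -/
theorem toDisc_ne_zero {z : ℂ} (h : z ≠ 0) : (toDisc z : ℂ) ≠ 0 := by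
  unfold toDisc
  split_ifs
  · exact h
  · exact one_ne_zero

open Classical in
/-- The point of the punctured disc with a given coordinate. -/
def toPunctured (z : ℂ) : PuncturedDisc :=
  if h : z ≠ 0 then ⟨toDisc z, toDisc_ne_zero h⟩ else ⟨toDisc 1, toDisc_ne_zero one_ne_zero⟩

theorem coe_toPunctured {z : ℂ} (h : z ≠ 0) : (toPunctured z : UnitDisc) = toDisc z := by
  rw [toPunctured, dif_pos h]

theorem toPunctured_coe (z : PuncturedDisc) : toPunctured (z : UnitDisc) = z :=
  Subtype.ext (by rw [coe_toPunctured z.2, toDisc_coe])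

section ToDisc

variable {E H N : Type*} [NormedAddCommGroup E] [TopologicalSpace H] [TopologicalSpace N]
  [ChartedSpace H N] {n : ℕ∞ω} {g : N → ℂ} {s : Set N}

theorem contMDiffOn_toDisc_real [NormedSpace ℝ E] {I : ModelWithCorners ℝ E H}
    (hg : ContMDiffOn I 𝓘(ℝ, ℂ) n g s) (h : ∀ x ∈ s, ‖g x‖ ≤ 1) :
    ContMDiffOn I realModel n (fun x => toDisc (g x)) s := fun x hx =>
  UnitDisc.contMDiffWithinAt_real
    ((hg x hx).congr (fun y hy => coe_toDisc (h y hy)) (coe_toDisc (h x hx)))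

theorem contMDiffOn_toPunctured_real [NormedSpace ℝ E] {I : ModelWithCorners ℝ E H}
    (hg : ContMDiffOn I 𝓘(ℝ, ℂ) n g s) (h : ∀ x ∈ s, ‖g x‖ ≤ 1) (h0 : ∀ x ∈ s, g x ≠ 0) :
    ContMDiffOn I realModel n (fun x => toPunctured (g x)) s := fun x hx =>
  (ChartedSpace.liftPropWithinAt_subtypeVal_comp_iff _ _ _).1
    ((contMDiffOn_toDisc_real hg h x hx).congr (fun y hy => coe_toPunctured (h0 y hy))
      (coe_toPunctured (h0 x hx)))

theorem contMDiffOn_toPunctured_complex [NormedSpace ℂ E] {I : ModelWithCorners ℂ E H}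
    (hg : ContMDiffOn I 𝓘(ℂ) n g s) (h : ∀ x ∈ s, ‖g x‖ ≤ 1) (h0 : ∀ x ∈ s, g x ≠ 0) :
    ContMDiffOn I complexModel n (fun x => toPunctured (g x)) s := fun x hx => by
  have h1 : ContMDiffWithinAt I complexModel n (fun x => toDisc (g x)) s x :=
    UnitDisc.contMDiffWithinAt_complex
      ((hg x hx).congr (fun y hy => coe_toDisc (h y hy)) (coe_toDisc (h x hx)))
  exact (ChartedSpace.liftPropWithinAt_subtypeVal_comp_iff _ _ _).1
    (h1.congr (fun y hy => coe_toPunctured (h0 y hy)) (coe_toPunctured (h0 x hx)))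

end ToDisc

theorem contMDiff_coe_real : ContMDiff realModel 𝓘(ℝ, ℂ) ∞ ((↑) : UnitDisc → ℂ) :=
  (UnitDisc.contMDiff_coe.restrictScalars_realModel).of_le le_top

theorem contMDiff_affineLine_coe_real : ContMDiff realModel 𝓘(ℝ, ℂ) ∞ AffineLine.coe :=
  (AffineLine.contMDiff_coe.restrictScalars_realModel).of_le le_top

/-! ### The curves of the family -/

namespace Neck

/-- The point of the total space that corresponds to the point `s` of the disc and to `τ`. -/
def point (τ : ℝ) (s : ℂ) : TotalSpaceX :=
  TotalSpaceX.ofVec ![s, (coscale τ (‖s‖ ^ 2) : ℂ)] (scale τ (‖s‖ ^ 2)) 0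

/-- The first entry vanishes only at s = 0, where `coscale` is the positive inner factor. So the
line remains defined at τ = 0, and the family extends through the bubbling. -/
theorem pointVec_ne_zero {τ : ℝ} (h0 : 0 ≤ τ) (s : ℂ) :
    (![s, (coscale τ (‖s‖ ^ 2) : ℂ)] : Fin 2 → ℂ) ≠ 0 := fun h => by
  have hs : s = 0 := by simpa using congrFun h 0
  have h1 : coscale τ (‖s‖ ^ 2) = 0 := by simpa using congrFun h 1
  have hx : ‖s‖ ^ 2 < 1 / 4 := by
    rw [hs]
    norm_num
  rw [coscale_inner hx] at h1
  exact (innerRaised_pos h0 hx).ne' h1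

/-- The first vector is scale · (s, coscale) = (radial τ s, τ²). At τ = 0 the line is [1 : 0] only
where `coscale` vanishes, whence the restriction to |s| ≥ 1/2. -/
theorem point_eq_disc {τ : ℝ} (h0 : 0 ≤ τ) (h1 : τ ≤ 1) {s : ℂ} (h : τ ≠ 0 ∨ 1 / 4 ≤ ‖s‖ ^ 2) :
    point τ s = TotalSpaceX.disc (τ ^ 2) (radial τ s) := by
  refine TotalSpaceX.ofVec_eq_disc (pointVec_ne_zero h0 s) ?_ ?_ fun ht => ?_
  · simp [radial]
  · have := scale_mul_coscale (x := ‖s‖ ^ 2) h0 h1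
    simp only [Matrix.cons_val_one, Matrix.cons_val_fin_one]
    exact_mod_cast this
  · have hτ : τ = 0 := pow_eq_zero_iff two_ne_zero |>.1 ht
    subst hτ
    simp [coscale_zero_outer (h.resolve_left (by simp))]

/-- The point of the zero section with a given affine coordinate. -/
def bubblePoint (w : ℂ) : TotalSpaceX := (TotalSpaceX.chart 1).symm (w, 0, 0)

/-- Inside the circle `scale` vanishes at τ = 0. What remains is the zero vector over [s : inner],
whose base coordinate in the second chart is s / inner. -/
theorem point_zero_eq_bubblePoint {s : ℂ} (h : ‖s‖ ^ 2 < 1 / 4) :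
    point 0 s = bubblePoint (bubble s) := by
  have hne : (coscale 0 (‖s‖ ^ 2) : ℂ) ≠ 0 := by
    rw [coscale_zero_inner h]
    exact_mod_cast (inner_pos h).ne'
  rw [point, TotalSpaceX.ofVec_eq_chart_symm (j := 1) (by simpa using hne)]
  simp [bubblePoint, scale_zero_inner h.le, coscale_zero_inner h, bubble, div_eq_inv_mul]

/-- The source of uniform and Hausdorff convergence. The parameter is τ = √t because the product of
the factors is τ² and must be the value t of η₁. -/
theorem continuous_point :
    Continuous fun p : unitInterval × UnitDisc => point (√p.1) (p.2 : ℂ) := by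
  have hp : Continuous fun p : unitInterval × UnitDisc => (√(p.1 : ℝ), ‖(p.2 : ℂ)‖ ^ 2) := by
    refine Continuous.prodMk ?_ ?_
    · exact Real.continuous_sqrt.comp (continuous_subtype_val.comp continuous_fst)
    · exact (continuous_norm.comp (continuous_subtype_val.comp continuous_snd)).pow 2
  have hm : ∀ p : unitInterval × UnitDisc,
      (√(p.1 : ℝ), ‖(p.2 : ℂ)‖ ^ 2) ∈ Icc (0 : ℝ) 1 ×ˢ (univ : Set ℝ) := fun p =>
    ⟨⟨Real.sqrt_nonneg _, Real.sqrt_le_one.2 p.1.2.2⟩, mem_univ _⟩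
  have h1 : Continuous fun p : unitInterval × UnitDisc => scale √p.1 (‖(p.2 : ℂ)‖ ^ 2) :=
    continuousOn_scale.comp_continuous hp hm
  have h2 : Continuous fun p : unitInterval × UnitDisc => coscale √p.1 (‖(p.2 : ℂ)‖ ^ 2) :=
    continuousOn_coscale.comp_continuous hp hm
  refine continuous_iff_continuousAt.2 fun p => ?_
  refine TotalSpaceX.continuousAt_ofVec ?_ (Complex.continuous_ofReal.comp h1).continuousAt
    continuousAt_const (pointVec_ne_zero (Real.sqrt_nonneg _) _)
  refine Continuous.continuousAt (continuous_pi fun i => ?_)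
  fin_cases i
  · exact continuous_subtype_val.comp continuous_snd
  · exact Complex.continuous_ofReal.comp h2

/-- A curve over the total space parametrized by the disc, which is part of the family. -/
structure Fiber (t : unitInterval) where
  C : NodalCurve
  u : C(C.carrier, TotalSpaceX)
  P : Parametrization UnitDisc.surface C
  isHolomorphic : C.IsHolomorphic C3 u
  injective : Function.Injective u
  image_boundary : u '' C.boundary = TotalSpaceX.disc t '' Metric.sphere 0 1
  toMap_surjective : Function.Surjective P.toMap
  map_toMap : ∀ s : UnitDisc, u (P.toMap s) = point √t s
  mem_source : ∀ s : UnitDisc, s ∈ P.regular.source ↔ t ≠ 0 ∨ ‖(s : ℂ)‖ ^ 2 ≠ 1 / 4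
  κ : C.reg → ℂ
  isCoordinateAt : ∀ p, IsCoordinateAt κ p
  coordinate_radial : ∀ s : UnitDisc, t ≠ 0 ∨ 1 / 4 < ‖(s : ℂ)‖ ^ 2 →
    κ (P.regular s) = radial √t s
  coordinate_bubble : t = 0 → ∀ s : UnitDisc, ‖(s : ℂ)‖ ^ 2 < 1 / 4 → κ (P.regular s) = bubble s
  nodes_of_pos : 0 < t → C.nodes = ∅
  range_of_pos : 0 < t → range u = TotalSpaceX.disc t '' Metric.closedBall 0 1
  nodes_zero : t = 0 → ∃ a, C.nodes = {a} ∧ u a = TotalSpaceX.disc 0 0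
  range_zero : t = 0 →
    range u = TotalSpaceX.disc 0 '' Metric.closedBall 0 1 ∪ TotalSpaceX.bubbleE

/-! ### The smooth curves -/

/-- The closed disc as a nodal curve. -/
abbrev discCurve : NodalCurve where
  carrier := UnitDisc
  reg := UnitDisc
  incl := id
  isOpenEmbedding_incl := IsOpenEmbedding.id
  finite_nodes := by simp
  exists_node := by simp

theorem norm_radial_coe_le {τ : ℝ} (h0 : 0 < τ) (h1 : τ ≤ 1) (s : UnitDisc) : ‖radial τ (s : ℂ)‖ ≤ 1 :=
  (norm_radial_le h0.le h1 _).trans s.norm_le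

theorem norm_radialInv_le {τ : ℝ} (h0 : 0 < τ) (h1 : τ ≤ 1) {z : ℂ} (hz : ‖z‖ ≤ 1) : ‖radialInv τ z‖ ≤ 1 := by
  obtain ⟨s, hs, rfl⟩ := exists_radial_eq h0 h1 hz
  rwa [radialInv_radial h0 h1]

theorem radial_radialInv {τ : ℝ} (h0 : 0 < τ) (h1 : τ ≤ 1) {z : ℂ} (hz : ‖z‖ ≤ 1) : radial τ (radialInv τ z) = z := by
  obtain ⟨s, hs, rfl⟩ := exists_radial_eq h0 h1 hz
  rw [radialInv_radial h0 h1]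

theorem contDiffAt_radialInv' {τ : ℝ} (h0 : 0 < τ) (h1 : τ ≤ 1) {z : ℂ} (hz : ‖z‖ ≤ 1) : ContDiffAt ℝ ∞ (radialInv τ) z := by
  obtain ⟨s, hs, rfl⟩ := exists_radial_eq h0 h1 hz
  exact contDiffAt_radialInv h0 h1 s

/-- The parametrization of the disc by the radial map. -/
abbrev discParametrization {τ : ℝ} (h0 : 0 < τ) (h1 : τ ≤ 1) :
    Parametrization UnitDisc.surface discCurve where
  toMap := ⟨fun s : UnitDisc => (⟨radial τ s,
      mem_closedBall_zero_iff.2 (norm_radial_coe_le h0 h1 s)⟩ : UnitDisc),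
    ((contDiff_radial h0 h1).continuous.comp continuous_subtype_val).subtype_mk _⟩
  regular :=
    { toFun := fun s : UnitDisc => (⟨radial τ s,
        mem_closedBall_zero_iff.2 (norm_radial_coe_le h0 h1 s)⟩ : UnitDisc)
      invFun := fun z : UnitDisc => toDisc (radialInv τ z)
      source := univ
      target := univ
      map_source' := fun _ _ => mem_univ _
      map_target' := fun _ _ => mem_univ _
      left_inv' := fun s _ => by
        have := radialInv_radial h0 h1 (s : ℂ)
        exact (congrArg toDisc this).trans (toDisc_coe s)
      right_inv' := fun z _ => Subtype.ext (by
        change radial τ (toDisc (radialInv τ z) : ℂ) = z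
        rw [coe_toDisc (norm_radialInv_le h0 h1 z.norm_le), radial_radialInv h0 h1 z.norm_le])
      open_source := isOpen_univ
      open_target := isOpen_univ
      contMDiffOn_toFun := fun s _ => UnitDisc.contMDiffWithinAt_real
        (((contDiff_radial h0 h1).contMDiff.comp contMDiff_coe_real) s).contMDiffWithinAt
      contMDiffOn_invFun := contMDiffOn_toDisc_real (fun z _ =>
        ((contDiffAt_radialInv' h0 h1 (UnitDisc.norm_le z)).contMDiffAt.comp z
          (contMDiff_coe_real z)).contMDiffWithinAt)
        fun z _ => norm_radialInv_le h0 h1 (UnitDisc.norm_le z) }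
  source_regular := by simp
  target_regular := rfl
  incl_regular _ _ := rfl
  circle a ha := by simp [NodalCurve.nodes] at ha

/-- The curve is the standard closed disc and the map is φ_t; the cutoffs enter only through the
parametrization `radial √t`. -/
theorem nonempty_fiber_of_pos {t : unitInterval} (ht : 0 < t) : Nonempty (Fiber t) := by
  have ht' : (0 : ℝ) < t := ht
  have h0 : 0 < √(t : ℝ) := Real.sqrt_pos.2 ht'
  have h1 : √(t : ℝ) ≤ 1 := Real.sqrt_le_one.2 t.2.2
  have hsq : √(t : ℝ) ^ 2 = t := Real.sq_sqrt ht'.le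
  refine ⟨{
    C := discCurve
    u := ⟨fun z : UnitDisc => TotalSpaceX.disc t z,
      (TotalSpaceX.contMDiff_disc t).continuous.comp continuous_subtype_val⟩
    P := discParametrization h0 h1
    isHolomorphic := fun z _ =>
      ((TotalSpaceX.contMDiff_disc t).comp UnitDisc.contMDiff_coe) z
    injective := (TotalSpaceX.isEmbedding_disc t).injective.comp Subtype.val_injective
    image_boundary := ?_
    toMap_surjective := fun z => ?_
    map_toMap := fun s => ?_
    mem_source := fun s => ⟨fun _ => Or.inl ht.ne', fun _ => mem_univ _⟩
    κ := fun z : UnitDisc => (z : ℂ)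
    isCoordinateAt := UnitDisc.isCoordinateAt
    coordinate_radial := fun s _ => rfl
    coordinate_bubble := fun h => absurd h ht.ne'
    nodes_of_pos := fun _ => by simp [NodalCurve.nodes]
    range_of_pos := fun _ => ?_
    nodes_zero := fun h => absurd h ht.ne'
    range_zero := fun h => absurd h ht.ne' }⟩
  · ext x
    constructor
    · rintro ⟨z, ⟨z, hz, rfl⟩, rfl⟩
      exact ⟨(z : UnitDisc), mem_sphere_zero_iff_norm.2 (UnitDisc.mem_boundary_complexModel.1 hz), rfl⟩
    · rintro ⟨ζ, hζ, rfl⟩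
      have hζ' := mem_sphere_zero_iff_norm.1 hζ
      let z : UnitDisc := ⟨ζ, mem_closedBall_zero_iff.2 hζ'.le⟩
      exact ⟨z, ⟨z, UnitDisc.mem_boundary_complexModel.2 hζ', rfl⟩, rfl⟩
  · obtain ⟨s, hs, hsz⟩ := exists_radial_eq h0 h1 (UnitDisc.norm_le z)
    exact ⟨(⟨s, mem_closedBall_zero_iff.2 hs⟩ : UnitDisc), Subtype.ext hsz⟩
  · rw [point_eq_disc h0.le h1 (Or.inl h0.ne'), hsq]
    rfl
  · ext x
    constructor
    · rintro ⟨z, rfl⟩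
      exact ⟨(z : UnitDisc), Subtype.property (p := (· ∈ Metric.closedBall (0 : ℂ) 1)) z, rfl⟩
    · rintro ⟨ζ, hζ, rfl⟩
      exact ⟨(⟨ζ, hζ⟩ : UnitDisc), rfl⟩

end Neck

namespace Neck

/-! ### The nodal curve -/

theorem radial_zero_ne_zero {s : ℂ} (h : 1 / 4 < ‖s‖ ^ 2) : radial 0 s ≠ 0 := by
  rw [radial, scale_zero_outer h.le]
  refine smul_ne_zero (outer_pos h).ne' ?_
  rintro rfl
  norm_num at h

theorem norm_radial_zero_le (s : UnitDisc) : ‖radial 0 (s : ℂ)‖ ≤ 1 :=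
  (norm_radial_le le_rfl zero_le_one _).trans s.norm_le

theorem contDiffAt_radial_zero {s : ℂ} (h : 1 / 4 < ‖s‖ ^ 2) : ContDiffAt ℝ ∞ (radial 0) s := by
  have h1 := contDiffAt_scale (mem_smoothLocus (x := ‖s‖ ^ 2) le_rfl zero_le_one (Or.inr h.ne'))
  have h2 : ContDiffAt ℝ ∞ (fun s : ℂ => ((0 : ℝ), ‖s‖ ^ 2)) s :=
    contDiffAt_const.prodMk (contDiff_norm_sq ℝ).contDiffAt
  exact (h1.comp s h2).smul contDiffAt_id

theorem contDiffAt_bubble {s : ℂ} (h : ‖s‖ ^ 2 < 1 / 4) : ContDiffAt ℝ ∞ bubble s :=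
  (((contDiff_inner.comp (contDiff_norm_sq ℝ)).contDiffAt).inv (inner_pos h).ne').smul contDiffAt_id

theorem radialZeroInv_spec {z : ℂ} (h0 : z ≠ 0) (hz : ‖z‖ ≤ 1) :
    ‖radialZeroInv z‖ ≤ 1 ∧ 1 / 4 < ‖radialZeroInv z‖ ^ 2 ∧ radial 0 (radialZeroInv z) = z ∧
      ContDiffAt ℝ ∞ radialZeroInv z := by
  obtain ⟨s, hs, hs4, rfl⟩ := exists_radial_zero_eq h0 hz
  rw [radialZeroInv_radial hs4]
  exact ⟨hs, hs4, rfl, contDiffAt_radialZeroInv hs4⟩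

theorem bubbleInv_spec (w : ℂ) : ‖bubbleInv w‖ ^ 2 < 1 / 4 ∧ bubble (bubbleInv w) = w ∧
    ContDiffAt ℝ ∞ bubbleInv w := by
  obtain ⟨s, hs4, rfl⟩ := exists_bubble_eq w
  rw [bubbleInv_bubble hs4]
  exact ⟨hs4, rfl, contDiffAt_bubbleInv hs4⟩

theorem norm_bubbleInv_le (w : ℂ) : ‖bubbleInv w‖ ≤ 1 := by
  have := (bubbleInv_spec w).1
  nlinarith [norm_nonneg (bubbleInv w)]

/-- The disc with the bubble attached. -/
def wedge : Set TotalSpaceX :=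
  TotalSpaceX.disc 0 '' Metric.closedBall 0 1 ∪ TotalSpaceX.bubbleE

theorem disc_mem_wedge (z : UnitDisc) : TotalSpaceX.disc 0 z ∈ wedge := Or.inl ⟨z, z.2, rfl⟩

theorem bubblePoint_mem_wedge (w : ℂ) : bubblePoint w ∈ wedge :=
  Or.inr (TotalSpaceX.chart_symm_mem_bubbleE 1 w)

instance : CompactSpace wedge := isCompact_iff_compactSpace.1
  (((isCompact_closedBall _ _).image (TotalSpaceX.contMDiff_disc 0).continuous).union
    TotalSpaceX.isCompact_bubbleE)

theorem disc_zero_eq_chart_symm (ζ : ℂ) :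
    TotalSpaceX.disc 0 ζ = (TotalSpaceX.chart 0).symm (0, ζ, 0) := by
  rw [TotalSpaceX.disc_zero_eq_ofVec, TotalSpaceX.ofVec_eq_chart_symm (j := 0) (by simp)]
  simp

/-- The line [1 : z] is [1/z : 1]: the node, at z = 0, is the point at infinity of the affine
coordinate on the bubble. -/
theorem chart_symm_zero_eq_bubblePoint {z : ℂ} (hz : z ≠ 0) :
    (TotalSpaceX.chart 0).symm (z, 0, 0) = bubblePoint z⁻¹ := by
  have h1 := TotalSpaceX.ofVec_eq_chart_symm (v := ![1, z]) (j := 0) (by simp) 0 0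
  have h2 := TotalSpaceX.ofVec_eq_chart_symm (v := ![1, z]) (j := 1) (by simpa using hz) 0 0
  simp only [Fin.isValue, sub_zero, sub_self, Matrix.cons_val_one, Matrix.cons_val_zero,
    Matrix.cons_val_fin_one, div_one, zero_mul, one_div] at h1 h2
  rw [← h1, h2, bubblePoint]

theorem disc_zero_notMem_chart (ζ : ℂ) :
    TotalSpaceX.disc 0 ζ ∉ (TotalSpaceX.chart 1).source := fun h => by
  rw [TotalSpaceX.disc_zero_eq_ofVec] at h
  have := TotalSpaceX.ne_zero_of_ofVec_mem_chart_source (fun h0 => by simpa using congrFun h0 0) h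
  simp at this

theorem bubbleE_eq_of_mem_chart {x : TotalSpaceX} (hx : x ∈ TotalSpaceX.bubbleE) {j : Fin 2}
    (hj : x ∈ (TotalSpaceX.chart j).source) :
    x = (TotalSpaceX.chart j).symm ((TotalSpaceX.chart j x).1, 0, 0) := by
  rw [TotalSpaceX.bubbleE_eq] at hx
  conv_lhs => rw [← TotalSpaceX.chart_symm_left_inv hj]
  congr 1
  rw [TotalSpaceX.chart_apply, hx.1, hx.2]
  rfl

/-- A point of the zero section is the node or lies in the affine part of the bubble. -/
theorem bubbleE_eq_disc_or {x : TotalSpaceX} (hx : x ∈ TotalSpaceX.bubbleE) :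
    x = TotalSpaceX.disc 0 0 ∨ ∃ w, x = bubblePoint w := by
  by_cases h : x ∈ (TotalSpaceX.chart 1).source
  · exact Or.inr ⟨_, bubbleE_eq_of_mem_chart hx h⟩
  · have h0 : x ∈ (TotalSpaceX.chart 0).source :=
      (TotalSpaceX.exists_rep_ne_zero x.line).resolve_right h
    have h1 := bubbleE_eq_of_mem_chart hx h0
    by_cases hz : (TotalSpaceX.chart 0 x).1 = 0
    · rw [hz] at h1
      exact Or.inl (h1.trans (disc_zero_eq_chart_symm 0).symm)
    · rw [chart_symm_zero_eq_bubblePoint hz] at h1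
      exact Or.inr ⟨_, h1⟩

/-- The smooth part of the disc with the bubble. -/
abbrev WedgeReg : Type := PuncturedDisc ⊕ AffineLine

/-- The inclusion of the smooth part. -/
def wedgeIncl : WedgeReg → wedge :=
  Sum.elim (fun z => ⟨TotalSpaceX.disc 0 (z : UnitDisc), disc_mem_wedge z⟩)
    fun w => ⟨bubblePoint (AffineLine.coe w), bubblePoint_mem_wedge _⟩

theorem isOpenEmbedding_chart_symm (j : Fin 2) : IsOpenEmbedding (TotalSpaceX.chart j).symm :=
  (TotalSpaceX.chart j).symm.isOpenEmbedding rfl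

theorem isEmbedding_bubblePoint : IsEmbedding bubblePoint := by
  have h : IsEmbedding fun w : ℂ => ((w, 0, 0) : C3) :=
    (show Function.LeftInverse (Prod.fst : C3 → ℂ) _ from fun _ => rfl).isEmbedding
      continuous_fst (by fun_prop)
  exact (isOpenEmbedding_chart_symm 1).isEmbedding.comp h

/-- The two pieces are open in the wedge because they are the loci ξ₁ ≠ 0 and line ≠ [1 : 0]. They
are disjoint because the disc lies over [1 : 0]. -/
theorem isOpenEmbedding_wedgeIncl : IsOpenEmbedding wedgeIncl := by
  refine IsOpenEmbedding.sumElim ⟨?_, ?_⟩ ⟨?_, ?_⟩ ?_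
  · refine IsEmbedding.of_comp (continuous_induced_rng.2 ?_) continuous_subtype_val ?_
    · exact (TotalSpaceX.contMDiff_disc 0).continuous.comp
        (continuous_subtype_val.comp continuous_subtype_val)
    · exact (TotalSpaceX.isEmbedding_disc 0).comp
        (IsEmbedding.subtypeVal.comp IsEmbedding.subtypeVal)
  · have : range (fun z : PuncturedDisc =>
        (⟨TotalSpaceX.disc 0 (z : UnitDisc), disc_mem_wedge z⟩ : wedge)) =
        {x : wedge | (x : TotalSpaceX).fst 0 ≠ 0} := by
      ext x
      constructor
      · rintro ⟨z, rfl⟩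
        exact z.2
      · intro hx
        rcases x.2 with ⟨ζ, hζ, h⟩ | h
        · have hζ0 : ζ ≠ 0 := by
            have h1 : (x : TotalSpaceX).fst 0 ≠ 0 := hx
            rw [← h] at h1
            exact h1
          exact ⟨⟨⟨ζ, hζ⟩, hζ0⟩, Subtype.ext h⟩
        · rw [TotalSpaceX.bubbleE_eq] at h
          exact absurd (congrFun h.1 0) hx
    rw [this]
    exact isOpen_ne_fun ((TotalSpaceX.contMDiff_fst 0).continuous.comp continuous_subtype_val)
      continuous_const
  · refine IsEmbedding.of_comp (continuous_induced_rng.2 ?_) continuous_subtype_val ?_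
    · exact isEmbedding_bubblePoint.continuous.comp AffineLine.continuous_coe
    · exact isEmbedding_bubblePoint.comp IsEmbedding.id
  · have : range (fun w : AffineLine =>
        (⟨bubblePoint (AffineLine.coe w), bubblePoint_mem_wedge _⟩ : wedge)) =
        {x : wedge | (x : TotalSpaceX) ∈ (TotalSpaceX.chart 1).source} := by
      ext x
      constructor
      · rintro ⟨w, rfl⟩
        exact TotalSpaceX.chart_symm_mem 1 _
      · intro hx
        rcases x.2 with ⟨ζ, hζ, h⟩ | h
        · have h1 : (x : TotalSpaceX) ∈ (TotalSpaceX.chart 1).source := hx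
          rw [← h] at h1
          exact absurd h1 (disc_zero_notMem_chart ζ)
        · exact ⟨AffineLine.of _, Subtype.ext (bubbleE_eq_of_mem_chart h hx).symm⟩
    rw [this]
    exact (TotalSpaceX.chart 1).open_source.preimage continuous_subtype_val
  · rintro (z | w) (z' | w') h
    · have h1 := (TotalSpaceX.isEmbedding_disc 0).injective (congrArg Subtype.val h)
      exact congrArg Sum.inl (Subtype.ext (Subtype.ext h1))
    · have h1 : TotalSpaceX.disc 0 (z : UnitDisc) = bubblePoint (AffineLine.coe w') :=
        congrArg Subtype.val h
      exact absurd (h1 ▸ TotalSpaceX.chart_symm_mem 1 _) (disc_zero_notMem_chart (z : UnitDisc))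
    · have h1 : bubblePoint (AffineLine.coe w) = TotalSpaceX.disc 0 (z' : UnitDisc) :=
        congrArg Subtype.val h
      exact absurd (h1 ▸ TotalSpaceX.chart_symm_mem 1 _) (disc_zero_notMem_chart (z' : UnitDisc))
    · have h1 := isEmbedding_bubblePoint.injective (congrArg Subtype.val h)
      exact congrArg Sum.inr h1

/-- The node. -/
def node : wedge := ⟨TotalSpaceX.disc 0 0, Or.inl ⟨0, by simp, rfl⟩⟩

theorem compl_range_wedgeIncl : (range wedgeIncl)ᶜ = {node} := by
  ext x
  constructor
  · intro hx
    rcases x.2 with ⟨ζ, hζ, h⟩ | h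
    · by_cases h0 : ζ = 0
      · subst h0
        exact Subtype.ext h.symm
      · exact absurd ⟨Sum.inl ⟨⟨ζ, hζ⟩, h0⟩, Subtype.ext h⟩ hx
    · rcases bubbleE_eq_disc_or h with h | ⟨w, h⟩
      · exact Subtype.ext h
      · exact absurd ⟨Sum.inr (AffineLine.of w), Subtype.ext h.symm⟩ hx
  · rintro rfl ⟨z | w, h⟩
    · exact z.2 ((TotalSpaceX.isEmbedding_disc 0).injective (congrArg Subtype.val h))
    · have h1 : bubblePoint (AffineLine.coe w) = TotalSpaceX.disc 0 0 := congrArg Subtype.val h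
      exact disc_zero_notMem_chart 0 (h1 ▸ TotalSpaceX.chart_symm_mem 1 _)

/-- The standard node in the chart around the node. -/
def nodeMap (z : StandardNode) : wedge :=
  -- In the coordinates (z, ξ₁) at the node the disc is z = 0 and the bubble is ξ₁ = 0. The first
  -- branch of the standard node becomes the disc.
  ⟨(TotalSpaceX.chart 0).symm (z.1.2, z.1.1, 0), by
    rcases mul_eq_zero.1 z.2.2.2 with h | h
    · rw [h]
      exact Or.inr (TotalSpaceX.chart_symm_mem_bubbleE 0 _)
    · rw [h, ← disc_zero_eq_chart_symm]
      exact Or.inl ⟨_, mem_closedBall_zero_iff.2 z.2.1.le, rfl⟩⟩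

theorem isOpenEmbedding_nodeMap : IsOpenEmbedding nodeMap := by
  refine ⟨?_, ?_⟩
  · have h : IsEmbedding fun z : ℂ × ℂ => ((z.2, z.1, 0) : C3) :=
      (show Function.LeftInverse (fun y : C3 => (y.2.1, y.1)) _ from fun _ => rfl).isEmbedding
        (by fun_prop) (by fun_prop)
    have h1 : IsEmbedding fun z : StandardNode => (TotalSpaceX.chart 0).symm (z.1.2, z.1.1, 0) :=
      (isOpenEmbedding_chart_symm 0).isEmbedding.comp (h.comp IsEmbedding.subtypeVal)
    exact IsEmbedding.of_comp (continuous_induced_rng.2 (h1.continuous)) continuous_subtype_val h1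
  · have : range nodeMap = Subtype.val ⁻¹' ((TotalSpaceX.chart 0).source ∩
        TotalSpaceX.chart 0 ⁻¹' {y : C3 | ‖y.1‖ < 1 ∧ ‖y.2.1‖ < 1}) := by
      ext x
      constructor
      · rintro ⟨z, rfl⟩
        refine ⟨TotalSpaceX.chart_symm_mem 0 _, ?_⟩
        change _ ∈ {y : C3 | ‖y.1‖ < 1 ∧ ‖y.2.1‖ < 1}
        rw [nodeMap, TotalSpaceX.chart_chart_symm]
        exact ⟨z.2.2.1, z.2.1⟩
      · rintro ⟨h1, h2, h3⟩
        rcases x.2 with ⟨ζ, hζ, h⟩ | h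
        · rw [← h, disc_zero_eq_chart_symm, TotalSpaceX.chart_chart_symm] at h3
          exact ⟨StandardNode.left ζ h3, Subtype.ext ((disc_zero_eq_chart_symm ζ).symm.trans h)⟩
        · exact ⟨StandardNode.right _ h2, Subtype.ext (bubbleE_eq_of_mem_chart h h1).symm⟩
    rw [this]
    refine ((TotalSpaceX.chart 0).isOpen_inter_preimage ?_).preimage continuous_subtype_val
    exact (isOpen_lt continuous_fst.norm continuous_const).inter
      (isOpen_lt (continuous_fst.comp continuous_snd).norm continuous_const)

/-- The disc with the bubble as a nodal curve. -/
abbrev wedgeCurve : NodalCurve where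
  carrier := wedge
  reg := WedgeReg
  incl := wedgeIncl
  isOpenEmbedding_incl := isOpenEmbedding_wedgeIncl
  finite_nodes := by
    rw [compl_range_wedgeIncl]
    exact finite_singleton _
  exists_node a ha := by
    rw [compl_range_wedgeIncl] at ha
    refine ⟨nodeMap, isOpenEmbedding_nodeMap, ?_, ⟨fun z => Sum.inl (toPunctured z), ?_, ?_⟩,
      ⟨fun z => Sum.inr (AffineLine.of z⁻¹), ?_, ?_⟩⟩
    · rw [mem_singleton_iff.1 ha]
      exact Subtype.ext (disc_zero_eq_chart_symm 0).symm
    · exact ContMDiff.inl.comp_contMDiffOn (contMDiffOn_toPunctured_complex contMDiffOn_id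
        (fun z hz => hz.2.le) fun z hz => hz.1)
    · intro z hz hz0
      refine Subtype.ext ?_
      change TotalSpaceX.disc 0 (toPunctured z : UnitDisc) = _
      rw [coe_toPunctured hz0, coe_toDisc hz.le]
      exact disc_zero_eq_chart_symm z
    · refine ContMDiff.inr.comp_contMDiffOn fun z hz =>
        AffineLine.contMDiffWithinAt_complex hz ?_
      exact (contDiffAt_inv ℂ hz.1).contMDiffAt.contMDiffWithinAt
    · intro z hz hz0
      exact Subtype.ext (chart_symm_zero_eq_bubblePoint hz0).symm

/-! ### The parametrization of the nodal curve, which collapses a circle to the node -/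

theorem point_zero_mem_wedge (s : UnitDisc) : point 0 (s : ℂ) ∈ wedge := by
  rcases le_or_gt (1 / 4) (‖(s : ℂ)‖ ^ 2) with h | h
  · rw [point_eq_disc le_rfl zero_le_one (Or.inr h), zero_pow two_ne_zero]
    exact Or.inl ⟨_, mem_closedBall_zero_iff.2 (norm_radial_zero_le s), rfl⟩
  · rw [point_zero_eq_bubblePoint h]
    exact bubblePoint_mem_wedge _

open Classical in
/-- The regular part of the parametrization of the disc with the bubble. -/
def wedgeFun (s : UnitDisc) : WedgeReg :=
  if 1 / 4 < ‖(s : ℂ)‖ ^ 2 then Sum.inl (toPunctured (radial 0 s))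
  else Sum.inr (AffineLine.of (bubble s))

theorem wedgeFun_outer {s : UnitDisc} (h : 1 / 4 < ‖(s : ℂ)‖ ^ 2) :
    wedgeFun s = Sum.inl (toPunctured (radial 0 s)) := if_pos h

theorem wedgeFun_inner {s : UnitDisc} (h : ‖(s : ℂ)‖ ^ 2 < 1 / 4) :
    wedgeFun s = Sum.inr (AffineLine.of (bubble s)) := if_neg (not_lt.2 h.le)

theorem coe_toPunctured_radial {s : UnitDisc} (h : 1 / 4 < ‖(s : ℂ)‖ ^ 2) :
    ((toPunctured (radial 0 s) : UnitDisc) : ℂ) = radial 0 s := by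
  rw [coe_toPunctured (radial_zero_ne_zero h), coe_toDisc (norm_radial_zero_le s)]

theorem wedgeIncl_wedgeFun {s : UnitDisc} (h : ‖(s : ℂ)‖ ^ 2 ≠ 1 / 4) :
    (wedgeIncl (wedgeFun s) : TotalSpaceX) = point 0 s := by
  rcases h.lt_or_gt with h | h
  · rw [wedgeFun_inner h, point_zero_eq_bubblePoint h]
    rfl
  · rw [wedgeFun_outer h, point_eq_disc le_rfl zero_le_one (Or.inr h.le), zero_pow two_ne_zero]
    change TotalSpaceX.disc 0 ((toPunctured (radial 0 s) : UnitDisc) : ℂ) = _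
    rw [coe_toPunctured_radial h]

/-- The inverse of the regular part of the parametrization. -/
def wedgeInv : WedgeReg → UnitDisc :=
  Sum.elim (fun z => toDisc (radialZeroInv (z : UnitDisc)))
    fun w => toDisc (bubbleInv (AffineLine.coe w))

theorem isOpen_normSq_ne : IsOpen {s : UnitDisc | ‖(s : ℂ)‖ ^ 2 ≠ 1 / 4} :=
  isOpen_ne_fun (continuous_subtype_val.norm.pow 2) continuous_const

theorem isOpen_normSq_gt : IsOpen {s : UnitDisc | 1 / 4 < ‖(s : ℂ)‖ ^ 2} :=
  isOpen_lt continuous_const (continuous_subtype_val.norm.pow 2)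

theorem isOpen_normSq_lt : IsOpen {s : UnitDisc | ‖(s : ℂ)‖ ^ 2 < 1 / 4} :=
  isOpen_lt (continuous_subtype_val.norm.pow 2) continuous_const

theorem contMDiffOn_wedgeFun :
    ContMDiffOn realModel realModel ∞ wedgeFun {s : UnitDisc | ‖(s : ℂ)‖ ^ 2 ≠ 1 / 4} := by
  intro s hs
  refine ContMDiffAt.contMDiffWithinAt ?_
  rcases Ne.lt_or_gt hs with h | h
  · have h1 : ContMDiffWithinAt realModel realModel ∞
        (fun s : UnitDisc => AffineLine.of (bubble s)) univ s :=
      AffineLine.contMDiffWithinAt_real (mem_univ _)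
        ((contDiffAt_bubble h).contMDiffAt.comp s (contMDiff_coe_real s)).contMDiffWithinAt
    refine (ContMDiff.inr.contMDiffAt.comp s (contMDiffWithinAt_univ.1 h1)).congr_of_eventuallyEq ?_
    filter_upwards [isOpen_normSq_lt.mem_nhds h] with s' hs'
    exact wedgeFun_inner hs'
  · have h1 : ContMDiffOn realModel realModel ∞
        (fun s : UnitDisc => toPunctured (radial 0 s)) {s : UnitDisc | 1 / 4 < ‖(s : ℂ)‖ ^ 2} :=
      contMDiffOn_toPunctured_real (fun s hs =>
        ((contDiffAt_radial_zero hs).contMDiffAt.comp s (contMDiff_coe_real s)).contMDiffWithinAt)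
        (fun s _ => norm_radial_zero_le s) fun s hs => radial_zero_ne_zero hs
    have h2 := h1.contMDiffAt (isOpen_normSq_gt.mem_nhds h)
    refine (ContMDiff.inl.contMDiffAt.comp s h2).congr_of_eventuallyEq ?_
    filter_upwards [isOpen_normSq_gt.mem_nhds h] with s' hs'
    exact wedgeFun_outer hs'

theorem contMDiff_wedgeInv : ContMDiff realModel realModel ∞ wedgeInv := by
  refine ContMDiff.sumElim ?_ ?_
  · refine contMDiffOn_univ.1 (contMDiffOn_toDisc_real (fun z _ => ?_) fun z _ => ?_)
    · have h1 := (radialZeroInv_spec z.2 (UnitDisc.norm_le z)).2.2.2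
      exact ((h1.contMDiffAt).comp z (contMDiffAt_subtype_iff.2
        (contMDiff_coe_real (z : UnitDisc)))).contMDiffWithinAt
    · exact (radialZeroInv_spec z.2 (UnitDisc.norm_le z)).1
  · refine contMDiffOn_univ.1 (contMDiffOn_toDisc_real (fun w _ => ?_) fun w _ =>
      norm_bubbleInv_le _)
    exact ((bubbleInv_spec (AffineLine.coe w)).2.2.contMDiffAt.comp w
      (contMDiff_affineLine_coe_real w)).contMDiffWithinAt

theorem wedgeInv_wedgeFun {s : UnitDisc} (h : ‖(s : ℂ)‖ ^ 2 ≠ 1 / 4) :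
    wedgeInv (wedgeFun s) = s := by
  rcases h.lt_or_gt with h | h
  · rw [wedgeFun_inner h]
    change toDisc (bubbleInv (bubble s)) = s
    rw [bubbleInv_bubble h, toDisc_coe]
  · rw [wedgeFun_outer h]
    change toDisc (radialZeroInv ((toPunctured (radial 0 s) : UnitDisc) : ℂ)) = s
    rw [coe_toPunctured_radial h, radialZeroInv_radial h, toDisc_coe]

theorem norm_wedgeInv_ne (p : WedgeReg) : ‖(wedgeInv p : ℂ)‖ ^ 2 ≠ 1 / 4 := by
  rcases p with z | w
  · have h := radialZeroInv_spec z.2 (UnitDisc.norm_le z)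
    change ‖(toDisc (radialZeroInv (z : UnitDisc)) : ℂ)‖ ^ 2 ≠ 1 / 4
    rw [coe_toDisc h.1]
    exact h.2.1.ne'
  · change ‖(toDisc (bubbleInv (AffineLine.coe w)) : ℂ)‖ ^ 2 ≠ 1 / 4
    rw [coe_toDisc (norm_bubbleInv_le _)]
    exact (bubbleInv_spec _).1.ne

theorem wedgeFun_wedgeInv (p : WedgeReg) : wedgeFun (wedgeInv p) = p := by
  rcases p with z | w
  · have h := radialZeroInv_spec z.2 (UnitDisc.norm_le z)
    have hc : (wedgeInv (Sum.inl z) : ℂ) = radialZeroInv (z : UnitDisc) := coe_toDisc h.1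
    rw [wedgeFun_outer (by rw [hc]; exact h.2.1), hc, h.2.2.1, toPunctured_coe]
  · have h := bubbleInv_spec (AffineLine.coe w)
    have hc : (wedgeInv (Sum.inr w) : ℂ) = bubbleInv (AffineLine.coe w) :=
      coe_toDisc (norm_bubbleInv_le _)
    rw [wedgeFun_inner (by rw [hc]; exact h.1), hc, h.2.1]
    rfl

/-- Off the circle the point comes from the smooth part, which omits the node. On the circle both
factors vanish at τ = 0. -/
theorem point_zero_eq_node_iff (s : UnitDisc) :
    point 0 (s : ℂ) = TotalSpaceX.disc 0 0 ↔ ‖(s : ℂ)‖ ^ 2 = 1 / 4 := by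
  constructor
  · intro h
    by_contra hne
    have h1 : wedgeIncl (wedgeFun s) = node := Subtype.ext ((wedgeIncl_wedgeFun hne).trans h)
    have h2 : node ∈ (range wedgeIncl)ᶜ := by
      rw [compl_range_wedgeIncl]
      rfl
    exact h2 ⟨_, h1⟩
  · intro h
    rw [point_eq_disc le_rfl zero_le_one (Or.inr h.ge), zero_pow two_ne_zero, radial,
      scale_zero_inner h.le, zero_smul]

/-- The parametrization of the circle of radius `1 / 2`. -/
def circleMap (r : ℝ) : ℂ := (1 / 2 : ℂ) * Complex.exp (2 * Real.pi * r * Complex.I)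

theorem norm_circleMap (r : ℝ) : ‖circleMap r‖ = 1 / 2 := by
  have : (2 * Real.pi * r * Complex.I : ℂ) = ((2 * Real.pi * r : ℝ) : ℂ) * Complex.I := by
    push_cast
    ring
  rw [circleMap, norm_mul, this, Complex.norm_exp_ofReal_mul_I]
  norm_num

theorem hasDerivAt_circleMap (r : ℝ) :
    HasDerivAt circleMap (circleMap r * (2 * Real.pi * Complex.I)) r := by
  have h1 : HasDerivAt (fun r : ℝ => (2 * Real.pi * r * Complex.I : ℂ))
      (2 * Real.pi * Complex.I) r := by
    have := (((hasDerivAt_id r).ofReal_comp).const_mul (2 * Real.pi : ℂ)).mul_const Complex.I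
    simpa using this
  have h2 := (h1.cexp).const_mul (1 / 2 : ℂ)
  rw [circleMap, mul_assoc]
  exact h2

theorem contDiff_circleMap : ContDiff ℝ ∞ circleMap := by
  have h : ContDiff ℝ ∞ fun r : ℝ => (2 * Real.pi * r * Complex.I : ℂ) :=
    (contDiff_const.mul Complex.ofRealCLM.contDiff).mul contDiff_const
  exact contDiff_const.mul h.cexp

theorem circleMap_eq_iff (r r' : ℝ) : circleMap r = circleMap r' ↔ ∃ n : ℤ, r' = r + n := by
  unfold circleMap
  rw [mul_right_inj' (by norm_num), eq_comm, Complex.exp_eq_exp_iff_exists_int]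
  refine exists_congr fun n => ?_
  have hpi : (2 * Real.pi * Complex.I : ℂ) ≠ 0 := Complex.two_pi_I_ne_zero
  constructor
  · intro h
    have h1 : (2 * Real.pi * Complex.I : ℂ) * r' = (2 * Real.pi * Complex.I) * (r + n) := by
      linear_combination h
    exact_mod_cast mul_left_cancel₀ hpi h1
  · rintro rfl
    push_cast
    ring

theorem exists_circleMap_eq {z : ℂ} (h : ‖z‖ ^ 2 = 1 / 4) : ∃ r, circleMap r = z := by
  have hn : ‖z‖ = 1 / 2 := by
    have h1 : (‖z‖ - 1 / 2) * (‖z‖ + 1 / 2) = 0 := by linear_combination h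
    rcases mul_eq_zero.1 h1 with h2 | h2
    · linarith
    · linarith [norm_nonneg z]
  refine ⟨z.arg / (2 * Real.pi), ?_⟩
  have hpi : (Real.pi : ℂ) ≠ 0 := Complex.ofReal_ne_zero.2 Real.pi_ne_zero
  conv_rhs => rw [← Complex.norm_mul_exp_arg_mul_I z, hn]
  unfold circleMap
  push_cast
  congr 2
  field_simp

theorem isSmoothCircle : IsSmoothCircle UnitDisc.surface
    {s : UnitDisc | ‖(s : ℂ)‖ ^ 2 = 1 / 4} := by
  have hle : ∀ r, ‖circleMap r‖ ≤ 1 := fun r => by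
    rw [norm_circleMap]
    norm_num
  have hsm : ContMDiff 𝓘(ℝ) realModel ∞ fun r => toDisc (circleMap r) :=
    contMDiffOn_univ.1 (contMDiffOn_toDisc_real contDiff_circleMap.contMDiff.contMDiffOn
      fun r _ => hle r)
  have hcoe : (fun r => (toDisc (circleMap r) : ℂ)) = circleMap := funext fun r => coe_toDisc (hle r)
  refine ⟨fun s hs => UnitDisc.mem_interior_realModel ?_, fun r => toDisc (circleMap r), hsm,
    fun r h => ?_, fun r r' => ?_, ?_⟩
  · have h1 : ‖(s : UnitDisc).1‖ ^ 2 = 1 / 4 := hs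
    have h2 := norm_nonneg (s : UnitDisc).1
    change ‖(s : UnitDisc).1‖ < 1
    nlinarith
  -- If the differential were zero, so would be that of `circleMap`, whose derivative has modulus π.
  · have h1 := mfderiv_comp r ((contMDiff_coe_real (toDisc (circleMap r))).mdifferentiableAt
      (by simp)) ((hsm r).mdifferentiableAt (by simp))
    have h2 : ((↑) : UnitDisc → ℂ) ∘ (fun r => toDisc (circleMap r)) = circleMap := hcoe
    rw [h2, h, ContinuousLinearMap.comp_zero, mfderiv_eq_fderiv,
      (hasDerivAt_circleMap r).hasFDerivAt.fderiv] at h1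
    have h3 := congrArg (fun L : ℝ →L[ℝ] ℂ => L 1) h1
    have h4 : circleMap r * (2 * Real.pi * Complex.I) = 0 := by
      simpa using h3.trans (show _ = (0 : ℂ) from rfl)
    refine mul_ne_zero (fun h0 => ?_) Complex.two_pi_I_ne_zero h4
    have := norm_circleMap r
    rw [h0] at this
    norm_num at this
  · rw [← circleMap_eq_iff]
    constructor
    · intro h
      have := congrArg Subtype.val h
      rwa [coe_toDisc (hle r), coe_toDisc (hle r')] at this
    · intro h
      exact congrArg toDisc h
  · ext s
    constructor
    · rintro ⟨r, rfl⟩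
      change ‖(toDisc (circleMap r) : ℂ)‖ ^ 2 = 1 / 4
      rw [coe_toDisc (hle r), norm_circleMap]
      norm_num
    · intro hs
      obtain ⟨r, hr⟩ := exists_circleMap_eq hs
      exact ⟨r, (congrArg toDisc hr).trans (toDisc_coe s)⟩

/-- The parametrization of the disc with the bubble, which collapses a circle. -/
abbrev wedgeParametrization : Parametrization UnitDisc.surface wedgeCurve where
  toMap := ⟨fun s : UnitDisc => (⟨point 0 (s : ℂ), point_zero_mem_wedge s⟩ : wedge), by
    have h : Continuous fun s : UnitDisc => point 0 (s : ℂ) := by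
      simpa [Function.comp_def] using
        continuous_point.comp (Continuous.prodMk_right (0 : unitInterval))
    exact h.subtype_mk _⟩
  regular :=
    { toFun := wedgeFun
      invFun := wedgeInv
      source := {s : UnitDisc | ‖(s : ℂ)‖ ^ 2 ≠ 1 / 4}
      target := univ
      map_source' := fun _ _ => mem_univ _
      map_target' := fun p _ => norm_wedgeInv_ne p
      left_inv' := fun _ hs => wedgeInv_wedgeFun hs
      right_inv' := fun p _ => wedgeFun_wedgeInv p
      open_source := isOpen_normSq_ne
      open_target := isOpen_univ
      contMDiffOn_toFun := contMDiffOn_wedgeFun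
      contMDiffOn_invFun := contMDiff_wedgeInv.contMDiffOn }
  source_regular := by
    ext s
    have h1 := compl_range_wedgeIncl
    rw [compl_eq_comm] at h1
    change ‖(s : UnitDisc).1‖ ^ 2 ≠ 1 / 4 ↔ (⟨point 0 _, point_zero_mem_wedge s⟩ : wedge) ∈ range wedgeIncl
    rw [← h1, mem_compl_singleton_iff, Ne, Ne, ← point_zero_eq_node_iff, Subtype.ext_iff]
    rfl
  target_regular := rfl
  incl_regular _ hs := Subtype.ext (wedgeIncl_wedgeFun hs)
  circle a ha := by
    have h1 : a = node := by
      have : a ∈ (range wedgeIncl)ᶜ := ha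
      rwa [compl_range_wedgeIncl] at this
    convert isSmoothCircle using 1
    ext s
    refine Iff.trans ?_ (point_zero_eq_node_iff s)
    rw [h1]
    exact Subtype.ext_iff

theorem isCoordinateAt_wedge (p : WedgeReg) :
    IsCoordinateAt (Sum.elim (fun z : PuncturedDisc => ((z : UnitDisc) : ℂ)) AffineLine.coe) p := by
  rcases p with z | w
  · obtain ⟨φ, h1, h2, h3⟩ := UnitDisc.isCoordinateAt (z : UnitDisc)
    refine ⟨φ, h1, h2, ?_⟩
    have h4 : ∀ᶠ q : PuncturedDisc in 𝓝 (z : PuncturedDisc),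
        (chartAt ClosedHalfPlane (z : UnitDisc) (q : UnitDisc) : ℂ) =
        φ (q : UnitDisc) := continuous_subtype_val.continuousAt.eventually h3
    rw [← (IsOpenEmbedding.inl (X := PuncturedDisc) (Y := AffineLine)).map_nhds_eq,
      eventually_map]
    filter_upwards [h4] with q hq
    refine Eq.trans ?_ hq
    exact congrArg Subtype.val (sum_chartAt_inl_apply (x := z) (y := q))
  · obtain ⟨φ, h1, h2, h3⟩ := AffineLine.isCoordinateAt w
    refine ⟨φ, h1, h2, ?_⟩
    rw [← (IsOpenEmbedding.inr (X := PuncturedDisc) (Y := AffineLine)).map_nhds_eq,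
      eventually_map]
    filter_upwards [h3] with q hq
    refine Eq.trans ?_ hq
    exact congrArg Subtype.val (sum_chartAt_inr_apply (x := w) (y := q))

theorem boundary_wedgeReg : complexModel.boundary WedgeReg =
    Sum.inl '' {z : PuncturedDisc | ‖((z : UnitDisc) : ℂ)‖ = 1} := by
  rw [ModelWithCorners.boundary_disjointUnion]
  have h1 : complexModel.boundary AffineLine = ∅ := by
    refine eq_empty_of_forall_notMem fun w hw => ?_
    rw [mem_boundary_complexModel_iff] at hw
    exact (AffineLine.chartAt_im_pos w).ne' hw
  have h2 : complexModel.boundary PuncturedDisc =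
      {z : PuncturedDisc | ‖((z : UnitDisc) : ℂ)‖ = 1} := by
    ext z
    rw [mem_boundary_complexModel_iff]
    exact UnitDisc.chartAt_im_eq_zero_iff (z : UnitDisc)
  rw [h1, h2, image_empty, union_empty]

theorem contMDiff_bubblePoint : ContMDiff 𝓘(ℂ) 𝓘(ℂ, C3) ω bubblePoint := by
  have h : ContDiff ℂ ω fun w : ℂ => ((w, 0, 0) : C3) := contDiff_id.prodMk contDiff_const
  exact (TotalSpaceX.contMDiff_chart_symm 1).comp h.contMDiff

/-- The curve is the subset `wedge` itself and the map its inclusion, so every requirement splits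
into the two pieces of the smooth part and the one node. -/
theorem nonempty_fiber_zero : Nonempty (Fiber 0) := by
  refine ⟨{
    C := wedgeCurve
    u := ⟨Subtype.val, continuous_subtype_val⟩
    P := wedgeParametrization
    isHolomorphic := fun p _ => ?_
    injective := Subtype.val_injective
    image_boundary := ?_
    toMap_surjective := fun x => ?_
    map_toMap := fun s => ?_
    mem_source := fun s => (or_iff_right (by simp)).symm
    κ := Sum.elim (fun z : PuncturedDisc => ((z : UnitDisc) : ℂ)) AffineLine.coe
    isCoordinateAt := isCoordinateAt_wedge
    coordinate_radial := fun s hs => ?_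
    coordinate_bubble := fun _ s hs => ?_
    nodes_of_pos := fun h => absurd h (lt_irrefl _)
    range_of_pos := fun h => absurd h (lt_irrefl _)
    nodes_zero := fun _ => ⟨node, compl_range_wedgeIncl, rfl⟩
    range_zero := fun _ => Subtype.range_val }⟩
  · have h : ContMDiff complexModel 𝓘(ℂ, C3) ω (Sum.elim
        (fun z : PuncturedDisc => TotalSpaceX.disc 0 (z : UnitDisc))
        fun w : AffineLine => bubblePoint (AffineLine.coe w)) := by
      refine ContMDiff.sumElim ?_ ?_
      · exact ((TotalSpaceX.contMDiff_disc 0).comp UnitDisc.contMDiff_coe).comp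
          contMDiff_subtype_val
      · exact contMDiff_bubblePoint.comp AffineLine.contMDiff_coe
    refine (h p).congr_of_eventuallyEq (Eventually.of_forall fun q => ?_)
    rcases q with z | w <;> rfl
  · change Subtype.val '' (wedgeIncl '' complexModel.boundary WedgeReg) = _
    rw [boundary_wedgeReg]
    ext x
    constructor
    · rintro ⟨_, ⟨_, ⟨z, hz, rfl⟩, rfl⟩, rfl⟩
      exact ⟨(z : UnitDisc), mem_sphere_zero_iff_norm.2 hz, rfl⟩
    · rintro ⟨ζ, hζ, rfl⟩
      have hζ' := mem_sphere_zero_iff_norm.1 hζ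
      have h0 : ζ ≠ 0 := by
        rintro rfl
        simp at hζ'
      exact ⟨_, ⟨_, ⟨⟨⟨ζ, mem_closedBall_zero_iff.2 hζ'.le⟩, h0⟩, hζ', rfl⟩, rfl⟩, rfl⟩
  · by_cases hx : x ∈ range wedgeIncl
    · obtain ⟨p, rfl⟩ := hx
      refine ⟨wedgeInv p, Subtype.ext ?_⟩
      have := wedgeIncl_wedgeFun (norm_wedgeInv_ne p)
      rw [wedgeFun_wedgeInv] at this
      exact this.symm
    · have h1 : x ∈ (range wedgeIncl)ᶜ := hx
      rw [compl_range_wedgeIncl, mem_singleton_iff] at h1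
      subst h1
      -- The node is the image of any point of the collapsed circle.
      let s : UnitDisc := ⟨1 / 2, by simp; norm_num⟩
      exact ⟨s, Subtype.ext ((point_zero_eq_node_iff s).2 (by norm_num [s]))⟩
  · change point 0 (s : ℂ) = _
    simp
  · have h : 1 / 4 < ‖(s : ℂ)‖ ^ 2 := hs.resolve_left (by simp)
    change Sum.elim _ _ (wedgeFun s) = _
    rw [wedgeFun_outer h]
    simpa using coe_toPunctured_radial h
  · change Sum.elim _ _ (wedgeFun s) = _
    rw [wedgeFun_inner hs]
    rfl

theorem nonempty_fiber (t : unitInterval) : Nonempty (Fiber t) := by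
  rcases eq_or_ne t 0 with rfl | h
  · exact nonempty_fiber_zero
  · exact nonempty_fiber_of_pos (unitInterval.pos_iff_ne_zero.2 h)

end Neck

/-! ### Gromov continuity of the family -/

namespace Neck

theorem extChartAt_target_eq_range (s : UnitDisc) :
    (extChartAt realModel s).target = range realModel := by
  have h : (chartAt ClosedHalfPlane s).target = univ := rfl
  rw [extChartAt_target, h, preimage_univ, univ_inter]

theorem hasDerivAt_cayleyInv {u w : ℂ} (hw : w + Complex.I ≠ 0) :
    HasDerivAt (UnitDisc.cayleyInv u) (2 * Complex.I * u / (w + Complex.I) ^ 2) w := by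
  have h := (((hasDerivAt_id w).sub_const Complex.I).const_mul u).div
    ((hasDerivAt_id w).add_const Complex.I) hw
  refine h.congr_deriv ?_
  congr 1
  simp only [id]
  ring

theorem fderiv_cayleyInv {u w : ℂ} (hu : u ≠ 0) (hw : w + Complex.I ≠ 0) :
    (fderiv ℝ (UnitDisc.cayleyInv u) w).IsInvertible := by
  have hc : 2 * Complex.I * u / (w + Complex.I) ^ 2 ≠ 0 :=
    div_ne_zero (mul_ne_zero (mul_ne_zero two_ne_zero Complex.I_ne_zero) hu) (pow_ne_zero 2 hw)
  refine ⟨mulEquiv _ hc, ?_⟩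
  have h := (hasDerivAt_cayleyInv (u := u) hw).hasFDerivAt.restrictScalars ℝ
  rw [h.fderiv]
  ext v
  simp only [mulEquiv_apply, ContinuousLinearEquiv.coe_coe,
    ContinuousLinearMap.coe_restrictScalars', ContinuousLinearMap.toSpanSingleton_apply,
    smul_eq_mul]
  exact mul_comm _ _

theorem contDiffAt_cayleyInv_real {u w : ℂ} (hw : w + Complex.I ≠ 0) :
    ContDiffAt ℝ ∞ (UnitDisc.cayleyInv u) w :=
  ((UnitDisc.contDiffAt_cayleyInv hw).restrict_scalars ℝ).of_le le_top

/-- The points whose modulus lies in `Q`, in the coordinates of a chart of the disc and with the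
parameter as first coordinate. -/
def chartLocus (u : ℂ) (Q : Set (ℝ × ℝ)) : Set (ℝ × ℂ) :=
  {p | p.2 + Complex.I ≠ 0 ∧ (p.1, ‖UnitDisc.cayleyInv u p.2‖ ^ 2) ∈ Q}

theorem contDiffAt_cayleyInv_snd {u : ℂ} {p : ℝ × ℂ} (hp : p.2 + Complex.I ≠ 0) :
    ContDiffAt ℝ ∞ (fun p : ℝ × ℂ => UnitDisc.cayleyInv u p.2) p :=
  (contDiffAt_cayleyInv_real hp).comp p contDiffAt_snd

theorem contDiffAt_normSq_cayleyInv {u : ℂ} {p : ℝ × ℂ} (hp : p.2 + Complex.I ≠ 0) :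
    ContDiffAt ℝ ∞ (fun p : ℝ × ℂ => (p.1, ‖UnitDisc.cayleyInv u p.2‖ ^ 2)) p :=
  contDiffAt_fst.prodMk ((contDiff_norm_sq ℝ).contDiffAt.comp p (contDiffAt_cayleyInv_snd hp))

theorem isOpen_chartLocus (u : ℂ) {Q : Set (ℝ × ℝ)} (hQ : IsOpen Q) :
    IsOpen (chartLocus u Q) := by
  have h1 : IsOpen {p : ℝ × ℂ | p.2 + Complex.I ≠ 0} :=
    isOpen_ne_fun (continuous_snd.add continuous_const) continuous_const
  have h2 : ContinuousOn (fun p : ℝ × ℂ => (p.1, ‖UnitDisc.cayleyInv u p.2‖ ^ 2))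
      {p : ℝ × ℂ | p.2 + Complex.I ≠ 0} := fun p hp =>
    (contDiffAt_normSq_cayleyInv hp).continuousAt.continuousWithinAt
  exact h2.isOpen_inter_preimage h1 hQ

theorem contDiffOn_comp_chartLocus {u : ℂ} {Q : Set (ℝ × ℝ)} {q : ℝ × ℝ → ℝ}
    (hq : ∀ p ∈ Q, ContDiffAt ℝ ∞ q p) :
    ContDiffOn ℝ ∞ (fun p : ℝ × ℂ => q (p.1, ‖UnitDisc.cayleyInv u p.2‖ ^ 2)) (chartLocus u Q) :=
  fun p hp => ((hq _ hp.2).comp p (contDiffAt_normSq_cayleyInv hp.1)).contDiffWithinAt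

theorem mem_chartLocus {u y : ℂ} {τ : ℝ} {Q : Set (ℝ × ℝ)} (hy : y ∈ range realModel)
    (h : (τ, ‖UnitDisc.cayleyInv u y‖ ^ 2) ∈ Q) : (τ, y) ∈ chartLocus u Q := by
  rw [range_realModel] at hy
  exact ⟨UnitDisc.add_I_ne_zero hy, h⟩

theorem coe_symm_of_mem_range {s : UnitDisc} {y : ℂ} (hy : y ∈ range realModel) :
    ((extChartAt realModel s).symm y : ℂ) = UnitDisc.cayleyInv (UnitDisc.pole s) y := by
  rw [range_realModel] at hy
  exact UnitDisc.coe_extChartAt_symm s hy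

theorem extChartAt_image_subset (s : UnitDisc) (K : Set UnitDisc) :
    extChartAt realModel s '' K ⊆ range realModel := by
  rintro _ ⟨x, -, rfl⟩
  exact mem_range_self _

theorem isCompact_extChartAt_image {s : UnitDisc} {K : Set UnitDisc} (hK : IsCompact K)
    (hKs : K ⊆ (chartAt ClosedHalfPlane s).source) : IsCompact (extChartAt realModel s '' K) :=
  hK.image_of_continuousOn ((continuousOn_extChartAt s).mono (by rwa [extChartAt_source]))

/-- A family of pulled back structures in the coordinates of a chart, when the coordinate of the
curve is a radial function times a constant. -/
theorem exists_smooth_complexStructure (F : ∀ t, Fiber t) {q : ℝ × ℝ → ℝ} {Q : Set (ℝ × ℝ)}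
    (hQ : IsOpen Q) (hq : ∀ p ∈ Q, ContDiffAt ℝ ∞ q p)
    (hF : ∀ t : unitInterval, ∃ c : ℂ, c ≠ 0 ∧ ∀ s : UnitDisc, (√(t : ℝ), ‖(s : ℂ)‖ ^ 2) ∈ Q →
      s ∈ (F t).P.regular.source ∧
        (F t).κ ((F t).P.regular s) = c * (q (√(t : ℝ), ‖(s : ℂ)‖ ^ 2) • (s : ℂ)))
    (s : UnitDisc) {t₀ : unitInterval} {y : ℂ} (hy : y ∈ range realModel)
    (hyQ : (√(t₀ : ℝ), ‖UnitDisc.cayleyInv (UnitDisc.pole s) y‖ ^ 2) ∈ Q)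
    (hinv : (fderiv ℝ (fun s : ℂ => q (√(t₀ : ℝ), ‖s‖ ^ 2) • s)
      (UnitDisc.cayleyInv (UnitDisc.pole s) y)).IsInvertible) :
    ∃ (H : ℝ × ℂ → ℂ →L[ℝ] ℂ) (O : Set (ℝ × ℂ)), IsOpen O ∧ (√(t₀ : ℝ), y) ∈ O ∧
      ContDiffOn ℝ ∞ H O ∧ ∀ t : unitInterval, ∀ y' ∈ range realModel, (√(t : ℝ), y') ∈ O →
        (F t).P.complexStructure s y' = H (√(t : ℝ), y') := by
  set u := UnitDisc.pole s
  set K : ℝ × ℂ → ℂ := fun p =>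
    q (p.1, ‖UnitDisc.cayleyInv u p.2‖ ^ 2) • UnitDisc.cayleyInv u p.2
  have hO := isOpen_chartLocus u hQ
  have hK : ContDiffOn ℝ ∞ K (chartLocus u Q) := (contDiffOn_comp_chartLocus hq).smul
    fun p hp => (contDiffAt_cayleyInv_snd hp.1).contDiffWithinAt
  -- The derivative of K in the disc variable alone, still smooth in both variables.
  set G : ℝ × ℂ → ℂ →L[ℝ] ℂ := fun p => (fderiv ℝ K p).comp (ContinuousLinearMap.inr ℝ ℝ ℂ)
  have hG : ContDiffOn ℝ ∞ G (chartLocus u Q) :=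
    (hK.fderiv_of_isOpen hO (m := ∞) (by simp)).clm_comp contDiffOn_const
  have hslice : ∀ {τ : ℝ} {y : ℂ}, (τ, y) ∈ chartLocus u Q →
      HasFDerivAt (fun y => K (τ, y)) (G (τ, y)) y := fun {τ y} h =>
    (((hK.contDiffAt (hO.mem_nhds h)).differentiableAt (by simp)).hasFDerivAt).comp y
      (hasFDerivAt_prodMk_right τ y)
  have hy0 : (√(t₀ : ℝ), y) ∈ chartLocus u Q := mem_chartLocus hy hyQ
  -- Invertibility is an open condition on G, and `pullbackStructure` is smooth at invertible maps.
  refine ⟨fun p => pullbackStructure (G p), chartLocus u Q ∩ G ⁻¹' {B | B.IsInvertible},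
    hG.continuousOn.isOpen_inter_preimage hO isOpen_setOf_isInvertible, ⟨hy0, ?_⟩, ?_, ?_⟩
  · change (G (√(t₀ : ℝ), y)).IsInvertible
    have h1 : DifferentiableAt ℝ (UnitDisc.cayleyInv u) y :=
      (contDiffAt_cayleyInv_real hy0.1).differentiableAt (by simp)
    have h2 : DifferentiableAt ℝ (fun s : ℂ => q (√(t₀ : ℝ), ‖s‖ ^ 2) • s)
        (UnitDisc.cayleyInv u y) := by
      have h3 : ContDiffAt ℝ ∞ (fun s : ℂ => (√(t₀ : ℝ), ‖s‖ ^ 2)) (UnitDisc.cayleyInv u y) :=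
        contDiffAt_const.prodMk (contDiff_norm_sq ℝ).contDiffAt
      exact (((hq _ hyQ).comp (UnitDisc.cayleyInv u y) h3).smul contDiffAt_id).differentiableAt
        (by simp)
    have h4 := (h2.hasFDerivAt.comp y h1.hasFDerivAt).unique (hslice hy0)
    rw [← h4]
    exact hinv.comp (fderiv_cayleyInv (UnitDisc.pole_ne_zero s) hy0.1)
  · intro p hp
    exact (contDiffAt_pullbackStructure hp.2).comp_contDiffWithinAt p
      ((hG p hp.1).mono inter_subset_left)
  · rintro t y' hy' ⟨hyO, -⟩
    obtain ⟨c, hc, hcs⟩ := hF t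
    have hsQ : ∀ {y : ℂ}, y ∈ range realModel → (√(t : ℝ), y) ∈ chartLocus u Q →
        (√(t : ℝ), ‖((extChartAt realModel s).symm y : ℂ)‖ ^ 2) ∈ Q := fun hy h => by
      rw [coe_symm_of_mem_range hy]
      exact h.2
    have hd := hslice hyO
    have hd' : HasFDerivAt (fun y => c * K (√(t : ℝ), y))
        ((mulEquiv c hc : ℂ →L[ℝ] ℂ).comp (G (√(t : ℝ), y'))) y' :=
      ((mulEquiv c hc : ℂ →L[ℝ] ℂ).hasFDerivAt).comp y' hd
    -- The constant c, which may depend on t in any manner, drops out here.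
    rw [(F t).P.complexStructure_eq (s := s) (by rwa [extChartAt_target_eq_range])
      (hcs _ (hsQ hy' hyO)).1 ((F t).isCoordinateAt _) hd'.differentiableAt ?_, hd'.fderiv,
      pullbackStructure_mulEquiv_comp]
    have hev : ∀ᶠ y in 𝓝 y', (√(t : ℝ), y) ∈ chartLocus u Q :=
      (hO.preimage (continuous_const.prodMk continuous_id)).mem_nhds hyO
    filter_upwards [nhdsWithin_le_nhds hev, self_mem_nhdsWithin] with y h1 h2
    rw [(hcs _ (hsQ h2 h1)).2, coe_symm_of_mem_range h2]

theorem isInvertible_fderiv_radial {τ : ℝ} (h0 : 0 ≤ τ) (h1 : τ ≤ 1) {s : ℂ}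
    (h : τ ≠ 0 ∨ 1 / 4 < ‖s‖ ^ 2) :
    (fderiv ℝ (fun s : ℂ => scale τ (‖s‖ ^ 2) • s) s).IsInvertible := by
  rcases h0.eq_or_lt with rfl | hτ
  · refine isInvertible_fderiv_smul_radial (I := Ioi (1 / 4)) isOpen_Ioi (fun x hx => ?_)
      (fun x hx x' hx' hle => ?_) (fun x hx => ?_) (h.resolve_left (by simp))
    · rw [scale_zero_outer (le_of_lt hx)]
      exact outer_pos hx
    · rw [scale_zero_outer (le_of_lt hx), scale_zero_outer (le_of_lt hx')]
      exact monotone_outer hle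
    · refine contDiff_outer.contDiffWithinAt.congr (fun x' hx' => ?_) ?_
      · exact scale_zero_outer (le_of_lt hx')
      · exact scale_zero_outer (le_of_lt hx)
  · exact isInvertible_fderiv_smul_radial isOpen_univ (fun x _ => scale_pos hτ h1)
      ((monotone_scale hτ h1).monotoneOn _) (contDiff_scale hτ h1).contDiffOn (mem_univ _)

theorem isInvertible_fderiv_bubble {s : ℂ} (h : ‖s‖ ^ 2 < 1 / 4) :
    (fderiv ℝ (fun s : ℂ => (innerRaised 0 (‖s‖ ^ 2))⁻¹ • s) s).IsInvertible := by
  have he : innerRaised 0 = inner := funext fun x => by simp [innerRaised]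
  rw [he]
  exact isInvertible_fderiv_smul_radial (q := fun x => (inner x)⁻¹) isOpen_Iio
    (fun x hx => inv_pos.2 (inner_pos hx)) monotoneOn_inv_inner
    (contDiff_inner.contDiffOn.inv fun x hx => (inner_pos hx).ne') h

theorem sqrt_mem_Icc (t : unitInterval) : 0 ≤ √(t : ℝ) ∧ √(t : ℝ) ≤ 1 :=
  ⟨Real.sqrt_nonneg _, Real.sqrt_le_one.2 t.2.2⟩

theorem sqrt_ne_zero_iff (t : unitInterval) : √(t : ℝ) ≠ 0 ↔ t ≠ 0 := by
  rw [Ne, Real.sqrt_eq_zero t.2.1, Ne, not_iff_not]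
  exact Set.Icc.coe_eq_zero

theorem tendsto_sqrt (t₀ : unitInterval) :
    Tendsto (fun t : unitInterval => √(t : ℝ)) (𝓝 t₀) (𝓝 √(t₀ : ℝ)) :=
  (Real.continuous_sqrt.comp continuous_subtype_val).continuousAt

/-- The complex structures of the family are given, locally, by a smooth function of the
parameter and the point. -/
theorem exists_smooth_complexStructure_of_mem (F : ∀ t, Fiber t) (s : UnitDisc)
    {t₀ : unitInterval} {y : ℂ} (hy : y ∈ range realModel)
    (hs : t₀ ≠ 0 ∨ ‖UnitDisc.cayleyInv (UnitDisc.pole s) y‖ ^ 2 ≠ 1 / 4) :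
    ∃ (H : ℝ × ℂ → ℂ →L[ℝ] ℂ) (O : Set (ℝ × ℂ)), IsOpen O ∧ (√(t₀ : ℝ), y) ∈ O ∧
      ContDiffOn ℝ ∞ H O ∧ ∀ t : unitInterval, ∀ y' ∈ range realModel, (√(t : ℝ), y') ∈ O →
        (F t).P.complexStructure s y' = H (√(t : ℝ), y') := by
  -- In the first case the radial map is a good coordinate near the given pair. In the second it
  -- tends to the constant 0 as t → 0 and has to be rescaled.
  by_cases h : t₀ ≠ 0 ∨ 1 / 4 < ‖UnitDisc.cayleyInv (UnitDisc.pole s) y‖ ^ 2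
  · have h' := h
    rw [← sqrt_ne_zero_iff] at h'
    -- The second set in Q excludes the pairs with τ = 0 inside the circle, where the coordinate is
    -- `bubble` and not `radial`.
    refine exists_smooth_complexStructure F (q := fun p => scale p.1 p.2)
      (Q := smoothLocus ∩ ({p | p.1 ≠ 0} ∪ {p | 1 / 4 < p.2})) ?_ ?_ ?_ s hy ⟨?_, ?_⟩ ?_
    · exact isOpen_smoothLocus.inter ((isOpen_ne_fun continuous_fst continuous_const).union
        (isOpen_lt continuous_const continuous_snd))
    · exact fun p hp => contDiffAt_scale hp.1
    · refine fun t => ⟨1, one_ne_zero, fun s hs => ?_⟩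
      have h1 : t ≠ 0 ∨ 1 / 4 < ‖(s : ℂ)‖ ^ 2 := by
        rw [← sqrt_ne_zero_iff]
        exact hs.2
      exact ⟨((F t).mem_source s).2 (h1.imp_right fun h => h.ne'),
        ((F t).coordinate_radial s h1).trans (one_mul _).symm⟩
    · exact mem_smoothLocus (sqrt_mem_Icc t₀).1 (sqrt_mem_Icc t₀).2 (h'.imp_right fun h => h.ne')
    · exact h'
    · exact isInvertible_fderiv_radial (sqrt_mem_Icc t₀).1 (sqrt_mem_Icc t₀).2 h'
  · push Not at h
    obtain ⟨rfl, hle⟩ := h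
    have hlt := lt_of_le_of_ne hle (hs.resolve_left (by simp))
    refine exists_smooth_complexStructure F (q := fun p => (innerRaised p.1 p.2)⁻¹)
      (Q := {p | p.2 < 1 / 4} ∩ {p | 0 < innerRaised p.1 p.2}) ?_ ?_ ?_ s hy ⟨hlt, ?_⟩ ?_
    · exact (isOpen_lt continuous_snd continuous_const).inter
        (isOpen_lt continuous_const contDiff_innerRaised.continuous)
    · exact fun p hp => contDiff_innerRaised.contDiffAt.inv (ne_of_gt hp.2)
    · intro t
      by_cases ht : t = 0
      · refine ⟨1, one_ne_zero, fun s hs => ⟨((F t).mem_source s).2 (Or.inr (ne_of_lt hs.1)), ?_⟩⟩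
        rw [(F t).coordinate_bubble ht s hs.1, one_mul, ht]
        simp [bubble, innerRaised]
      -- For t > 0 the radial map inside the circle is τ² · s / innerRaised; the degenerating factor
      -- τ² is taken as the constant.
      · refine ⟨((√(t : ℝ) : ℂ)) ^ 2, pow_ne_zero 2
          (Complex.ofReal_ne_zero.2 ((sqrt_ne_zero_iff t).2 ht)),
          fun s hs => ⟨((F t).mem_source s).2 (Or.inl ht), ?_⟩⟩
        rw [(F t).coordinate_radial s (Or.inl ht), radial, scale_inner hs.1]
        simp only [Complex.real_smul]
        push_cast
        ring
    · change 0 < innerRaised √((0 : unitInterval) : ℝ) _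
      exact innerRaised_pos (sqrt_mem_Icc 0).1 hlt
    · simpa using isInvertible_fderiv_bubble hlt

/-- The maps of the family are given, locally, by a smooth function of the parameter and the
point. -/
theorem exists_smooth_chart (s : UnitDisc) {t₀ : unitInterval} {y : ℂ} (hy : y ∈ range realModel)
    (hs : t₀ ≠ 0 ∨ ‖UnitDisc.cayleyInv (UnitDisc.pole s) y‖ ^ 2 ≠ 1 / 4) {j : Fin 2}
    (hj : point √(t₀ : ℝ) (UnitDisc.cayleyInv (UnitDisc.pole s) y) ∈
      (TotalSpaceX.chart j).source) :
    ∃ O : Set (ℝ × ℂ), IsOpen O ∧ (√(t₀ : ℝ), y) ∈ O ∧ ContDiffOn ℝ ∞ (fun p : ℝ × ℂ =>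
      TotalSpaceX.chart j (point p.1 (UnitDisc.cayleyInv (UnitDisc.pole s) p.2))) O := by
  set u := UnitDisc.pole s
  set v : ℝ × ℂ → Fin 2 → ℂ := fun p => ![UnitDisc.cayleyInv u p.2,
    (coscale p.1 (‖UnitDisc.cayleyInv u p.2‖ ^ 2) : ℂ)]
  have hO := isOpen_chartLocus u isOpen_smoothLocus
  have hscale : ContDiffOn ℝ ∞ (fun p : ℝ × ℂ =>
      (scale p.1 (‖UnitDisc.cayleyInv u p.2‖ ^ 2) : ℂ)) (chartLocus u smoothLocus) :=
    Complex.ofRealCLM.contDiff.comp_contDiffOn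
      (contDiffOn_comp_chartLocus fun p hp => contDiffAt_scale hp)
  have hv : ∀ i, ContDiffOn ℝ ∞ (fun p => v p i) (chartLocus u smoothLocus) := by
    intro i
    fin_cases i
    · exact fun p hp => (contDiffAt_cayleyInv_snd hp.1).contDiffWithinAt
    · exact Complex.ofRealCLM.contDiff.comp_contDiffOn
        (contDiffOn_comp_chartLocus fun p hp => contDiffAt_coscale hp)
  -- The map in the chart is rational in v and `scale`, and its only denominator is the j-th entry
  -- of v.
  refine ⟨chartLocus u smoothLocus ∩ (fun p => v p j) ⁻¹' {0}ᶜ,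
    (hv j).continuousOn.isOpen_inter_preimage hO isOpen_compl_singleton,
    ⟨mem_chartLocus hy ?_, ?_⟩, ?_⟩
  · rw [← sqrt_ne_zero_iff] at hs
    exact mem_smoothLocus (sqrt_mem_Icc t₀).1 (sqrt_mem_Icc t₀).2 hs
  · exact TotalSpaceX.ne_zero_of_ofVec_mem_chart_source
      (pointVec_ne_zero (sqrt_mem_Icc t₀).1 _) hj
  · have hne : ∀ p ∈ chartLocus u smoothLocus ∩ (fun p => v p j) ⁻¹' {0}ᶜ, v p j ≠ 0 :=
      fun p hp => hp.2
    have h1 : ContDiffOn ℝ ∞ (fun p : ℝ × ℂ => ((v p (1 - j) * (v p j)⁻¹,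
        (scale p.1 (‖UnitDisc.cayleyInv u p.2‖ ^ 2) : ℂ) * v p j, 0 * v p j) : C3))
        (chartLocus u smoothLocus ∩ (fun p => v p j) ⁻¹' {0}ᶜ) := by
      have hvj := (hv j).mono (inter_subset_left (t := (fun p => v p j) ⁻¹' {0}ᶜ))
      have hvj' := (hv (1 - j)).mono (inter_subset_left (t := (fun p => v p j) ⁻¹' {0}ᶜ))
      exact (hvj'.mul (hvj.inv hne)).prodMk
        (((hscale.mono inter_subset_left).mul hvj).prodMk (contDiffOn_const.mul hvj))
    exact h1.congr fun p hp => by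
      rw [← div_eq_mul_inv]
      exact TotalSpaceX.chart_ofVec (hne p hp) _ _

/-- The maps and the complex structures depend on t only through τ = √t, locally by functions smooth
in τ and the point off the collapsed circle. As √t is continuous at 0 as well, the smooth
convergences follow from one criterion. -/
theorem gromovTendsto_fiber (F : ∀ t, Fiber t) (t₀ : unitInterval) :
    GromovTendsto C3 (𝓝 t₀) (fun t => (F t).u) (fun t => (F t).P) (F t₀).u (F t₀).P where
  uniform := by
    let G : C(unitInterval × UnitDisc, TotalSpaceX) := ⟨_, continuous_point⟩
    have h1 : Tendsto (fun t => G.curry t) (𝓝 t₀) (𝓝 (G.curry t₀)) := G.curry.continuous.continuousAt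
    have h2 : ∀ t, (F t).u.comp (F t).P.toMap = G.curry t := fun t =>
      ContinuousMap.ext fun s => (F t).map_toMap s
    simp only [h2]
    exact h1
  smooth s m K hK hKsrc hKs hKm := by
    obtain ⟨j, hj⟩ := TotalSpaceX.exists_chartAt_eq m
    have hext : ∀ x, extChartAt 𝓘(ℝ, C3) m x = TotalSpaceX.chart j x := fun x => by
      rw [← hj]
      rfl
    have hval : ∀ t : unitInterval, ∀ y ∈ range realModel,
        extChartAt 𝓘(ℝ, C3) m ((F t).u ((F t).P.toMap ((extChartAt realModel s).symm y))) =
          TotalSpaceX.chart j (point √(t : ℝ) (UnitDisc.cayleyInv (UnitDisc.pole s) y)) := by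
      intro t y hy
      rw [hext, (F t).map_toMap, coe_symm_of_mem_range hy]
    refine smoothTendstoOn_of_locally_contDiffOn (isCompact_extChartAt_image hK hKs)
      (extChartAt_image_subset s K) (tendsto_sqrt t₀) ?_
    rintro _ ⟨x, hx, rfl⟩
    have hr : extChartAt realModel s x ∈ range realModel := mem_range_self _
    have hx' : UnitDisc.cayleyInv (UnitDisc.pole s) (extChartAt realModel s x) = x := by
      rw [← coe_symm_of_mem_range hr, (extChartAt realModel s).left_inv]
      rw [extChartAt_source]
      exact hKs hx
    obtain ⟨O, hO, hyO, hH⟩ := exists_smooth_chart (t₀ := t₀) s hr (j := j)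
      (by rw [hx']; exact ((F t₀).mem_source x).1 (hKsrc hx))
      (by
        rw [hx', ← (F t₀).map_toMap, ← hj]
        exact hKm hx)
    exact ⟨_, O, hO, hyO, hH, fun t y hy _ => hval t y hy, fun y hy _ => hval t₀ y hy⟩
  avoids_nodes K hK hKsrc := by
    by_cases h : t₀ = 0
    · refine Eventually.of_forall fun t s hs => ((F t).mem_source s).2 (Or.inr ?_)
      exact (((F t₀).mem_source s).1 (hKsrc hs)).resolve_left (by simpa using h)
    · filter_upwards [isOpen_ne.mem_nhds h] with t ht s _
      exact ((F t).mem_source s).2 (Or.inl ht)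
  structures s K hK hKsrc hKs := by
    refine smoothTendstoOn_of_locally_contDiffOn (isCompact_extChartAt_image hK hKs)
      (extChartAt_image_subset s K) (tendsto_sqrt t₀) ?_
    rintro _ ⟨x, hx, rfl⟩
    have hr : extChartAt realModel s x ∈ range realModel := mem_range_self _
    have hx' : UnitDisc.cayleyInv (UnitDisc.pole s) (extChartAt realModel s x) = x := by
      rw [← coe_symm_of_mem_range hr, (extChartAt realModel s).left_inv]
      rw [extChartAt_source]
      exact hKs hx
    obtain ⟨H, O, hO, hyO, hH, hF⟩ := exists_smooth_complexStructure_of_mem F (t₀ := t₀) s hr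
      (by rw [hx']; exact ((F t₀).mem_source x).1 (hKsrc hx))
    exact ⟨H, O, hO, hyO, hH, hF, hF t₀⟩
  constant_near_boundary := by
    have hsrc : ∀ t, {s : UnitDisc | 3 / 8 < ‖(s : ℂ)‖ ^ 2} ⊆ (F t).P.regular.source :=
      fun t s hs => ((F t).mem_source s).2 (Or.inr (by
        have : 3 / 8 < ‖(s : ℂ)‖ ^ 2 := hs
        linarith))
    have hW : IsOpen {s : UnitDisc | 3 / 8 < ‖(s : ℂ)‖ ^ 2} :=
      isOpen_lt continuous_const (continuous_subtype_val.norm.pow 2)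
    refine ⟨{s : UnitDisc | 3 / 8 < ‖(s : ℂ)‖ ^ 2}, hW, fun s hs => ?_, hsrc t₀,
      fun t => ⟨hsrc t, ?_⟩⟩
    · rw [UnitDisc.mem_boundary_realModel] at hs
      change 3 / 8 < ‖(s : UnitDisc).1‖ ^ 2
      rw [hs]
      norm_num
    · rintro s x ⟨hxW, hxs⟩
      have hr : extChartAt realModel s x ∈ range realModel := mem_range_self _
      have hxs' : x ∈ (extChartAt realModel s).source := by rwa [extChartAt_source]
      have hx' : (extChartAt realModel s).symm (extChartAt realModel s x) = x :=
        (extChartAt realModel s).left_inv hxs'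
      -- For |s|² > 3/8 the radial map is the identity for all t, so the structure is that of the
      -- disc itself, expressed without t.
      have key : ∀ t, (F t).P.complexStructure s (extChartAt realModel s x) = pullbackStructure
          (fderiv ℝ (UnitDisc.cayleyInv (UnitDisc.pole s)) (extChartAt realModel s x)) := by
        intro t
        refine (F t).P.complexStructure_eq (by rwa [extChartAt_target_eq_range])
          (by rw [hx']; exact hsrc t hxW) ((F t).isCoordinateAt _)
          ((contDiffAt_cayleyInv_real ?_).differentiableAt (by simp)) ?_
        · rw [range_realModel] at hr
          exact UnitDisc.add_I_ne_zero hr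
        · have hc : ContinuousWithinAt (extChartAt realModel s).symm (range realModel)
              (extChartAt realModel s x) := by
            have := continuousOn_extChartAt_symm (I := realModel) s
            rw [extChartAt_target_eq_range] at this
            exact this _ hr
          have hev := hc.eventually (by
            rw [hx']
            exact hW.mem_nhds hxW)
          filter_upwards [hev, self_mem_nhdsWithin] with y h1 h2
          have h1' : 3 / 8 < ‖((extChartAt realModel s).symm y : ℂ)‖ ^ 2 := h1
          rw [(F t).coordinate_radial _ (Or.inr (by linarith)), radial_of_le h1'.le,
            coe_symm_of_mem_range h2]
      rw [key t, key t₀]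

end Neck

/-! ### Reindexing -/

section Reindex

variable {E : Type*} [NormedAddCommGroup E] [NormedSpace ℂ E] {M : Type*}
  [TopologicalSpace M] [ChartedSpace E M]

theorem SmoothTendstoOn.comp {ι ι' V : Type*} [NormedAddCommGroup V] [NormedSpace ℝ V]
    {l : Filter ι} {l' : Filter ι'} {F : ι → ℂ → V} {F₀ : ℂ → V} {L : Set ℂ} {τ : ι' → ι}
    (h : SmoothTendstoOn l F F₀ L) (hτ : Tendsto τ l' l) :
    SmoothTendstoOn l' (fun i => F (τ i)) F₀ L :=
  ⟨hτ.eventually h.1, h.2.1, fun m v hv => hτ.eventually (h.2.2 m v hv)⟩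

/-- Each clause is a limit along the filter or holds for all indices, hence can be reindexed. This
serves both the sequence 1/(k+1) and the reversed family. -/
theorem GromovTendsto.comp {ι ι' : Type*} {l : Filter ι} {l' : Filter ι'} {S : BorderedSurface}
    {C : ι → NodalCurve} {u : ∀ i, C((C i).carrier, M)} {P : ∀ i, Parametrization S (C i)}
    {C₀ : NodalCurve} {u₀ : C(C₀.carrier, M)} {P₀ : Parametrization S C₀} {τ : ι' → ι}
    (h : GromovTendsto E l u P u₀ P₀) (hτ : Tendsto τ l' l) :
    GromovTendsto E l' (fun i => u (τ i)) (fun i => P (τ i)) u₀ P₀ where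
  uniform := h.uniform.comp hτ
  smooth s m K h1 h2 h3 h4 := (h.smooth s m K h1 h2 h3 h4).comp hτ
  avoids_nodes K h1 h2 := hτ.eventually (h.avoids_nodes K h1 h2)
  structures s K h1 h2 h3 := (h.structures s K h1 h2 h3).comp hτ
  constant_near_boundary := by
    obtain ⟨W, h1, h2, h3, h4⟩ := h.constant_near_boundary
    exact ⟨W, h1, h2, h3, fun i => h4 (τ i)⟩

end Reindex

namespace Neck

theorem gromovContinuous_fiber (F : ∀ t, Fiber t) : GromovContinuous C3 fun t => (F t).u := by
  refine ⟨UnitDisc.surface, fun t => (F t).P, ?_, gromovTendsto_fiber F⟩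
  exact continuous_point.congr fun p => ((F p.1).map_toMap p.2).symm

theorem gromovContinuous_fiber_symm (F : ∀ t, Fiber t) :
    GromovContinuous C3 fun t => (F (unitInterval.symm t)).u := by
  refine ⟨UnitDisc.surface, fun t => (F (unitInterval.symm t)).P, ?_, fun t₀ =>
    (gromovTendsto_fiber F _).comp unitInterval.continuous_symm.continuousAt⟩
  have h : Continuous fun p : unitInterval × UnitDisc => (unitInterval.symm p.1, p.2) :=
    (unitInterval.continuous_symm.comp continuous_fst).prodMk continuous_snd
  exact (continuous_point.comp h).congr fun p =>
    ((F (unitInterval.symm p.1)).map_toMap p.2).symm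

theorem gromovConverges_fiber (F : ∀ t, Fiber t) {τ : ℕ → unitInterval}
    (hτ : Tendsto τ atTop (𝓝 0)) : GromovConverges C3 (fun k => (F (τ k)).u) (F 0).u :=
  ⟨UnitDisc.surface, fun k => (F (τ k)).P, (F 0).P, (gromovTendsto_fiber F 0).comp hτ⟩

end Neck

/-! ### The closed curves and their boundaries -/

namespace TotalSpaceX

theorem eq_disc {x : TotalSpaceX} {t : ℝ} (h1 : x.fst 1 = t) (h2 : x.snd = 0) (h0 : x.fst ≠ 0) :
    x = disc t (x.fst 0) := by
  have hf : x.fst = (disc t (x.fst 0)).fst := by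
    ext i
    fin_cases i
    · rfl
    · exact h1
  exact TotalSpaceX.ext (line_eq_of_fst_ne_zero hf h0) hf h2

/-- The closed curve `{|ξ₁| ≤ 1, η₁ = t, ξ₂ = η₂ = 0}`. -/
def closedCurve (t : ℝ) : Set TotalSpaceX := {x | ‖x.fst 0‖ ≤ 1 ∧ x.fst 1 = t ∧ x.snd = 0}

theorem disc_mem_closedCurve {t : ℝ} {ζ : ℂ} (h : ‖ζ‖ ≤ 1) : disc t ζ ∈ closedCurve t :=
  ⟨h, rfl, rfl⟩

theorem closedCurve_eq {t : ℝ} (ht : t ≠ 0) : closedCurve t = disc t '' Metric.closedBall 0 1 := by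
  ext x
  constructor
  · rintro ⟨h1, h2, h3⟩
    refine ⟨x.fst 0, mem_closedBall_zero_iff.2 h1, (eq_disc h2 h3 fun h0 => ht ?_).symm⟩
    rw [h0] at h2
    simpa using h2.symm
  · rintro ⟨ζ, hζ, rfl⟩
    exact disc_mem_closedCurve (mem_closedBall_zero_iff.1 hζ)

theorem mem_bubbleE {x : TotalSpaceX} : x ∈ bubbleE ↔ x.fst = 0 ∧ x.snd = 0 := by
  rw [bubbleE_eq]
  rfl

/-- Where ξ₁ = 0 the equations η₁ = 0 and v₂ = 0 leave the line free; this is how E enters the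
limit. -/
theorem closedCurve_zero : closedCurve 0 = disc 0 '' Metric.closedBall 0 1 ∪ bubbleE := by
  ext x
  constructor
  · rintro ⟨h1, h2, h3⟩
    by_cases h0 : x.fst = 0
    · exact Or.inr (mem_bubbleE.2 ⟨h0, h3⟩)
    · exact Or.inl ⟨x.fst 0, mem_closedBall_zero_iff.2 h1, (eq_disc h2 h3 h0).symm⟩
  · rintro (⟨ζ, hζ, rfl⟩ | h)
    · exact disc_mem_closedCurve (mem_closedBall_zero_iff.1 hζ)
    · rw [mem_bubbleE] at h
      exact ⟨by simp [h.1], by simp [h.1], h.2⟩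

theorem curve_zero : curve 0 = disc 0 '' Metric.ball 0 1 ∪ bubbleE := by
  ext x
  constructor
  · rintro ⟨h1, h2, h3⟩
    by_cases h0 : x.fst = 0
    · exact Or.inr (mem_bubbleE.2 ⟨h0, h3⟩)
    · exact Or.inl ⟨x.fst 0, mem_ball_zero_iff.2 h1, (eq_disc h2 h3 h0).symm⟩
  · rintro (⟨ζ, hζ, rfl⟩ | h)
    · exact ⟨mem_ball_zero_iff.1 hζ, rfl, rfl⟩
    · rw [mem_bubbleE] at h
      exact ⟨by simp [h.1], by simp [h.1], h.2⟩

theorem disc_zero_zero_mem_bubbleE : disc 0 0 ∈ bubbleE := by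
  rw [mem_bubbleE]
  refine ⟨?_, rfl⟩
  ext i
  fin_cases i <;> simp [disc_fst]

theorem image_disc_zero_inter_bubbleE :
    disc 0 '' Metric.closedBall 0 1 ∩ bubbleE = {disc 0 0} := by
  ext x
  constructor
  · rintro ⟨⟨ζ, hζ, rfl⟩, h⟩
    have h0 : ζ = 0 := congrFun (mem_bubbleE.1 h).1 0
    rw [h0]
    rfl
  · rintro rfl
    exact ⟨⟨0, by simp, rfl⟩, disc_zero_zero_mem_bubbleE⟩

theorem disc_mem_domainD {t : ℝ} {ζ : ℂ} (h : t ≠ 0 ∨ ζ ≠ 0) : disc t ζ ∈ domainD := by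
  rw [mem_domainD]
  intro h0
  rcases h with h | h
  · exact h (Complex.ofReal_eq_zero.1 (congrFun h0 1))
  · exact h (congrFun h0 0)

theorem image_closedBall_subset_domainD {t : ℝ} (ht : t ≠ 0) :
    disc t '' Metric.closedBall 0 1 ⊆ domainD := by
  rintro _ ⟨ζ, -, rfl⟩
  exact disc_mem_domainD (Or.inl ht)

theorem image_sphere_subset_domainD (t : ℝ) : disc t '' Metric.sphere 0 1 ⊆ domainD := by
  rintro _ ⟨ζ, hζ, rfl⟩
  exact disc_mem_domainD (Or.inr (ne_zero_of_mem_sphere one_ne_zero ⟨ζ, hζ⟩))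

theorem disc_zero_zero_notMem_domainD : disc 0 0 ∉ domainD := fun h =>
  h (mem_bubbleE.1 disc_zero_zero_mem_bubbleE).1

theorem exists_compact_image_sphere_subset : ∃ K : Set TotalSpaceX, IsCompact K ∧ K ⊆ domainD ∧
    ∀ t : unitInterval, disc t '' Metric.sphere 0 1 ⊆ K := by
  -- The condition |ξ₁| = 1 holds on all the boundaries and keeps them away from Σ₁.
  refine ⟨{x | ‖x.fst 0‖ = 1 ∧ ‖x.fst 1‖ ≤ 1 ∧ x.snd = 0}, isCompact_of_norm_le ?_ 1 ?_ ?_,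
    fun x hx h0 => ?_, ?_⟩
  · exact (isClosed_eq (contMDiff_fst 0).continuous.norm continuous_const).inter
      ((isClosed_le (contMDiff_fst 1).continuous.norm continuous_const).inter
        (isClosed_eq continuous_snd_vec continuous_const))
  · rintro x ⟨h1, h2, -⟩
    rw [pi_norm_le_iff_of_nonneg zero_le_one]
    intro i
    fin_cases i
    · exact h1.le
    · exact h2
  · rintro x ⟨-, -, h⟩
    simp [h]
  · have h0' : x.fst = 0 := h0
    have h1 := hx.1
    rw [h0'] at h1
    simp at h1
  · rintro t _ ⟨ζ, hζ, rfl⟩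
    refine ⟨mem_sphere_zero_iff_norm.1 hζ, ?_, rfl⟩
    change ‖((t : ℝ) : ℂ)‖ ≤ 1
    rw [Complex.norm_real, Real.norm_eq_abs, abs_of_nonneg t.2.1]
    exact t.2.2

/-! ### The curves as analytic sets with boundary -/

theorem isClosed_closedCurve (t : ℝ) : IsClosed (closedCurve t) :=
  (isClosed_le (contMDiff_fst 0).continuous.norm continuous_const).inter
    ((isClosed_eq (contMDiff_fst 1).continuous continuous_const).inter
      (isClosed_eq continuous_snd_vec continuous_const))

theorem curve_subset_closedCurve (t : ℝ) : curve t ⊆ closedCurve t := fun _ h => ⟨h.1.le, h.2⟩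

/-- A point with |ξ₁| = 1 has v₁ ≠ 0, hence lies on the disc and is a limit of its interior points.
-/
theorem closure_curve (t : ℝ) : closure (curve t) = closedCurve t := by
  refine (closure_minimal (curve_subset_closedCurve t) (isClosed_closedCurve t)).antisymm ?_
  rintro x ⟨h1, h2, h3⟩
  rcases h1.lt_or_eq with h | h
  · exact subset_closure ⟨h, h2, h3⟩
  · have h0 : x.fst ≠ 0 := fun h0 => by simp [h0] at h
    rw [eq_disc h2 h3 h0]
    have h4 : x.fst 0 ∈ closure (Metric.ball (0 : ℂ) 1) := by
      rw [closure_ball _ one_ne_zero]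
      exact mem_closedBall_zero_iff.2 h1
    refine closure_mono ?_ (image_closure_subset_closure_image (contMDiff_disc t).continuous
      ⟨_, h4, rfl⟩)
    rintro _ ⟨ζ, hζ, rfl⟩
    exact ⟨mem_ball_zero_iff.1 hζ, rfl, rfl⟩

/-- A neighbourhood of the curve. -/
def tube (t r : ℝ) : Set TotalSpaceX :=
  {x | ‖x.fst 0‖ < 1 ∧ ‖x.fst 1 - t‖ < r ∧ ‖x.snd‖ < 1}

theorem isOpen_tube (t r : ℝ) : IsOpen (tube t r) :=
  (isOpen_lt (contMDiff_fst 0).continuous.norm continuous_const).inter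
    ((isOpen_lt ((contMDiff_fst 1).continuous.sub continuous_const).norm continuous_const).inter
      (isOpen_lt continuous_snd_vec.norm continuous_const))

theorem closure_tube_subset (t r : ℝ) :
    closure (tube t r) ⊆ {x | ‖x.fst 0‖ ≤ 1 ∧ ‖x.fst 1 - t‖ ≤ r ∧ ‖x.snd‖ ≤ 1} := by
  refine closure_minimal (fun x hx => ⟨hx.1.le, hx.2.1.le, hx.2.2.le⟩) ?_
  exact (isClosed_le (contMDiff_fst 0).continuous.norm continuous_const).inter
    ((isClosed_le ((contMDiff_fst 1).continuous.sub continuous_const).norm continuous_const).inter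
      (isClosed_le continuous_snd_vec.norm continuous_const))

theorem isCompact_closure_tube (t r : ℝ) : IsCompact (closure (tube t r)) := by
  refine isCompact_of_norm_le isClosed_closure (max 1 (r + ‖(t : ℂ)‖)) (fun x hx => ?_)
    fun x hx => (closure_tube_subset t r hx).2.2.trans (le_max_left _ _)
  obtain ⟨h1, h2, -⟩ := closure_tube_subset t r hx
  rw [pi_norm_le_iff_of_nonneg (zero_le_one.trans (le_max_left _ _))]
  intro i
  fin_cases i
  · exact h1.trans (le_max_left _ _)
  · refine le_trans ?_ (le_max_right _ _)
    calc ‖x.fst 1‖ = ‖(x.fst 1 - t) + t‖ := by rw [sub_add_cancel]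
      _ ≤ _ := (norm_add_le _ _).trans (add_le_add_left h2 _)

theorem curve_subset_tube {t r : ℝ} (hr : 0 < r) : curve t ⊆ tube t r := by
  rintro x ⟨h1, h2, h3⟩
  exact ⟨h1, by simpa [h2] using hr, by simp [h3]⟩

/-- The curve as an analytic set with boundary. -/
def curveSet (t : ℝ) {r : ℝ} (hr : 0 < r) : AnalyticSetWithBoundary C3 TotalSpaceX where
  U := tube t r
  isOpen_U := isOpen_tube t r
  isCompact_closure_U := isCompact_closure_tube t r
  C := curve t
  subset_U := curve_subset_tube hr
  analytic x hx := by
    refine ⟨tube t r, subset_rfl, isOpen_tube t r, hx, 3,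
      ![fun x => x.fst 1 - t, fun x => x.snd 0, fun x => x.snd 1], fun i => ?_, ?_⟩
    · fin_cases i
      · exact ((contMDiff_fst 1).sub contMDiff_const).contMDiffOn
      · exact (contMDiff_snd 0).contMDiffOn
      · exact (contMDiff_snd 1).contMDiffOn
    · ext y
      constructor
      · rintro ⟨⟨-, h2, h3⟩, hy⟩
        refine ⟨hy, fun i => ?_⟩
        fin_cases i <;> simp [h2, h3]
      · rintro ⟨hy, h⟩
        refine ⟨⟨hy.1, sub_eq_zero.1 (h 0), ?_⟩, hy⟩
        ext i
        fin_cases i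
        · exact h 1
        · exact h 2

theorem boundary_curveSet (t : ℝ) {r : ℝ} (hr : 0 < r) :
    (curveSet t hr).boundary = disc t '' Metric.sphere 0 1 := by
  change closure (curve t) ∩ frontier (tube t r) = _
  rw [(isOpen_tube t r).frontier_eq, closure_curve]
  ext x
  constructor
  · rintro ⟨⟨h1, h2, h3⟩, -, hx⟩
    have h : ‖x.fst 0‖ = 1 := by
      by_contra hne
      exact hx (curve_subset_tube hr ⟨lt_of_le_of_ne h1 hne, h2, h3⟩)
    refine ⟨x.fst 0, mem_sphere_zero_iff_norm.2 h, (eq_disc h2 h3 fun h0 => ?_).symm⟩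
    simp [h0] at h
  · rintro ⟨ζ, hζ, rfl⟩
    have hζ' := mem_sphere_zero_iff_norm.1 hζ
    have hx : disc t ζ ∈ closedCurve t := disc_mem_closedCurve hζ'.le
    refine ⟨hx, ?_, fun h => h.1.ne hζ'⟩
    rw [← closure_curve] at hx
    exact closure_mono (curve_subset_tube hr) hx

/-! ### Regular points and pure dimension -/

theorem surjective_mfderiv_of_section {F E M : Type*} [NormedAddCommGroup F] [NormedSpace ℂ F]
    [NormedAddCommGroup E] [NormedSpace ℂ E] [TopologicalSpace M] [ChartedSpace E M]
    {g : M → F} {σ : F → M} {x : M} {a : F} (hσ : MDifferentiableAt 𝓘(ℂ, F) 𝓘(ℂ, E) σ a)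
    (hx : σ a = x) (hg : MDifferentiableAt 𝓘(ℂ, E) 𝓘(ℂ, F) g x) (h : g ∘ σ = id) :
    Function.Surjective (mfderiv 𝓘(ℂ, E) 𝓘(ℂ, F) g x) := by
  subst hx
  have h1 := mfderiv_comp a hg hσ
  rw [h, mfderiv_id] at h1
  exact fun v => ⟨mfderiv 𝓘(ℂ, F) 𝓘(ℂ, E) σ a v, (congrArg (fun L => L v) h1).symm⟩

theorem finrank_C3 : Module.finrank ℂ C3 = 3 := by
  simp [C3, Module.finrank_prod]

theorem contMDiff_vec2 {g₀ g₁ : TotalSpaceX → ℂ} (h₀ : ContMDiff 𝓘(ℂ, C3) 𝓘(ℂ) ω g₀)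
    (h₁ : ContMDiff 𝓘(ℂ, C3) 𝓘(ℂ) ω g₁) :
    ContMDiff 𝓘(ℂ, C3) 𝓘(ℂ, Fin 2 → ℂ) ω fun x => ![g₀ x, g₁ x] := by
  rw [contMDiff_pi_space]
  intro i
  fin_cases i
  · exact h₀
  · exact h₁

/-- Where ξ₁ ≠ 0 two equations suffice, η₁ = t and ξ₂ = 0, because v₂ lies on a line with non-zero
first entry. -/
theorem isRegularPoint_disc (t : ℝ) {ζ : ℂ} (h0 : ζ ≠ 0) (h1 : ‖ζ‖ < 1) :
    IsRegularPointOfDim C3 (curve t) 1 (disc t ζ) := by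
  refine ⟨⟨h1, rfl, rfl⟩, 2, by rw [finrank_C3], {x | x.fst 0 ≠ 0 ∧ ‖x.fst 0‖ < 1}, ?_, ⟨h0, h1⟩,
    fun x => ![x.fst 1 - t, x.snd 0], ?_, ?_, ?_⟩
  · exact (isOpen_ne_fun (contMDiff_fst 0).continuous continuous_const).inter
      (isOpen_lt (contMDiff_fst 0).continuous.norm continuous_const)
  · exact (contMDiff_vec2 ((contMDiff_fst 1).sub contMDiff_const) (contMDiff_snd 0)).contMDiffOn
  · have hv : ∀ a : Fin 2 → ℂ, (![ζ, t + a 0] : Fin 2 → ℂ) ≠ 0 := fun a h =>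
      h0 (congrFun h 0)
    -- The section has η₁ = t + a₀, and the division by ζ makes ξ₂ = a₁.
    refine surjective_mfderiv_of_section (σ := fun a : Fin 2 → ℂ => ofVec ![ζ, t + a 0] 1 (a 1 / ζ))
      (a := 0) ?_ ?_ ?_ ?_
    · refine (contMDiffAt_ofVec (v := fun a : Fin 2 → ℂ => ![ζ, t + a 0]) (a := fun _ => 1)
        (b := fun a => a 1 / ζ) (contDiffAt_pi.2 fun i => ?_) contDiffAt_const
        ((contDiff_apply ℂ ℂ 1).contDiffAt.div contDiffAt_const h0) (hv 0)).mdifferentiableAt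
          (by simp)
      fin_cases i
      · exact contDiffAt_const
      · exact contDiffAt_const.add (contDiff_apply ℂ ℂ 0).contDiffAt
    · have h2 : ![ζ, (t : ℂ) + (0 : Fin 2 → ℂ) 0] = ![ζ, (t : ℂ)] := by simp
      have h := hv 0
      rw [h2] at h
      change ofVec ![ζ, (t : ℂ) + (0 : Fin 2 → ℂ) 0] 1 ((0 : Fin 2 → ℂ) 1 / ζ) = _
      rw [h2, eq_disc (x := ofVec ![ζ, (t : ℂ)] 1 ((0 : Fin 2 → ℂ) 1 / ζ)) (t := t)]
      · simp [ofVec_fst h]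
      · simp [ofVec_fst h]
      · simp [ofVec_snd h]
      · simpa [ofVec_fst h] using h
    · exact (contMDiff_vec2 ((contMDiff_fst 1).sub contMDiff_const)
        (contMDiff_snd 0)).contMDiffAt.mdifferentiableAt (by simp)
    · funext a
      ext i
      fin_cases i
      · simp [ofVec_fst (hv a)]
      · simp [ofVec_snd (hv a), h0]
  · ext y
    constructor
    · rintro ⟨⟨h2, h3, h4⟩, hy⟩
      exact ⟨hy, by simp [h3, h4]⟩
    · rintro ⟨hy, h⟩
      refine ⟨⟨hy.2, sub_eq_zero.1 (congrFun h 0), ?_⟩, hy⟩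
      have h2 : y.snd 0 = 0 := congrFun h 1
      have hm := y.fst_mem
      have hm' := y.snd_mem
      rw [Projectivization.submodule_eq, Submodule.mem_span_singleton] at hm hm'
      obtain ⟨a, ha⟩ := hm
      obtain ⟨b, hb⟩ := hm'
      have h3 : y.line.rep 0 ≠ 0 := fun h3 => hy.1 (by rw [← ha]; simp [h3])
      have h4 : b = 0 := by
        rw [← hb] at h2
        exact (mul_eq_zero.1 h2).resolve_right h3
      rw [← hb, h4, zero_smul]

/-- The second chart omits the node, and in it the bubble is cut out by the fibre coordinates η₁ and
η₂. -/
theorem isRegularPoint_bubble {x : TotalSpaceX} (hx : x ∈ bubbleE) (hx1 : x ∈ (chart 1).source) :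
    IsRegularPointOfDim C3 (curve 0) 1 x := by
  rw [mem_bubbleE] at hx
  refine ⟨⟨by simp [hx.1], by simp [hx.1], hx.2⟩, 2, by rw [finrank_C3],
    (chart 1).source ∩ {x | ‖x.fst 0‖ < 1}, ?_, ⟨hx1, by simp [hx.1]⟩,
    fun x => ![x.fst 1, x.snd 1], ?_, ?_, ?_⟩
  · exact (chart 1).open_source.inter
      (isOpen_lt (contMDiff_fst 0).continuous.norm continuous_const)
  · exact (contMDiff_vec2 (contMDiff_fst 1) (contMDiff_snd 1)).contMDiffOn
  · refine surjective_mfderiv_of_section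
      (σ := fun a : Fin 2 → ℂ => (chart 1).symm ((chart 1 x).1, a 0, a 1)) (a := 0) ?_ ?_ ?_ ?_
    · refine ((contMDiff_chart_symm 1).comp (ContDiff.contMDiff ?_)).contMDiffAt.mdifferentiableAt
        (n := ω) (by simp)
      exact contDiff_const.prodMk ((contDiff_apply ℂ ℂ 0).prodMk (contDiff_apply ℂ ℂ 1))
    · conv_rhs => rw [← chart_symm_left_inv hx1]
      congr 1
      rw [chart_apply, hx.1, hx.2]
      rfl
    · exact (contMDiff_vec2 (contMDiff_fst 1) (contMDiff_snd 1)).contMDiffAt.mdifferentiableAt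
        (by simp)
    · funext a
      ext i
      fin_cases i
      · simp [chart_symm_fst, vec]
      · simp [chart_symm_snd, vec]
  · ext y
    constructor
    · rintro ⟨⟨h2, h3, h4⟩, hy⟩
      exact ⟨hy, by simp [h3, h4]⟩
    · rintro ⟨hy, h⟩
      have h1 : y.fst 1 = 0 := congrFun h 0
      have h2 : y.snd 1 = 0 := congrFun h 1
      refine ⟨⟨hy.2, by simp [h1], ?_⟩, hy⟩
      rw [snd_apply_eq y hy.1, h2, zero_smul]

/-- The point ζ = 0, which is the node when t = 0, is a limit of regular points. -/
theorem disc_mem_closure_regular (t : ℝ) {ζ : ℂ} (h1 : ‖ζ‖ < 1) :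
    disc t ζ ∈ closure {x | IsRegularPointOfDim C3 (curve t) 1 x} := by
  have h2 : ζ ∈ closure (Metric.ball (0 : ℂ) 1 ∩ {0}ᶜ) :=
    (dense_compl_singleton (0 : ℂ)).open_subset_closure_inter Metric.isOpen_ball
      (mem_ball_zero_iff.2 h1)
  refine closure_mono ?_ (image_closure_subset_closure_image (contMDiff_disc t).continuous
    ⟨ζ, h2, rfl⟩)
  rintro _ ⟨z, ⟨hz, hz0⟩, rfl⟩
  exact isRegularPoint_disc t hz0 (mem_ball_zero_iff.1 hz)

theorem isPure_curveSet (t : ℝ) {r : ℝ} (hr : 0 < r) : (curveSet t hr).IsPure 1 := by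
  rintro x ⟨h1, h2, h3⟩
  by_cases h0 : x.fst = 0
  · have ht : t = 0 := by
      rw [h0] at h2
      simpa using h2.symm
    subst ht
    have hx : x ∈ bubbleE := mem_bubbleE.2 ⟨h0, h3⟩
    rcases Neck.bubbleE_eq_disc_or hx with h | ⟨w, h⟩
    · rw [h]
      exact disc_mem_closure_regular 0 (by simp)
    · refine subset_closure (isRegularPoint_bubble hx ?_)
      rw [h]
      exact chart_symm_mem 1 _
  · rw [eq_disc h2 h3 h0]
    exact disc_mem_closure_regular t h1

/-! ### Hausdorff convergence -/

theorem _root_.tendsto_range_vietoris {ι T K M : Type*} [TopologicalSpace T] [TopologicalSpace K]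
    [CompactSpace K] [TopologicalSpace M] {Ψ : T → K → M} (hΨ : Continuous fun p : T × K => Ψ p.1 p.2)
    {l : Filter ι} {τ : ι → T} {t₀ : T} (hτ : Tendsto τ l (𝓝 t₀)) :
    Tendsto (fun i => range (Ψ (τ i))) l (@nhds (Set M) (TopologicalSpace.vietoris M)
      (range (Ψ t₀))) := by
  let _ : TopologicalSpace (Set M) := TopologicalSpace.vietoris M
  -- For the subbasic sets of the Vietoris topology: the range lies in U for an open set of t
  -- because the projection along the compact K is closed, and it meets U for an open set of t
  -- because projections are open.
  have h : Continuous fun t => range (Ψ t) := by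
    refine continuous_generateFrom_iff.2 ?_
    rintro _ (⟨U, hU, rfl⟩ | ⟨U, hU, rfl⟩)
    · have h1 : IsClosed (Prod.fst '' {p : T × K | Ψ p.1 p.2 ∈ Uᶜ}) :=
        isClosedMap_fst_of_compactSpace _ (IsClosed.preimage hΨ (IsOpen.isClosed_compl hU))
      convert h1.isOpen_compl using 1
      ext t
      simp [range_subset_iff]
    · have h1 : IsOpen (Prod.fst '' {p : T × K | Ψ p.1 p.2 ∈ U}) :=
        isOpenMap_fst _ (IsOpen.preimage hΨ hU)
      convert h1 using 1
      ext t
      simp only [mem_preimage, mem_image, Prod.exists]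
      constructor
      · rintro ⟨_, ⟨k, rfl⟩, hk⟩
        exact ⟨t, k, hk, rfl⟩
      · rintro ⟨_, k, hk, rfl⟩
        exact ⟨_, ⟨k, rfl⟩, hk⟩
  exact h.continuousAt.tendsto.comp hτ

end TotalSpaceX

namespace Neck

/-- The disc covers each closed curve, so that Hausdorff convergence can be read off from the
continuous family. -/
theorem range_point (t : unitInterval) :
    range (fun s : UnitDisc => point √(t : ℝ) s) = TotalSpaceX.closedCurve t := by
  obtain ⟨F⟩ := nonempty_fiber t
  have h : (fun s : UnitDisc => point √(t : ℝ) s) = F.u ∘ F.P.toMap :=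
    funext fun s => (F.map_toMap s).symm
  rw [h, F.toMap_surjective.range_comp]
  rcases eq_or_ne t 0 with rfl | ht
  · exact (F.range_zero rfl).trans TotalSpaceX.closedCurve_zero.symm
  · rw [F.range_of_pos (unitInterval.pos_iff_ne_zero.2 ht), TotalSpaceX.closedCurve_eq]
    exact fun h => ht (Subtype.ext h)

theorem tendsto_closedCurve {ι : Type*} {l : Filter ι} {τ : ι → unitInterval} {t₀ : unitInterval}
    (hτ : Tendsto τ l (𝓝 t₀)) : Tendsto (fun i => TotalSpaceX.closedCurve (τ i)) l
      (@nhds (Set TotalSpaceX) (TopologicalSpace.vietoris TotalSpaceX)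
        (TotalSpaceX.closedCurve t₀)) := by
  simp only [← range_point]
  exact tendsto_range_vietoris (Ψ := fun (t : unitInterval) (s : UnitDisc) => point √(t : ℝ) s)
    continuous_point hτ

theorem range_point_sphere (t : unitInterval) :
    range (fun s : Metric.sphere (0 : ℂ) 1 => point √(t : ℝ) s) =
      TotalSpaceX.disc t '' Metric.sphere 0 1 := by
  rw [image_eq_range]
  refine congrArg range (funext fun s => ?_)
  have hs : ‖(s : ℂ)‖ = 1 := mem_sphere_zero_iff_norm.1 s.2
  rw [point_eq_disc (sqrt_mem_Icc t).1 (sqrt_mem_Icc t).2 (Or.inr (by rw [hs]; norm_num)),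
    Real.sq_sqrt t.2.1, radial_of_le (by rw [hs]; norm_num)]

theorem tendsto_image_sphere {ι : Type*} {l : Filter ι} {τ : ι → unitInterval} {t₀ : unitInterval}
    (hτ : Tendsto τ l (𝓝 t₀)) : Tendsto (fun i => TotalSpaceX.disc (τ i) '' Metric.sphere 0 1) l
      (@nhds (Set TotalSpaceX) (TopologicalSpace.vietoris TotalSpaceX)
        (TotalSpaceX.disc t₀ '' Metric.sphere 0 1)) := by
  simp only [← range_point_sphere]
  have h : Continuous fun p : unitInterval × Metric.sphere (0 : ℂ) 1 => point √(p.1 : ℝ) p.2 :=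
    continuous_point.comp (continuous_fst.prodMk
      ((continuous_inclusion Metric.sphere_subset_closedBall).comp continuous_snd))
  exact tendsto_range_vietoris
    (Ψ := fun (t : unitInterval) (s : Metric.sphere (0 : ℂ) 1) => point √(t : ℝ) s) h hτ

end Neck

/-! ### The hypotheses and the failure of the continuity principles -/

namespace Neck

/-- At time 1 the reversed family has reached C₀, whose node is not in D, whereas R lies over D. -/
theorem not_continuousLift (F : ∀ t, Fiber t) (R : HolomorphicExtension C3 TotalSpaceX.domainD) :
    ¬ ContinuousLift R fun t => (F (unitInterval.symm t)).u := by
  rintro ⟨v, -, -, hv⟩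
  obtain ⟨a, -, ha⟩ := (F (unitInterval.symm 1)).nodes_zero unitInterval.symm_one
  have h := TotalSpaceX.proj_mem_domainD R (v 1 a)
  rw [hv, ha] at h
  exact TotalSpaceX.disc_zero_zero_notMem_domainD h

theorem continuousHypotheses_fiber (F : ∀ t, Fiber t) :
    ContinuousHypotheses (E := C3) TotalSpaceX.domainD fun t => (F (unitInterval.symm t)).u where
  isConnected := TotalSpaceX.isConnected_domainD
  holomorphic t := (F (unitInterval.symm t)).isHolomorphic
  continuous := gromovContinuous_fiber_symm F
  initial := by
    have h : (0 : unitInterval) < unitInterval.symm 0 := by simp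
    rw [(F (unitInterval.symm 0)).range_of_pos h]
    exact TotalSpaceX.image_closedBall_subset_domainD (by simp)
  boundary t := by
    rw [(F (unitInterval.symm t)).image_boundary]
    exact TotalSpaceX.image_sphere_subset_domainD _

/-- The sequence `1 / (k + 1)` in the unit interval. -/
def oneDiv (k : ℕ) : unitInterval :=
  ⟨1 / (k + 1), by positivity, by
    rw [div_le_one (by positivity)]
    linarith [(Nat.cast_nonneg k : (0 : ℝ) ≤ k)]⟩

theorem oneDiv_pos (k : ℕ) : 0 < (oneDiv k : ℝ) := by
  change (0 : ℝ) < 1 / (k + 1)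
  positivity

theorem tendsto_zero_of_eq_one_div {τ : ℕ → unitInterval} (h : ∀ k, (τ k : ℝ) = 1 / (k + 1)) :
    Tendsto τ atTop (𝓝 0) := by
  rw [tendsto_subtype_rng]
  simp only [h]
  exact tendsto_one_div_add_atTop_nhds_zero_nat

/-- The smooth curves as analytic sets with boundary. -/
abbrev smoothCurve (k : ℕ) : AnalyticSetWithBoundary C3 TotalSpaceX :=
  TotalSpaceX.curveSet (oneDiv k) (half_pos (oneDiv_pos k))

/-- The nodal curve as an analytic set with boundary. -/
abbrev nodalCurve : AnalyticSetWithBoundary C3 TotalSpaceX :=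
  TotalSpaceX.curveSet (0 : unitInterval) one_pos

theorem discreteHypotheses :
    DiscreteHypotheses TotalSpaceX.domainD 1 smoothCurve nodalCurve where
  isConnected := TotalSpaceX.isConnected_domainD
  one_le := le_rfl
  lt_dim := by
    rw [TotalSpaceX.finrank_C3]
    norm_num
  -- The tube has radius t/2, and |η₁ - t| ≤ t/2 excludes η₁ = 0.
  inside k x hx h0 := by
    have h := (TotalSpaceX.closure_tube_subset _ _ hx).2.1
    have h0' : x.fst = 0 := h0
    rw [h0', Pi.zero_apply, zero_sub, norm_neg, Complex.norm_real, Real.norm_eq_abs,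
      abs_of_pos (oneDiv_pos k)] at h
    linarith [oneDiv_pos k]
  pure k := TotalSpaceX.isPure_curveSet _ _
  pure_limit := TotalSpaceX.isPure_curveSet _ _
  tendsto_closure := by
    have h := tendsto_closedCurve (tendsto_zero_of_eq_one_div (τ := oneDiv) fun _ => rfl)
    simp only [← TotalSpaceX.closure_curve] at h
    exact h
  tendsto_boundary := by
    have h := tendsto_image_sphere (tendsto_zero_of_eq_one_div (τ := oneDiv) fun _ => rfl)
    unfold HausdorffTendsto
    simp only [TotalSpaceX.boundary_curveSet]
    exact h
  boundary_subset := by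
    rw [TotalSpaceX.boundary_curveSet]
    exact TotalSpaceX.image_sphere_subset_domainD _

/-- Surjectivity onto C₀ is already impossible: a preimage of the node would lie over a point
outside D. -/
theorem not_discreteLift (R : HolomorphicExtension C3 TotalSpaceX.domainD) :
    ¬ DiscreteLift R smoothCurve nodalCurve := by
  rintro ⟨B, ⟨h, -, hs⟩, -⟩
  have h0 : TotalSpaceX.disc 0 0 ∈ nodalCurve.C := by
    change TotalSpaceX.disc 0 0 ∈ TotalSpaceX.curve ((0 : unitInterval) : ℝ)
    exact ⟨by simp [TotalSpaceX.disc_fst], by simp [TotalSpaceX.disc_fst], rfl⟩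
  obtain ⟨b, hb⟩ := hs ⟨_, h0⟩
  have h1 : R.proj b = TotalSpaceX.disc 0 0 := congrArg Subtype.val hb
  have h2 := TotalSpaceX.proj_mem_domainD R b
  rw [h1] at h2
  exact TotalSpaceX.disc_zero_zero_notMem_domainD h2

end Neck

end

theorem mainTheorem12 :
    -- `X` is a connected complex threefold which is not Stein
    (T2Space TotalSpaceX ∧ SecondCountableTopology TotalSpaceX ∧ ConnectedSpace TotalSpaceX ∧
      ¬ IsStein C3 TotalSpaceX) ∧
    -- `D` is a domain on which the function is holomorphic; it does not extend meromorphically to a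
    -- neighbourhood of any point of the complement of `D`, in particular of any point of `E`
    (IsConnected (TotalSpaceX.domainD : Set TotalSpaceX) ∧
      ContMDiffOn 𝓘(ℂ, C3) 𝓘(ℂ) ω TotalSpaceX.expRatio TotalSpaceX.domainD ∧
      TotalSpaceX.bubbleE ⊆ TotalSpaceX.hypersurface ∧
      ∀ x ∈ TotalSpaceX.hypersurface,
        ¬ ExtendsMeromorphicallyAt C3 TotalSpaceX.domainD TotalSpaceX.expRatio x) ∧
    -- the discs are embedded; `C_t` is a disc for `t > 0`, and a disc plus the bubble for `t = 0`
    (∀ t : unitInterval, ContMDiff 𝓘(ℂ) 𝓘(ℂ, C3) ω (TotalSpaceX.disc t) ∧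
      IsEmbedding (TotalSpaceX.disc t) ∧
      ∀ ζ : ℂ, Function.Injective (mfderiv 𝓘(ℂ) 𝓘(ℂ, C3) (TotalSpaceX.disc t) ζ)) ∧
    (∀ t : unitInterval, 0 < t →
      TotalSpaceX.curve t = TotalSpaceX.disc t '' Metric.ball 0 1 ∧
      TotalSpaceX.disc t '' Metric.closedBall 0 1 ⊆ TotalSpaceX.domainD) ∧
    TotalSpaceX.curve 0 = TotalSpaceX.disc 0 '' Metric.ball 0 1 ∪ TotalSpaceX.bubbleE ∧
    TotalSpaceX.disc 0 '' Metric.closedBall 0 1 ∩ TotalSpaceX.bubbleE = {TotalSpaceX.disc 0 0} ∧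
    -- the boundaries of all the discs stay in a compact subset of `D`
    (∃ K : Set TotalSpaceX, IsCompact K ∧ K ⊆ TotalSpaceX.domainD ∧
      ∀ t : unitInterval, TotalSpaceX.disc t '' Metric.sphere 0 1 ⊆ K) ∧
    -- the Gromov continuous family, and the failure of the continuous continuity principle
    (∃ (C : unitInterval → NodalCurve) (u : ∀ t, C((C t).carrier, TotalSpaceX)),
      (∀ t, (C t).IsHolomorphic C3 (u t) ∧ Function.Injective (u t) ∧
        u t '' (C t).boundary = TotalSpaceX.disc t '' Metric.sphere 0 1) ∧
      (∀ t, 0 < t → (C t).nodes = ∅ ∧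
        range (u t) = TotalSpaceX.disc t '' Metric.closedBall 0 1) ∧
      (∃ a, (C 0).nodes = {a} ∧ u 0 a = TotalSpaceX.disc 0 0) ∧
      range (u 0) = TotalSpaceX.disc 0 '' Metric.closedBall 0 1 ∪ TotalSpaceX.bubbleE ∧
      GromovContinuous C3 u ∧
      (∀ τ : ℕ → unitInterval, (∀ k, (τ k : ℝ) = 1 / (k + 1)) →
        GromovConverges C3 (fun k => u (τ k)) (u 0)) ∧
      ContinuousHypotheses (E := C3) TotalSpaceX.domainD (fun t => u (unitInterval.symm t)) ∧
      ∀ R : HolomorphicExtension C3 TotalSpaceX.domainD, R.IsEnvelope →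
        ¬ ContinuousLift R (fun t => u (unitInterval.symm t))) ∧
    -- the failure of the discrete continuity principle for `C_{1/k}`
    (∃ (A : ℕ → AnalyticSetWithBoundary C3 TotalSpaceX)
        (A₀ : AnalyticSetWithBoundary C3 TotalSpaceX),
      (∀ k : ℕ, (A k).C = TotalSpaceX.curve (1 / (k + 1)) ∧
        (A k).boundary = TotalSpaceX.disc (1 / (k + 1)) '' Metric.sphere 0 1) ∧
      A₀.C = TotalSpaceX.curve 0 ∧
      A₀.boundary = TotalSpaceX.disc 0 '' Metric.sphere 0 1 ∧
      DiscreteHypotheses TotalSpaceX.domainD 1 A A₀ ∧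
      ∀ R : HolomorphicExtension C3 TotalSpaceX.domainD, R.IsEnvelope →
        ¬ DiscreteLift R A A₀) ∧
    -- the envelope of holomorphy exists, so that both principles are false in `X`
    (∃ R : HolomorphicExtension C3 TotalSpaceX.domainD, R.IsEnvelope) ∧
    ¬ DiscreteContinuityPrinciple C3 TotalSpaceX ∧
    ¬ ContinuousContinuityPrinciple C3 TotalSpaceX := by
  let F : ∀ t, Neck.Fiber t := fun t => (Neck.nonempty_fiber t).some
  refine ⟨⟨inferInstance, inferInstance, inferInstance, TotalSpaceX.not_isStein⟩,
    ⟨TotalSpaceX.isConnected_domainD, TotalSpaceX.contMDiffOn_expRatio,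
      TotalSpaceX.bubbleE_subset_hypersurface,
      fun x hx => TotalSpaceX.not_extendsMeromorphicallyAt hx⟩,
    fun t => ⟨TotalSpaceX.contMDiff_disc t, TotalSpaceX.isEmbedding_disc t,
      TotalSpaceX.injective_mfderiv_disc t⟩,
    fun t ht => ?_, TotalSpaceX.curve_zero, TotalSpaceX.image_disc_zero_inter_bubbleE,
    TotalSpaceX.exists_compact_image_sphere_subset,
    ⟨fun t => (F t).C, fun t => (F t).u,
      fun t => ⟨(F t).isHolomorphic, (F t).injective, (F t).image_boundary⟩,
      fun t ht => ⟨(F t).nodes_of_pos ht, (F t).range_of_pos ht⟩, (F 0).nodes_zero rfl,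
      (F 0).range_zero rfl, Neck.gromovContinuous_fiber F,
      fun τ hτ => Neck.gromovConverges_fiber F (Neck.tendsto_zero_of_eq_one_div hτ),
      Neck.continuousHypotheses_fiber F, fun R _ => Neck.not_continuousLift F R⟩,
    ⟨Neck.smoothCurve, Neck.nodalCurve,
      fun k => ⟨rfl, TotalSpaceX.boundary_curveSet _ _⟩, rfl, TotalSpaceX.boundary_curveSet _ _,
      Neck.discreteHypotheses, fun R _ => Neck.not_discreteLift R⟩,
    ⟨TotalSpaceX.trivialExtension, TotalSpaceX.isEnvelope_trivialExtension⟩, fun h => ?_,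
    fun h => ?_⟩
  · have ht' : (t : ℝ) ≠ 0 := ne_of_gt ht
    exact ⟨TotalSpaceX.curve_eq_image_disc ht', TotalSpaceX.image_closedBall_subset_domainD ht'⟩
  · exact Neck.not_discreteLift _ (h _ 1 _ _ Neck.discreteHypotheses _
      TotalSpaceX.isEnvelope_trivialExtension)
  · exact Neck.not_continuousLift F _ (h _ _ _ (Neck.continuousHypotheses_fiber F) _
      TotalSpaceX.isEnvelope_trivialExtension)
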